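/- Let $q,d\in\mathbb C^\times$ be generic, i.e. $q^md^n=1$ with $m,n\in\mathbb Z$ only for $m=n=0$, and set $q_1=q^{-1}d$, $q_2=q^2$, $q_3=q^{-1}d^{-1}$, $g_{i,i}(z,w)=z-q_2w$ and $g_{i,j}(z,w)=(z-q_1w)(z-q_3w)$ for $i\neq j$, where $i,j\in\mathbb Z/2\mathbb Z$. Let $\mathcal E$ be the quantum toroidal algebra of type $\mathfrak{gl}_2$: the unital associative $\mathbb C$-algebra generated by the coefficients of $E_i(z)=\sum_{k\in\mathbb Z}E_{i,k}z^{-k}$, $F_i(z)=\sum_{k\in\mathbb Z}F_{i,k}z^{-k}$, $K_i^\pm(z)=K_i^{\pm1}\exp\bigl(\pm(q-q^{-1})\sum_{r>0}H_{i,\pm r}z^{\mp r}\bigr)$ $(i\in\mathbb Z/2\mathbb Z)$ and by a central invertible element $\mathsf t$, with the relations that all coefficients of all $K_i^\pm(z)$ commute and $$(-1)^{i+j}g_{i,j}(z,w)K_i^\pm(z)E_j(w)+g_{j,i}(w,z)E_j(w)K_i^\pm(z)=0,\qquad (-1)^{i+j}g_{j,i}(w,z)K_i^\pm(z)F_j(w)+g_{i,j}(z,w)F_j(w)K_i^\pm(z)=0,$$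 $$[E_i(z),F_j(w)]=\tfrac{\delta_{i,j}}{q-q^{-1}}\,\delta(z/w)\bigl(K_i^+(w)-K_i^-(z)\bigr),$$ $$(-1)^{i+j}g_{i,j}(z,w)E_i(z)E_j(w)+g_{j,i}(w,z)E_j(w)E_i(z)=0,\qquad (-1)^{i+j}g_{j,i}(w,z)F_i(z)F_j(w)+g_{i,j}(z,w)F_j(w)F_i(z)=0,$$ $$\mathrm{Sym}_{z_1,z_2,z_3}[E_i(z_1),[E_i(z_2),[E_i(z_3),E_{i+1}(w)]_{q^2}]]_{q^{-2}}=0,\qquad \mathrm{Sym}_{z_1,z_2,z_3}[F_i(z_1),[F_i(z_2),[F_i(z_3),F_{i+1}(w)]_{q^2}]]_{q^{-2}}=0,$$ where $\delta(z)=\sum_{k\in\mathbb Z}z^k$, $[A,B]_p=AB-pBA$ and $\mathrm{Sym}$ is the average over permutations. A vector $v$ of an $\mathcal E$-module has $\ell$-weight $\phi=(\phi^0,\phi^1)$, a pair of rational functions, if $K_i^\pm(z)v=\phi^i(z)v$ for $i=0,1$, with $\phi^i$ expanded at $z=\infty$ for $K_i^+$ and at $z=0$ for $K_i^-$. A module is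 tame if it has a basis of $\ell$-weight vectors with pairwise distinct $\ell$-weights. It is a highest $\ell$-weight module of highest $\ell$-weight $\phi$ if it is generated by a non-zero vector $v$ of $\ell$-weight $\phi$ with $E_0(z)v=E_1(z)v=0$. It has level $\kappa$ if $K_0K_1$ acts as the scalar $\kappa$. A box $\Box=(x,y,z)\in\mathbb Z_{\ge0}^3$ has color $c(\Box)=x+z$ mod $2$ and position $p(\Box)=q_1^{-x}q_2^{-y}q_3^{-z}$; boxes are totally ordered lexicographically with priority $y$, then $z$, then $x$. A plane partition is identified with its Young diagram, a finite set $\lambda$ of boxes such that with every box $\lambda$ contains all boxes of $\mathbb Z_{\ge0}^3$ with coordinatewise smaller or equal coordinates. A box $\Box\notin\lambda$ is concave for $\lambda$ if $\lambda\sqcup\Box$ is a plane partition, and a box $\Box\in\lambda$ is convex if $\lambda\setminus\Box$ is one; $CC_i(\lambda)$ and $CV_i(\lambda)$ are the sets of concave and convex boxes of color $i$. For $a\in\mathbb C^\times$ let $A_{c,a}(z)$ be the pair of rational functions with component $c$ equal to $\frac{q_2z-a}{z-q_2a}$ and the other component equal to $\frac{(q_1z-a)(q_3z-a)}{(z-q_1a)(z-q_3a)}$.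 Let $\kappa\in\mathbb C^\times$ be generic in the sense that $\kappa^2\ne q_1^iq_2^jq_3^k$ for all integers $i,j,k\ge 0$ with $i+k$ even, and let $\Psi(z)=\bigl(\frac{\kappa z-\kappa^{-1}}{z-1},\,1\bigr)$. Put $$\phi_\lambda=\Psi\prod_{\Box\in\lambda}A^{-1}_{c(\Box),p(\Box)},\qquad \phi_{\lambda,<\Box}=\Psi\prod_{\Box_1\in\lambda,\ \Box_1<\Box}A^{-1}_{c(\Box_1),p(\Box_1)},\qquad \phi_{\lambda,>\Box}=\prod_{\Box_1\in\lambda,\ \Box_1>\Box}A^{-1}_{c(\Box_1),p(\Box_1)}.$$ Then for $\Box\in CC_i(\lambda)$ the function $\phi^i_{\lambda,>\Box}$ is regular at $p(\Box)$, and on the vector space $M_0^\kappa$ with basis $|\lambda\rangle$ labelled by all plane partitions $\lambda$ the formulas $$K_i^\pm(z)|\lambda\rangle=\phi^i_\lambda(z)|\lambda\rangle,\qquad \mathsf t\,|\lambda\rangle=|\lambda\rangle,$$ $$F_i(z)|\lambda\rangle=\sum_{\Box\in CC_i(\lambda)}\phi^i_{\lambda,>\Box}(p(\Box))\,\delta\bigl(z/p(\Box)\bigr)\,|\lambda\sqcup\Box\rangle,$$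 $$E_i(z)|\lambda\rangle=\sum_{\Box\in CV_i(\lambda)}\Bigl(\tfrac1{q-q^{-1}}\operatorname*{res}_{z=p(\Box)}\phi^i_{\lambda,<\Box}(z)\tfrac{dz}z\Bigr)\delta\bigl(z/p(\Box)\bigr)\,|\lambda\setminus\Box\rangle$$ define an $\mathcal E$-module. This module (the MacMahon module) is irreducible and tame, it is a highest $\ell$-weight module of highest $\ell$-weight $\Psi$, and its level is $\kappa$. -/

import Mathlib

namespace Toroidal

noncomputable section

/-! ### Parameters and the structure functions -/

/-- The parameter `q₁ = q⁻¹ d`. -/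
def q₁ (q d : ℂ) : ℂ := q⁻¹ * d

/-- The parameter `q₂ = q²`. -/
def q₂ (q : ℂ) : ℂ := q ^ 2

/-- The parameter `q₃ = q⁻¹ d⁻¹`. -/
def q₃ (q d : ℂ) : ℂ := q⁻¹ * d⁻¹

section Series

variable {A : Type*} [Ring A] [Algebra ℂ A]

/-- A formal series `T(z,w) = ∑ T_{a,b} z^{-a} w^{-b}` is given by its coefficients
`T : ℤ → ℤ → A`. This is the product `g_{i,j}(z,w) T(z,w)`, where
`g_{i,i}(z,w) = z - q₂ w` and `g_{i,j}(z,w) = (z - q₁ w)(z - q₃ w)` for `i ≠ j`. -/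
def gMul (q d : ℂ) (i j : ZMod 2) (T : ℤ → ℤ → A) : ℤ → ℤ → A := fun a b =>
  if i = j then T (a + 1) b - q₂ q • T a (b + 1)
  else T (a + 2) b - (q₁ q d + q₃ q d) • T (a + 1) (b + 1) + (q₁ q d * q₃ q d) • T a (b + 2)

/-- The product `g_{i,j}(w,z) T(z,w)`. -/
def gMulSwap (q d : ℂ) (i j : ZMod 2) (T : ℤ → ℤ → A) : ℤ → ℤ → A := fun a b =>
  gMul q d i j (fun b' a' => T a' b') b a

/-- The sign `(-1)^{i+j}`. -/
def sgn (i j : ZMod 2) : ℂ := if i = j then 1 else -1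

/-- The coefficient of `z^{-a} w^{-b}` in
`(-1)^{i+j} g_{i,j}(z,w) X(z) Y(w) + g_{j,i}(w,z) Y(w) X(z)`. -/
def exchangeE (q d : ℂ) (i j : ZMod 2) (X Y : ℤ → A) (a b : ℤ) : A :=
  sgn i j • gMul q d i j (fun a' b' => X a' * Y b') a b
    + gMulSwap q d j i (fun a' b' => Y b' * X a') a b

/-- The coefficient of `z^{-a} w^{-b}` in
`(-1)^{i+j} g_{j,i}(w,z) X(z) Y(w) + g_{i,j}(z,w) Y(w) X(z)`. -/
def exchangeF (q d : ℂ) (i j : ZMod 2) (X Y : ℤ → A) (a b : ℤ) : A :=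
  sgn i j • gMulSwap q d j i (fun a' b' => X a' * Y b') a b
    + gMul q d i j (fun a' b' => Y b' * X a') a b

/-- `[x, y]_p = x y - p y x`. -/
def qBracket (p : ℂ) (x y : A) : A := x * y - p • (y * x)

/-- The coefficient of `z₁^{-a₁} z₂^{-a₂} z₃^{-a₃} w^{-b}` in
`Sym_{z₁,z₂,z₃} [X(z₁), [X(z₂), [X(z₃), Y(w)]_{q²}]]_{q⁻²}`. -/
def serre (q : ℂ) (X Y : ℤ → A) (a : Fin 3 → ℤ) (b : ℤ) : A :=
  ((Nat.factorial 3 : ℂ)⁻¹) • ∑ σ : Equiv.Perm (Fin 3),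
    qBracket (q ^ (-2 : ℤ)) (X (a (σ 0)))
      (qBracket 1 (X (a (σ 1))) (qBracket (q ^ 2) (X (a (σ 2))) (Y b)))

end Series

/-! ### The quantum toroidal algebra -/

/-- The two signs in `K_i^±(z)`. -/
inductive Sgn
  | plus
  | minus

/-- Generators: the coefficients of `E_i(z)`, `F_i(z)`, `K_i^±(z)`, and `t^{±1}`.
`K s i n` is the coefficient of `z^{∓n}`, `n ≥ 0`, in `K_i^±(z)`. -/
inductive Gen
  | E (i : ZMod 2) (k : ℤ)
  | F (i : ZMod 2) (k : ℤ)
  | K (s : Sgn) (i : ZMod 2) (n : ℕ)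
  | t
  | tInv

/-- The coefficient of `z^{-k}` in `E_i(z)`. -/
def freeE (i : ZMod 2) (k : ℤ) : FreeAlgebra ℂ Gen := FreeAlgebra.ι ℂ (Gen.E i k)

/-- The coefficient of `z^{-k}` in `F_i(z)`. -/
def freeF (i : ZMod 2) (k : ℤ) : FreeAlgebra ℂ Gen := FreeAlgebra.ι ℂ (Gen.F i k)

/-- The coefficient of `z^{-n}` in `K_i^±(z)`: the series `K_i^+(z)` has only non-positive powers
of `z`, the series `K_i^-(z)` only non-negative ones. -/
def freeK (s : Sgn) (i : ZMod 2) (n : ℤ) : FreeAlgebra ℂ Gen :=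
  match s with
  | Sgn.plus => if 0 ≤ n then FreeAlgebra.ι ℂ (Gen.K Sgn.plus i n.toNat) else 0
  | Sgn.minus => if n ≤ 0 then FreeAlgebra.ι ℂ (Gen.K Sgn.minus i (-n).toNat) else 0

/-- The defining relations of the quantum toroidal algebra `𝓔` of type `gl₂`.

The constant terms of `K_i^+(z)` and `K_i^-(z)` are `K_i` and `K_i⁻¹`. Writing
`K_i^±(z) = K_i^{±1} exp(±(q - q⁻¹) ∑_{r>0} H_{i,±r} z^{∓r})` only names the coefficients of the
logarithm of the series `K_i^{∓1} K_i^±(z)`, which have constant term `1` and commuting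
coefficients, so the generators `H_{i,r}` and the coefficients of `K_i^±(z)` determine one another
polynomially. -/
inductive Rel (q d : ℂ) : FreeAlgebra ℂ Gen → FreeAlgebra ℂ Gen → Prop
  | K_mul_inv (i : ZMod 2) : Rel q d (freeK Sgn.plus i 0 * freeK Sgn.minus i 0) 1
  | K_inv_mul (i : ZMod 2) : Rel q d (freeK Sgn.minus i 0 * freeK Sgn.plus i 0) 1
  | K_K (s s' : Sgn) (i j : ZMod 2) (a b : ℤ) :
      Rel q d (freeK s i a * freeK s' j b) (freeK s' j b * freeK s i a)
  | K_E (s : Sgn) (i j : ZMod 2) (a b : ℤ) :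
      Rel q d (exchangeE q d i j (freeK s i) (freeE j) a b) 0
  | K_F (s : Sgn) (i j : ZMod 2) (a b : ℤ) :
      Rel q d (exchangeF q d i j (freeK s i) (freeF j) a b) 0
  /-- The coefficient of `z^{-a} w^{-b}` in
  `[E_i(z), F_j(w)] = δ_{ij} / (q - q⁻¹) δ(z/w) (K_i^+(w) - K_i^-(z))`. -/
  | E_F (i j : ZMod 2) (a b : ℤ) :
      Rel q d (freeE i a * freeF j b - freeF j b * freeE i a)
        (if i = j then
          (q - q⁻¹)⁻¹ • (freeK Sgn.plus i (a + b) - freeK Sgn.minus i (a + b)) else 0)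
  | E_E (i j : ZMod 2) (a b : ℤ) : Rel q d (exchangeE q d i j (freeE i) (freeE j) a b) 0
  | F_F (i j : ZMod 2) (a b : ℤ) : Rel q d (exchangeF q d i j (freeF i) (freeF j) a b) 0
  | serre_E (i : ZMod 2) (a : Fin 3 → ℤ) (b : ℤ) :
      Rel q d (serre q (freeE i) (freeE (i + 1)) a b) 0
  | serre_F (i : ZMod 2) (a : Fin 3 → ℤ) (b : ℤ) :
      Rel q d (serre q (freeF i) (freeF (i + 1)) a b) 0
  | t_mul_inv : Rel q d (FreeAlgebra.ι ℂ Gen.t * FreeAlgebra.ι ℂ Gen.tInv) 1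
  | t_inv_mul : Rel q d (FreeAlgebra.ι ℂ Gen.tInv * FreeAlgebra.ι ℂ Gen.t) 1
  | t_central (g : Gen) :
      Rel q d (FreeAlgebra.ι ℂ Gen.t * FreeAlgebra.ι ℂ g)
        (FreeAlgebra.ι ℂ g * FreeAlgebra.ι ℂ Gen.t)

/-- The quantum toroidal algebra `𝓔` of type `gl₂`. -/
abbrev Alg (q d : ℂ) : Type := RingQuot (Rel q d)

/-- The element `E_{i,k}` of `𝓔`. -/
def E (q d : ℂ) (i : ZMod 2) (k : ℤ) : Alg q d := RingQuot.mkAlgHom ℂ (Rel q d) (freeE i k)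

/-- The element `F_{i,k}` of `𝓔`. -/
def F (q d : ℂ) (i : ZMod 2) (k : ℤ) : Alg q d := RingQuot.mkAlgHom ℂ (Rel q d) (freeF i k)

/-- The coefficient of `z^{-n}` in the Cartan current `K_i^±(z)` of `𝓔`. -/
def K (q d : ℂ) (s : Sgn) (i : ZMod 2) (n : ℤ) : Alg q d :=
  RingQuot.mkAlgHom ℂ (Rel q d) (freeK s i n)

/-- The central element `t` of `𝓔`. -/
def t (q d : ℂ) : Alg q d := RingQuot.mkAlgHom ℂ (Rel q d) (FreeAlgebra.ι ℂ Gen.t)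

/-! ### Rational functions -/

/-- The expansion of a rational function `f(z)` at `z = 0`, a Laurent series in `z`. -/
def expandZero (f : RatFunc ℂ) : LaurentSeries ℂ := (f : LaurentSeries ℂ)

/-- The expansion of a rational function `f(z)` at `z = ∞`, a Laurent series in `z⁻¹`: the
expansion of `f(1/u)` at `u = 0`. -/
def expandInfty (f : RatFunc ℂ) : LaurentSeries ℂ :=
  ((f.eval RatFunc.C (RatFunc.X)⁻¹ : RatFunc ℂ) : LaurentSeries ℂ)

/-- The coefficient of `z^{-n}` in the expansion of `f(z)` at `z = ∞` (for `K^+`) or at `z = 0`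
(for `K^-`). -/
def expandCoeff (s : Sgn) (f : RatFunc ℂ) (n : ℤ) : ℂ :=
  match s with
  | Sgn.plus => (expandInfty f).coeff n
  | Sgn.minus => (expandZero f).coeff (-n)

/-- `f` is regular at `p`. -/
def RegularAt (f : RatFunc ℂ) (p : ℂ) : Prop := f.denom.eval p ≠ 0

/-- The value `f(p)`, meaningful if `f` is regular at `p`. -/
def value (f : RatFunc ℂ) (p : ℂ) : ℂ := f.eval (RingHom.id ℂ) p

/-- The residue of `f(z) dz` at `z = p`: the coefficient of `u⁻¹` in the Laurent expansion of
`f(p + u)` at `u = 0`. -/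
def residue (f : RatFunc ℂ) (p : ℂ) : ℂ :=
  ((RatFunc.laurent p f : RatFunc ℂ) : LaurentSeries ℂ).coeff (-1)

/-! ### Modules over the quantum toroidal algebra -/

section Modules

variable (q d : ℂ) {V : Type*} [AddCommGroup V] [Module ℂ V] [Module (Alg q d) V]

/-- `v` is a vector of `ℓ`-weight `φ(z) = (φ⁰(z), φ¹(z))`: `K_i^±(z) v = φ^i(z) v`, where `φ^i(z)`
is expanded at `z = ∞` for `K_i^+(z)` and at `z = 0` for `K_i^-(z)`. -/
def IsLWeightVector (φ : ZMod 2 → RatFunc ℂ) (v : V) : Prop :=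
  ∀ (s : Sgn) (i : ZMod 2) (n : ℤ), K q d s i n • v = expandCoeff s (φ i) n • v

variable (V)

/-- The module has level `κ`: the central element `K₀ K₁` acts as the scalar `κ`. -/
def HasLevel (κ : ℂ) : Prop :=
  ∀ v : V, (K q d Sgn.plus 0 0 * K q d Sgn.plus 1 0) • v = κ • v

/-- Tame modules: there is a basis of `ℓ`-weight vectors with distinct `ℓ`-weights. -/
def IsTame : Prop :=
  ∃ (ι : Type) (e : Module.Basis ι ℂ V) (φ : ι → ZMod 2 → RatFunc ℂ),
    Function.Injective φ ∧ ∀ x, IsLWeightVector q d (φ x) (e x)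

/-- Highest `ℓ`-weight modules of highest `ℓ`-weight `φ`: the module is generated by a vector `v`
of `ℓ`-weight `φ` with `E_i(z) v = 0`. -/
def IsHighestLWeight (φ : ZMod 2 → RatFunc ℂ) : Prop :=
  ∃ v : V, v ≠ 0 ∧ IsLWeightVector q d φ v ∧ (∀ (i : ZMod 2) (k : ℤ), E q d i k • v = 0) ∧
    Submodule.span (Alg q d) {v} = ⊤

end Modules

/-! ### Boxes and plane partitions -/

/-- A box, given by its coordinates `(x, y, z)`. -/
abbrev Box : Type := ℕ × ℕ × ℕ

/-- The color `x + z` mod `2`. -/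
def color (b : Box) : ZMod 2 := (b.1 : ZMod 2) + (b.2.2 : ZMod 2)

/-- The position `q₁^{-x} q₂^{-y} q₃^{-z}`. -/
def pos (q d : ℂ) (b : Box) : ℂ :=
  q₁ q d ^ (-(b.1 : ℤ)) * q₂ q ^ (-(b.2.1 : ℤ)) * q₃ q d ^ (-(b.2.2 : ℤ))

/-- The total order on boxes, lexicographic according to `y > z > x`. -/
def BoxLT (b c : Box) : Prop :=
  b.2.1 < c.2.1 ∨ (b.2.1 = c.2.1 ∧ (b.2.2 < c.2.2 ∨ (b.2.2 = c.2.2 ∧ b.1 < c.1)))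

/-- A plane partition, identified with its (three-dimensional) Young diagram: a finite set of
boxes containing with each box all boxes with coordinatewise smaller or equal coordinates. -/
@[ext]
structure PlanePartition where
  /-- the Young diagram -/
  cells : Finset Box
  isLowerSet : IsLowerSet (cells : Set Box)

/-- The empty plane partition, the reference state. -/
def PlanePartition.empty : PlanePartition := ⟨∅, by simp [isLowerSet_empty]⟩

open Classical in
/-- The convex boxes of color `i`: those whose removal produces a plane partition. -/
def convexBoxes (i : ZMod 2) (l : PlanePartition) : Finset Box :=
  {b ∈ l.cells | IsLowerSet ((l.cells.erase b : Finset Box) : Set Box) ∧ color b = i}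

/-- The set of concave boxes of color `i`: boxes outside the plane partition whose addition
produces a plane partition. -/
def concaveSet (i : ZMod 2) (l : PlanePartition) : Set Box :=
  {b | b ∉ l.cells ∧ IsLowerSet ((insert b l.cells : Finset Box) : Set Box) ∧ color b = i}

theorem concaveSet_finite (i : ZMod 2) (l : PlanePartition) : (concaveSet i l).Finite := by
  classical
  refine (Finset.finite_toSet (insert ((0, 0, 0) : Box)
    (l.cells.image (fun b => (b.1 + 1, b.2.1, b.2.2)) ∪
      (l.cells.image (fun b => (b.1, b.2.1 + 1, b.2.2)) ∪
        l.cells.image (fun b => (b.1, b.2.1, b.2.2 + 1)))))).subset ?_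
  rintro ⟨x, y, z⟩ ⟨-, hl, -⟩
  have key : ∀ c : Box, c ≤ (x, y, z) → c ≠ (x, y, z) → c ∈ l.cells := by
    intro c hc hne
    have h := hl hc (by simp)
    simp only [Finset.coe_insert, Set.mem_insert_iff, Finset.mem_coe] at h
    exact h.resolve_left hne
  simp only [Finset.coe_insert, Finset.coe_union, Finset.coe_image, Set.mem_insert_iff,
    Set.mem_union, Set.mem_image, Finset.mem_coe]
  rcases x with _ | x
  · rcases y with _ | y
    · rcases z with _ | z
      · exact Or.inl rfl
      · exact Or.inr (Or.inr (Or.inr ⟨(0, 0, z), key _ (by simp) (by simp), rfl⟩))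
    · exact Or.inr (Or.inr (Or.inl ⟨(0, y, z), key _ (by simp) (by simp), rfl⟩))
  · exact Or.inr (Or.inl ⟨(x, y, z), key _ (by simp) (by simp), rfl⟩)

/-- The finite set of concave boxes of color `i`. -/
def concaveBoxes (i : ZMod 2) (l : PlanePartition) : Finset Box := (concaveSet_finite i l).toFinset

/-! ### `ℓ`-weights and the combinatorial action -/

/-- The affine root `A_{c,a}(z)`, a pair of rational functions: its component `c` is
`(q₂ z - a) / (z - q₂ a)`, the other one is `(q₁ z - a)(q₃ z - a) / ((z - q₁ a)(z - q₃ a))`. -/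
def rootA (q d : ℂ) (c : ZMod 2) (a : ℂ) : ZMod 2 → RatFunc ℂ := fun i =>
  if i = c then
    (RatFunc.C (q₂ q) * RatFunc.X - RatFunc.C a) / (RatFunc.X - RatFunc.C (q₂ q * a))
  else
    ((RatFunc.C (q₁ q d) * RatFunc.X - RatFunc.C a) *
        (RatFunc.C (q₃ q d) * RatFunc.X - RatFunc.C a)) /
      ((RatFunc.X - RatFunc.C (q₁ q d * a)) * (RatFunc.X - RatFunc.C (q₃ q d * a)))

/-- The product over the boxes `b ∈ s` of the `ℓ`-weights `A_{c(b),p(b)}(z)⁻¹`. -/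
def boxesWeight (q d : ℂ) (s : Finset Box) : ZMod 2 → RatFunc ℂ :=
  ∏ b ∈ s, (rootA q d (color b) (pos q d b))⁻¹

/-- The `ℓ`-weight `φ_λ(z)` of a plane partition, where `Ψ` is that of the empty one. -/
def lWeight (q d : ℂ) (Ψ : ZMod 2 → RatFunc ℂ) (l : PlanePartition) : ZMod 2 → RatFunc ℂ :=
  Ψ * boxesWeight q d l.cells

open Classical in
/-- `φ_{λ,<b}(z)`. -/
def lWeightBelow (q d : ℂ) (Ψ : ZMod 2 → RatFunc ℂ) (l : PlanePartition) (b : Box) :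
    ZMod 2 → RatFunc ℂ :=
  Ψ * boxesWeight q d {c ∈ l.cells | BoxLT c b}

open Classical in
/-- `φ_{λ,>b}(z)`. -/
def lWeightAbove (q d : ℂ) (l : PlanePartition) (b : Box) : ZMod 2 → RatFunc ℂ :=
  boxesWeight q d {c ∈ l.cells | BoxLT b c}

/-- The coefficient `a^i_{λ,b} = φ^i_{λ,>b}(p(b))`. -/
def coeffA (q d : ℂ) (i : ZMod 2) (l : PlanePartition) (b : Box) : ℂ :=
  value (lWeightAbove q d l b i) (pos q d b)

/-- The coefficient `b^i_{λ,b} = (q - q⁻¹)⁻¹ res_{z = p(b)} φ^i_{λ,<b}(z) dz / z`. -/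
def coeffB (q d : ℂ) (Ψ : ZMod 2 → RatFunc ℂ) (i : ZMod 2) (l : PlanePartition) (b : Box) : ℂ :=
  (q - q⁻¹)⁻¹ * residue (lWeightBelow q d Ψ l b i / RatFunc.X) (pos q d b)

/-- The vector space with basis the plane partitions. -/
abbrev Space : Type := PlanePartition →₀ ℂ

open Classical in
/-- The basis vector of a plane partition, given by its set of boxes. -/
def ket (s : Finset Box) : Space :=
  if h : IsLowerSet (s : Set Box) then Finsupp.single ⟨s, h⟩ 1 else 0

open Classical in
/-- The action of `𝓔` on the space of plane partitions is the combinatorial one: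
* `K_i^±(z) |λ⟩ = φ_λ^i(z) |λ⟩`,
* `F_i(z) |λ⟩ = ∑_{b concave of color i} a^i_{λ,b} δ(z / p(b)) |λ ⊔ b⟩`,
* `E_i(z) |λ⟩ = ∑_{b convex of color i} b^i_{λ,b} δ(z / p(b)) |λ ∖ b⟩`,
* `t = 1`,

where `δ(z) = ∑ z^k`, so that `δ(z / p)` has the coefficient `p^k` at `z^{-k}`. -/
structure IsCombinatorialAction (q d : ℂ) (Ψ : ZMod 2 → RatFunc ℂ) [Module (Alg q d) Space] :
    Prop where
  K_ket : ∀ l : PlanePartition, IsLWeightVector q d (lWeight q d Ψ l) (ket l.cells)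
  F_ket : ∀ (i : ZMod 2) (k : ℤ) (l : PlanePartition),
    F q d i k • ket l.cells = ∑ b ∈ concaveBoxes i l,
      (coeffA q d i l b * pos q d b ^ k) • ket (insert b l.cells)
  E_ket : ∀ (i : ZMod 2) (k : ℤ) (l : PlanePartition),
    E q d i k • ket l.cells = ∑ b ∈ convexBoxes i l,
      (coeffB q d Ψ i l b * pos q d b ^ k) • ket (l.cells.erase b)
  t_smul : ∀ v : Space, t q d • v = v

/-- The `ℓ`-weight `Ψ(z) = ((κ z - κ⁻¹) / (z - 1), 1)`. -/
def psiMacMahon (κ : ℂ) : ZMod 2 → RatFunc ℂ := fun i =>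
  if i = 0 then (RatFunc.C κ * RatFunc.X - RatFunc.C κ⁻¹) / (RatFunc.X - 1) else 1

end

end Toroidal

/-! ### Orders, leading coefficients and residues of rational functions at a point. -/

namespace Toroidal

noncomputable section

open scoped RatFunc

/-! ### Local analysis of rational functions -/

/-! Since `q₁ q₂ q₃ = 1` and the parameters are generic, two lattice points have the same position
exactly when they differ by a multiple of `(1,1,1)`. The order of `φ^i_λ` at a position of color `i`
therefore adds up contributions of boxes near one diagonal line. This sum telescopes: it depends
only on which of six neighbours of the last point of the line belong to `λ`, where the complement of
the octant counts as part of `λ` (`sum_boxOrd`). Genericity of `κ` keeps the zero of `Ψ` away from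
these points. The outcome is that the poles of `φ^i_λ` are simple and sit exactly at the concave and
convex boxes of color `i` (`ordAt_fullWeight_corner`, `exists_box_of_ordAt_neg`). Applied to the
boxes of `λ` before a given box, it also shows that the coefficients of `F` are finite and that
those of `E` and `F` are non-zero. Values and residues thus become leading coefficients, which are
multiplicative, so each coefficient is a product over pairs of boxes.

Relation `[E, F]`: adding one box and removing a different one commute, because the two orders of
performing them differ by reciprocal pair factors. Adding and removing the same box produces the
residue of `φ^i_λ` at that box. The sum of these residues against delta functions is the difference
of the expansions at infinity and at zero (`expandCoeff_plus_sub_minus`).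

Relations among the `E`: the coefficient of a word of removals is a common factor times a product
over pairs of removed boxes (`remWord_ket`). When the removed skew shape contains no unit square,
the zeros of `g` at its pairs of boxes are exactly the forbidden orders of removal, so every pair
contributes a multiple of a value of `g` (`exists_pairW_eq`). The quadratic relations are then
immediate, and the Serre relations reduce to `serre_polynomial_identity`. The relations among the
`F` follow by transposition, since adding is the transpose of removing.

Structure of the module: the orders of `φ_λ` at all lattice points determine how many boxes `λ` has
on each diagonal line, hence determine `λ` (`lWeight_injective`). A submodule therefore contains
every basis vector that occurs in one of its elements. Non-vanishing of the matrix coefficients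
connects all plane partitions to the empty one, which gives irreducibility. -/

theorem algebraMap_laurentSeries_C (c : ℂ) :
    algebraMap (RatFunc ℂ) (LaurentSeries ℂ) (RatFunc.C c) = HahnSeries.C c := by
  rw [← RatFunc.algebraMap_C, ← IsScalarTower.algebraMap_apply]
  simp

/-- The Laurent expansion of a rational function at `p`. -/
def loc (p : ℂ) : RatFunc ℂ →+* LaurentSeries ℂ :=
  (algebraMap (RatFunc ℂ) (LaurentSeries ℂ)).comp (RatFunc.laurent p : RatFunc ℂ →ₐ[ℂ] _).toRingHom

/-- The order of vanishing at `p`. -/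
def ordAt (p : ℂ) (f : RatFunc ℂ) : ℤ := (loc p f).order

/-- The leading coefficient of the Laurent expansion at `p`. -/
def lcAt (p : ℂ) (f : RatFunc ℂ) : ℂ := (loc p f).leadingCoeff

theorem residue_eq_coeff (f : RatFunc ℂ) (p : ℂ) : residue f p = (loc p f).coeff (-1) := rfl

theorem loc_ne_zero {p : ℂ} {f : RatFunc ℂ} (hf : f ≠ 0) : loc p f ≠ 0 :=
  (map_ne_zero _).2 hf

theorem ordAt_mul (p : ℂ) {f g : RatFunc ℂ} (hf : f ≠ 0) (hg : g ≠ 0) :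
    ordAt p (f * g) = ordAt p f + ordAt p g := by
  rw [ordAt, map_mul, HahnSeries.order_mul (loc_ne_zero hf) (loc_ne_zero hg)]; rfl

theorem ordAt_one (p : ℂ) : ordAt p 1 = 0 := by simp [ordAt]

theorem ordAt_inv (p : ℂ) (f : RatFunc ℂ) : ordAt p f⁻¹ = -ordAt p f := by
  by_cases hf : f = 0
  -- The zero series has order `0` by convention, so the formula survives for `f = 0`.
  · simp [hf, ordAt]
  · have := ordAt_mul p hf (inv_ne_zero hf)
    rw [mul_inv_cancel₀ hf, ordAt_one] at this
    omega

theorem ordAt_prod {ι : Type*} (p : ℂ) (s : Finset ι) (f : ι → RatFunc ℂ)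
    (hf : ∀ i ∈ s, f i ≠ 0) : ordAt p (∏ i ∈ s, f i) = ∑ i ∈ s, ordAt p (f i) := by
  classical
  induction s using Finset.induction_on with
  | empty => simp [ordAt_one]
  | insert a s ha ih =>
    rw [Finset.prod_insert ha, Finset.sum_insert ha, ordAt_mul, ih]
    · exact fun i hi => hf i (Finset.mem_insert_of_mem hi)
    · exact hf a (Finset.mem_insert_self _ _)
    · exact Finset.prod_ne_zero_iff.2 fun i hi => hf i (Finset.mem_insert_of_mem hi)

theorem lcAt_mul (p : ℂ) (f g : RatFunc ℂ) : lcAt p (f * g) = lcAt p f * lcAt p g := by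
  rw [lcAt, map_mul, HahnSeries.leadingCoeff_mul]; rfl

theorem lcAt_one (p : ℂ) : lcAt p 1 = 1 := by simp [lcAt]

theorem lcAt_ne_zero (p : ℂ) {f : RatFunc ℂ} (hf : f ≠ 0) : lcAt p f ≠ 0 :=
  HahnSeries.leadingCoeff_ne_zero.2 (loc_ne_zero hf)

theorem lcAt_inv (p : ℂ) (f : RatFunc ℂ) : lcAt p f⁻¹ = (lcAt p f)⁻¹ := by
  by_cases hf : f = 0
  · simp [hf, lcAt]
  · apply eq_inv_of_mul_eq_one_left
    rw [← lcAt_mul, inv_mul_cancel₀ hf, lcAt_one]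

theorem lcAt_prod {ι : Type*} (p : ℂ) (s : Finset ι) (f : ι → RatFunc ℂ) :
    lcAt p (∏ i ∈ s, f i) = ∏ i ∈ s, lcAt p (f i) := by
  classical
  induction s using Finset.induction_on with
  | empty => simp [lcAt_one]
  | insert a s ha ih => rw [Finset.prod_insert ha, Finset.prod_insert ha, lcAt_mul, ih]

theorem loc_algebraMap (p : ℂ) (P : Polynomial ℂ) :
    loc p (algebraMap _ _ P) =
      ((Polynomial.taylor p P : PowerSeries ℂ) : LaurentSeries ℂ) := by
  rw [RatFunc.coe_coe]
  simp [loc]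

theorem loc_algebraMap_coeff_zero (p : ℂ) (P : Polynomial ℂ) :
    (loc p (algebraMap _ _ P)).coeff 0 = P.eval p := by
  rw [loc_algebraMap, PowerSeries.coeff_coe]
  simp

theorem loc_algebraMap_coeff_neg (p : ℂ) (P : Polynomial ℂ) {n : ℤ} (hn : n < 0) :
    (loc p (algebraMap _ _ P)).coeff n = 0 := by
  rw [loc_algebraMap, PowerSeries.coeff_coe, if_pos hn]

theorem algebraMap_ratFunc_ne_zero {P : Polynomial ℂ} (hP : P ≠ 0) :
    algebraMap (Polynomial ℂ) (RatFunc ℂ) P ≠ 0 := by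
  simpa using hP

theorem coeff_ordAt_ne_zero (p : ℂ) {f : RatFunc ℂ} (hf : f ≠ 0) :
    (loc p f).coeff (ordAt p f) ≠ 0 := by
  rw [ordAt, Ne, HahnSeries.coeff_order_eq_zero]; exact loc_ne_zero hf

theorem ordAt_polynomial_nonneg (p : ℂ) {P : Polynomial ℂ} (hP : P ≠ 0) :
    0 ≤ ordAt p (algebraMap _ _ P) := by
  by_contra! h
  exact coeff_ordAt_ne_zero p (algebraMap_ratFunc_ne_zero hP) (loc_algebraMap_coeff_neg p P h)

theorem ordAt_polynomial_eq_zero (p : ℂ) {P : Polynomial ℂ} (hP : P ≠ 0) :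
    ordAt p (algebraMap _ _ P) = 0 ↔ P.eval p ≠ 0 := by
  rw [← loc_algebraMap_coeff_zero]
  constructor
  · intro h
    rw [← h]
    exact coeff_ordAt_ne_zero p (algebraMap_ratFunc_ne_zero hP)
  · intro h
    exact le_antisymm (HahnSeries.order_le_of_coeff_ne_zero h) (ordAt_polynomial_nonneg p hP)

theorem lcAt_eq_coeff (p : ℂ) (f : RatFunc ℂ) : lcAt p f = (loc p f).coeff (ordAt p f) :=
  HahnSeries.leadingCoeff_eq

theorem lcAt_polynomial (p : ℂ) {P : Polynomial ℂ} (hP : P.eval p ≠ 0) :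
    lcAt p (algebraMap _ _ P) = P.eval p := by
  have h0 : P ≠ 0 := by rintro rfl; simp at hP
  rw [lcAt_eq_coeff, (ordAt_polynomial_eq_zero p h0).2 hP, loc_algebraMap_coeff_zero]

theorem ordAt_eq_num_sub_denom (p : ℂ) {f : RatFunc ℂ} (hf : f ≠ 0) :
    ordAt p f = ordAt p (algebraMap _ _ f.num) - ordAt p (algebraMap _ _ f.denom) := by
  conv_lhs => rw [← RatFunc.num_div_denom f]
  rw [div_eq_mul_inv, ordAt_mul, ordAt_inv]
  · ring
  · exact algebraMap_ratFunc_ne_zero (RatFunc.num_ne_zero hf)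
  · exact inv_ne_zero (algebraMap_ratFunc_ne_zero f.denom_ne_zero)

/-- If the reduced denominator vanished at `p`, non-negative order would force the numerator to
vanish there too, against coprimality. -/
theorem regularAt_of_ordAt_nonneg {p : ℂ} {f : RatFunc ℂ} (hf : f ≠ 0) (h : 0 ≤ ordAt p f) :
    RegularAt f p := by
  intro hd
  have h1 := ordAt_polynomial_nonneg p f.denom_ne_zero
  have h2 : ordAt p (algebraMap _ _ f.denom) ≠ 0 := fun h0 =>
    (ordAt_polynomial_eq_zero p f.denom_ne_zero).1 h0 hd
  rw [ordAt_eq_num_sub_denom p hf] at h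
  have h3 : f.num.eval p = 0 := by
    by_contra h3
    rw [(ordAt_polynomial_eq_zero p (RatFunc.num_ne_zero hf)).2 h3] at h
    omega
  obtain ⟨a, b, hab⟩ := RatFunc.isCoprime_num_denom f
  have := congrArg (Polynomial.eval p) hab
  simp [hd, h3] at this

/-- Factors of a weight can have zeros and poles at `p` that cancel only in the product. Leading
coefficients are multiplicative in spite of this, so values, and below residues at simple poles, are
traded for them. -/
theorem value_eq_lcAt {p : ℂ} {f : RatFunc ℂ} (hf : f ≠ 0) (h : ordAt p f = 0) :
    value f p = lcAt p f := by
  have hr : f.denom.eval p ≠ 0 := regularAt_of_ordAt_nonneg hf h.ge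
  have hn : f.num.eval p ≠ 0 := by
    rw [← ordAt_polynomial_eq_zero p (RatFunc.num_ne_zero hf)]
    have := ordAt_eq_num_sub_denom p hf
    rw [(ordAt_polynomial_eq_zero p f.denom_ne_zero).2 hr] at this
    omega
  conv_rhs => rw [← RatFunc.num_div_denom f]
  rw [div_eq_mul_inv, lcAt_mul, lcAt_inv, lcAt_polynomial p hr, lcAt_polynomial p hn]
  simp [value, RatFunc.eval, Polynomial.eval₂_id, div_eq_mul_inv]

theorem residue_eq_lcAt {p : ℂ} {f : RatFunc ℂ} (h : ordAt p f = -1) :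
    residue f p = lcAt p f := by
  rw [residue_eq_coeff, lcAt_eq_coeff, h]

/-- The linear function `a z - b`. -/
def linFun (a b : ℂ) : RatFunc ℂ := RatFunc.C a * RatFunc.X - RatFunc.C b

theorem linFun_eq_algebraMap (a b : ℂ) :
    linFun a b = algebraMap _ _ (Polynomial.C a * Polynomial.X - Polynomial.C b) := by
  simp [linFun]

theorem linFun_ne_zero {a : ℂ} (ha : a ≠ 0) (b : ℂ) : linFun a b ≠ 0 := by
  rw [linFun_eq_algebraMap]
  apply algebraMap_ratFunc_ne_zero
  intro h
  have := congrArg (fun P => Polynomial.coeff P 1) h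
  simp [Polynomial.coeff_C] at this
  exact ha this

theorem ordAt_linFun (p : ℂ) {a : ℂ} (ha : a ≠ 0) (b : ℂ) :
    ordAt p (linFun a b) = if a * p = b then 1 else 0 := by
  have h0 := linFun_ne_zero ha b
  split_ifs with h
  · have : loc p (linFun a b) = HahnSeries.single 1 a := by
      simp only [linFun, loc, map_sub, map_mul, RingHom.comp_apply, AlgHom.toRingHom_eq_coe,
        RingHom.coe_coe, RatFunc.laurent_C, RatFunc.laurent_X, map_add, RatFunc.coe_X]
      rw [algebraMap_laurentSeries_C, algebraMap_laurentSeries_C, algebraMap_laurentSeries_C,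
        mul_add, ← map_mul HahnSeries.C, h, add_sub_cancel_right]
      simp
    rw [ordAt, this, HahnSeries.order_single ha]
  · rw [linFun_eq_algebraMap] at h0 ⊢
    rw [ordAt_polynomial_eq_zero]
    · simpa [sub_eq_zero] using h
    · rintro h; simp [h] at h0

theorem lcAt_linFun (p : ℂ) {a b : ℂ} (h : a * p ≠ b) : lcAt p (linFun a b) = a * p - b := by
  rw [linFun_eq_algebraMap, lcAt_polynomial]
  · simp
  · simpa [sub_eq_zero] using h

end

end Toroidal

/-! ### Expansions at zero and infinity, and the residue formula for their difference. -/

namespace Toroidal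

noncomputable section

open scoped RatFunc

/-! ### Expansions at zero and at infinity -/

/-- `RatFunc.eval` respects products only when no denominator is sent to zero. Transcendence of
`X⁻¹` ensures this, which makes the substitution `z ↦ z⁻¹` a ring homomorphism. -/
theorem eval₂_inv_X_injective :
    Function.Injective (Polynomial.eval₂RingHom (RatFunc.C (K := ℂ)) (RatFunc.X)⁻¹) := by
  have h : Transcendental ℂ ((RatFunc.X : RatFunc ℂ)⁻¹) := fun h =>
    RatFunc.transcendental_X (K := ℂ) (IsAlgebraic.inv_iff.1 h)
  have h2 := transcendental_iff_injective.1 h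
  intro P Q hPQ
  exact h2 (by simpa [Polynomial.aeval_def, RatFunc.algebraMap_eq_C] using hPQ)

/-- The substitution `z ↦ z⁻¹`. -/
def invHom : RatFunc ℂ →+* RatFunc ℂ :=
  RatFunc.liftRingHom (Polynomial.eval₂RingHom (RatFunc.C (K := ℂ)) (RatFunc.X)⁻¹)
    (nonZeroDivisors_le_comap_nonZeroDivisors_of_injective _ eval₂_inv_X_injective)

theorem invHom_apply (f : RatFunc ℂ) : invHom f = f.eval RatFunc.C (RatFunc.X)⁻¹ := by
  rw [invHom, RatFunc.liftRingHom_apply]; rfl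

theorem invHom_C (c : ℂ) : invHom (RatFunc.C c) = RatFunc.C c := by
  rw [invHom_apply, RatFunc.eval_C]

theorem invHom_X : invHom RatFunc.X = RatFunc.X⁻¹ := by
  rw [invHom_apply, RatFunc.eval_X]

/-- The expansion at infinity, for `plus`, or at zero, for `minus`. -/
def expHom : Sgn → RatFunc ℂ →+* LaurentSeries ℂ
  | Sgn.plus => (algebraMap (RatFunc ℂ) (LaurentSeries ℂ)).comp invHom
  | Sgn.minus => algebraMap (RatFunc ℂ) (LaurentSeries ℂ)

theorem expandCoeff_plus (f : RatFunc ℂ) (n : ℤ) :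
    expandCoeff Sgn.plus f n = (expHom Sgn.plus f).coeff n := by
  simp only [expandCoeff, expandInfty, expHom, RingHom.comp_apply, invHom_apply]

theorem expandCoeff_minus (f : RatFunc ℂ) (n : ℤ) :
    expandCoeff Sgn.minus f n = (expHom Sgn.minus f).coeff (-n) := rfl

theorem expHom_C (s : Sgn) (c : ℂ) : expHom s (RatFunc.C c) = HahnSeries.C c := by
  cases s
  · rw [expHom, RingHom.comp_apply, invHom_C, algebraMap_laurentSeries_C]
  · rw [expHom, algebraMap_laurentSeries_C]

theorem expHom_plus_X : expHom Sgn.plus RatFunc.X = HahnSeries.single (-1) 1 := by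
  rw [expHom, RingHom.comp_apply, invHom_X, map_inv₀, RatFunc.coe_X, HahnSeries.inv_single, inv_one]

theorem expHom_minus_X : expHom Sgn.minus RatFunc.X = HahnSeries.single 1 1 := by
  rw [expHom, RatFunc.coe_X]

theorem expandCoeff_add (s : Sgn) (f g : RatFunc ℂ) (n : ℤ) :
    expandCoeff s (f + g) n = expandCoeff s f n + expandCoeff s g n := by
  cases s <;> simp [expandCoeff_plus, expandCoeff_minus]

theorem expandCoeff_sub (s : Sgn) (f g : RatFunc ℂ) (n : ℤ) :
    expandCoeff s (f - g) n = expandCoeff s f n - expandCoeff s g n := by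
  cases s <;> simp [expandCoeff_plus, expandCoeff_minus]

theorem expandCoeff_zero (s : Sgn) (n : ℤ) : expandCoeff s 0 n = 0 := by
  cases s <;> simp [expandCoeff_plus, expandCoeff_minus]

theorem expandCoeff_sum {ι : Type*} (s : Sgn) (t : Finset ι) (f : ι → RatFunc ℂ) (n : ℤ) :
    expandCoeff s (∑ i ∈ t, f i) n = ∑ i ∈ t, expandCoeff s (f i) n := by
  classical
  induction t using Finset.induction_on with
  | empty => simp [expandCoeff_zero]
  | insert a t ha ih => rw [Finset.sum_insert ha, Finset.sum_insert ha, expandCoeff_add, ih]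

theorem expandCoeff_C_mul (s : Sgn) (c : ℂ) (f : RatFunc ℂ) (n : ℤ) :
    expandCoeff s (RatFunc.C c * f) n = c * expandCoeff s f n := by
  cases s <;> simp only [expandCoeff_plus, expandCoeff_minus, map_mul, expHom_C,
    HahnSeries.C_mul_eq_smul, HahnSeries.coeff_smul, smul_eq_mul]

theorem expandCoeff_X_mul (s : Sgn) (f : RatFunc ℂ) (n : ℤ) :
    expandCoeff s (RatFunc.X * f) n = expandCoeff s f (n + 1) := by
  cases s
  · rw [expandCoeff_plus, expandCoeff_plus, map_mul, expHom_plus_X, HahnSeries.coeff_single_mul,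
      one_mul, sub_neg_eq_add]
  · rw [expandCoeff_minus, expandCoeff_minus, map_mul, expHom_minus_X, HahnSeries.coeff_single_mul,
      one_mul]
    congr 1; ring

/-- `f` is regular at the point of expansion and has value `c` there. -/
def EndValue (s : Sgn) (f : RatFunc ℂ) (c : ℂ) : Prop :=
  ∃ g : PowerSeries ℂ, expHom s f = (g : LaurentSeries ℂ) ∧ PowerSeries.constantCoeff g = c

namespace EndValue

variable {s : Sgn} {f g : RatFunc ℂ} {c e : ℂ}

theorem mul (hf : EndValue s f c) (hg : EndValue s g e) : EndValue s (f * g) (c * e) := by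
  obtain ⟨a, ha, rfl⟩ := hf
  obtain ⟨b, hb, rfl⟩ := hg
  exact ⟨a * b, by rw [map_mul, ha, hb, PowerSeries.coe_mul], map_mul _ _ _⟩

theorem one : EndValue s 1 1 := ⟨1, by simp, by simp⟩

theorem inv (hf : EndValue s f c) (hc : c ≠ 0) : EndValue s f⁻¹ c⁻¹ := by
  obtain ⟨a, ha, rfl⟩ := hf
  refine ⟨a⁻¹, ?_, PowerSeries.constantCoeff_inv a⟩
  rw [map_inv₀, ha]
  symm
  apply eq_inv_of_mul_eq_one_left
  rw [← PowerSeries.coe_mul, PowerSeries.inv_mul_cancel _ hc, PowerSeries.coe_one]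

theorem prod {ι : Type*} {t : Finset ι} {f : ι → RatFunc ℂ} {c : ι → ℂ}
    (h : ∀ i ∈ t, EndValue s (f i) (c i)) : EndValue s (∏ i ∈ t, f i) (∏ i ∈ t, c i) := by
  classical
  induction t using Finset.induction_on with
  | empty => simpa using one
  | insert a t ha ih =>
    rw [Finset.prod_insert ha, Finset.prod_insert ha]
    exact (h a (Finset.mem_insert_self _ _)).mul
      (ih fun i hi => h i (Finset.mem_insert_of_mem hi))

theorem expandCoeff_zero (hf : EndValue s f c) : expandCoeff s f 0 = c := by
  obtain ⟨a, ha, rfl⟩ := hf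
  cases s
  · rw [expandCoeff_plus, ha, PowerSeries.coeff_coe]; simp
  · rw [expandCoeff_minus, ha, PowerSeries.coeff_coe]; simp

theorem expandCoeff_plus_neg (hf : EndValue Sgn.plus f c) {n : ℤ} (hn : n < 0) :
    expandCoeff Sgn.plus f n = 0 := by
  obtain ⟨a, ha, rfl⟩ := hf
  rw [expandCoeff_plus, ha, PowerSeries.coeff_coe, if_pos hn]

theorem expandCoeff_minus_pos (hf : EndValue Sgn.minus f c) {n : ℤ} (hn : 0 < n) :
    expandCoeff Sgn.minus f n = 0 := by
  obtain ⟨a, ha, rfl⟩ := hf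
  rw [expandCoeff_minus, ha, PowerSeries.coeff_coe, if_pos (by omega)]

theorem linFun_minus (a b : ℂ) : EndValue Sgn.minus (linFun a b) (-b) := by
  refine ⟨PowerSeries.C a * PowerSeries.X - PowerSeries.C b, ?_, by simp⟩
  simp only [linFun, map_sub, map_mul, expHom_C, expHom_minus_X, PowerSeries.coe_C,
    PowerSeries.coe_X]

theorem linFun_plus (a b : ℂ) : EndValue Sgn.plus (linFun a b * RatFunc.X⁻¹) a := by
  refine ⟨PowerSeries.C a - PowerSeries.C b * PowerSeries.X, ?_, by simp⟩
  have hX : (RatFunc.X : RatFunc ℂ) ≠ 0 := RatFunc.X_ne_zero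
  have : linFun a b * RatFunc.X⁻¹ = RatFunc.C a - RatFunc.C b * RatFunc.X⁻¹ := by
    rw [linFun]; field_simp
  rw [this]
  simp only [map_sub, map_mul, expHom_C, map_inv₀, expHom_plus_X, PowerSeries.coe_C,
    PowerSeries.coe_X, HahnSeries.inv_single]
  simp

theorem div_linFun_minus (a : ℂ) {b c e : ℂ} (he : e ≠ 0) :
    EndValue Sgn.minus (linFun a b / linFun c e) (b / e) := by
  rw [div_eq_mul_inv, div_eq_mul_inv b e, ← neg_mul_neg b, ← inv_neg]
  exact (linFun_minus a b).mul ((linFun_minus c e).inv (neg_ne_zero.2 he))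

theorem div_linFun_plus {a : ℂ} (b : ℂ) {c : ℂ} (e : ℂ) (hc : c ≠ 0) :
    EndValue Sgn.plus (linFun a b / linFun c e) (a / c) := by
  have hX : (RatFunc.X : RatFunc ℂ) ≠ 0 := RatFunc.X_ne_zero
  have hl := linFun_ne_zero hc e
  have : linFun a b / linFun c e =
      (linFun a b * RatFunc.X⁻¹) * (linFun c e * RatFunc.X⁻¹)⁻¹ := by field_simp
  rw [this, div_eq_mul_inv a]
  exact (linFun_plus a b).mul ((linFun_plus c e).inv hc)

end EndValue

/-! ### The difference of the two expansions -/

theorem expandCoeff_injective {f g : RatFunc ℂ}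
    (h : ∀ n, expandCoeff Sgn.minus f n = expandCoeff Sgn.minus g n) : f = g := by
  apply (algebraMap (RatFunc ℂ) (LaurentSeries ℂ)).injective
  ext n
  simpa [expandCoeff_minus, expHom] using h (-n)

/-- The two expansions of `1 / (z - p)` differ by `p⁻¹ δ(z / p)`. -/
theorem expandCoeff_inv_linFun_sub {p : ℂ} (hp : p ≠ 0) (n : ℤ) :
    expandCoeff Sgn.plus (linFun 1 p)⁻¹ n - expandCoeff Sgn.minus (linFun 1 p)⁻¹ n
      = p ^ (n - 1) := by
  have hl := linFun_ne_zero one_ne_zero p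
  have hX : (RatFunc.X : RatFunc ℂ) ≠ 0 := RatFunc.X_ne_zero
  -- Both expansions solve `(z - p) f = 1`. This is a first-order recurrence whose inhomogeneous
  -- term cancels in the difference.
  have hrec : ∀ s n, expandCoeff s (linFun 1 p)⁻¹ (n + 1) =
      p * expandCoeff s (linFun 1 p)⁻¹ n + expandCoeff s 1 n := by
    intro s n
    rw [← expandCoeff_X_mul, ← expandCoeff_C_mul, ← expandCoeff_add]
    congr 1
    field_simp
    simp [linFun]
  have h1 : ∀ n, expandCoeff Sgn.plus 1 n = expandCoeff Sgn.minus 1 n := by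
    intro n
    by_cases hn : n = 0 <;>
      simp [expandCoeff_plus, expandCoeff_minus, map_one, HahnSeries.coeff_one, hn]
  have hplus : EndValue Sgn.plus (linFun 1 p)⁻¹ 0 := by
    have e : (linFun 1 p)⁻¹ = RatFunc.X⁻¹ * (linFun 1 p * RatFunc.X⁻¹)⁻¹ := by field_simp
    rw [e, ← zero_mul (1 : ℂ)⁻¹]
    refine EndValue.mul ⟨PowerSeries.X, ?_, by simp⟩
      ((EndValue.linFun_plus 1 p).inv one_ne_zero)
    rw [map_inv₀, expHom_plus_X, PowerSeries.coe_X, HahnSeries.inv_single]; simp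
  have hminus := (EndValue.linFun_minus 1 p).inv (neg_ne_zero.2 hp)
  -- At `z⁻¹` only the expansion at infinity contributes, since the one at zero has no negative
  -- powers of `z`.
  have base : expandCoeff Sgn.plus (linFun 1 p)⁻¹ 1 - expandCoeff Sgn.minus (linFun 1 p)⁻¹ 1
      = 1 := by
    have := hrec Sgn.plus 0
    rw [zero_add, hplus.expandCoeff_zero, EndValue.one.expandCoeff_zero] at this
    rw [this, hminus.expandCoeff_minus_pos one_pos]; ring
  have step : ∀ n, expandCoeff Sgn.plus (linFun 1 p)⁻¹ (n + 1) -
      expandCoeff Sgn.minus (linFun 1 p)⁻¹ (n + 1) = p * (expandCoeff Sgn.plus (linFun 1 p)⁻¹ n -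
      expandCoeff Sgn.minus (linFun 1 p)⁻¹ n) := by
    intro n; rw [hrec, hrec, h1]; ring
  obtain ⟨m, rfl⟩ : ∃ m, n = m + 1 := ⟨n - 1, by ring⟩
  induction m using Int.induction_on with
  | zero => simpa using base
  | succ k ih =>
    rw [step, ih, add_sub_cancel_right, add_sub_cancel_right, zpow_add_one₀ hp, mul_comm]
  | pred k ih =>
    have h := step (-(k : ℤ) - 1 + 1)
    rw [sub_add_cancel, ih, add_sub_cancel_right] at h
    rw [sub_add_cancel, zpow_sub_one₀ hp, h]
    field_simp

/-- `f` has no pole at `p`. -/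
def HoloAt (p : ℂ) (f : RatFunc ℂ) : Prop := ∀ n < 0, (loc p f).coeff n = 0

theorem HoloAt.sub {p : ℂ} {f g : RatFunc ℂ} (hf : HoloAt p f) (hg : HoloAt p g) :
    HoloAt p (f - g) := fun n hn => by
  rw [map_sub, HahnSeries.coeff_sub, hf n hn, hg n hn, sub_zero]

theorem HoloAt.sum {ι : Type*} {p : ℂ} {t : Finset ι} {f : ι → RatFunc ℂ}
    (h : ∀ i ∈ t, HoloAt p (f i)) : HoloAt p (∑ i ∈ t, f i) := fun n hn => by
  rw [map_sum, HahnSeries.coeff_sum]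
  exact Finset.sum_eq_zero fun i hi => h i hi n hn

theorem holoAt_of_ordAt_nonneg {p : ℂ} {f : RatFunc ℂ} (h : 0 ≤ ordAt p f) : HoloAt p f :=
  fun n hn => HahnSeries.coeff_eq_zero_of_lt_order (by rw [ordAt] at h; omega)

theorem ordAt_nonneg_of_holoAt {p : ℂ} {f : RatFunc ℂ} (hf : f ≠ 0) (h : HoloAt p f) :
    0 ≤ ordAt p f := by
  by_contra! hn
  exact coeff_ordAt_ne_zero p hf (h _ hn)

theorem loc_C_mul_inv_linFun (p r : ℂ) :
    loc p (RatFunc.C r * (linFun 1 p)⁻¹) = HahnSeries.single (-1) r := by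
  have : loc p (linFun 1 p) = HahnSeries.single 1 1 := by
    simp [linFun, loc]
  rw [map_mul, map_inv₀, this, HahnSeries.inv_single]
  simp [loc, algebraMap_laurentSeries_C]

theorem holoAt_C_mul_inv_linFun {p p' : ℂ} (h : p ≠ p') (r : ℂ) :
    HoloAt p (RatFunc.C r * (linFun 1 p')⁻¹) := by
  by_cases hr : r = 0
  · subst hr; intro n _; simp
  apply holoAt_of_ordAt_nonneg
  have hC : (RatFunc.C r : RatFunc ℂ) ≠ 0 := by simpa using hr
  rw [ordAt_mul p hC (inv_ne_zero (linFun_ne_zero one_ne_zero p')), ordAt_inv,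
    ordAt_linFun p one_ne_zero, one_mul, if_neg h, ← RatFunc.algebraMap_C,
    (ordAt_polynomial_eq_zero p (by simpa using hr)).2 (by simpa using hr)]
  simp

/-- A non-constant denominator has a complex root, and this root would be a pole. -/
theorem eq_algebraMap_of_holoAt {f : RatFunc ℂ} (h : ∀ p, HoloAt p f) :
    ∃ P : Polynomial ℂ, f = algebraMap _ _ P := by
  by_cases hf : f = 0
  · exact ⟨0, by simp [hf]⟩
  refine ⟨f.num, ?_⟩
  have hd : f.denom = 1 := by
    rw [← (show f.denom.Monic from f.monic_denom).natDegree_eq_zero]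
    by_contra hdeg
    obtain ⟨p, hp⟩ := IsAlgClosed.exists_root f.denom (fun h0 => hdeg
      (Polynomial.natDegree_eq_zero_iff_degree_le_zero.2 h0.le))
    exact regularAt_of_ordAt_nonneg hf (ordAt_nonneg_of_holoAt hf (h p)) hp
  conv_lhs => rw [← RatFunc.num_div_denom f, hd]
  simp

theorem expandCoeff_plus_algebraMap (P : Polynomial ℂ) (m : ℕ) :
    expandCoeff Sgn.plus (algebraMap _ _ P) (-(m : ℤ)) = P.coeff m := by
  induction P using Polynomial.induction_on' with
  | add P Q hP hQ => rw [map_add, expandCoeff_add, hP, hQ, Polynomial.coeff_add]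
  | monomial k a =>
    have e : algebraMap (Polynomial ℂ) (RatFunc ℂ) (Polynomial.monomial k a) =
        RatFunc.C a * RatFunc.X ^ k := by
      rw [← Polynomial.C_mul_X_pow_eq_monomial]; simp
    rw [e, expandCoeff_C_mul, Polynomial.coeff_monomial, expandCoeff_plus, map_pow, expHom_plus_X,
      HahnSeries.single_pow, HahnSeries.coeff_single]
    simp only [one_pow, nsmul_eq_mul, mul_neg, mul_one, neg_inj, Nat.cast_inj]
    by_cases hk : k = m
    · simp [hk]
    · rw [if_neg hk, if_neg (Ne.symm hk), mul_zero]

/-- Subtracting the principal parts at the simple poles leaves a polynomial, and regularity at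
infinity makes it a constant. A constant has the same expansion at both ends, while each principal
part contributes a delta function. -/
theorem expandCoeff_plus_sub_minus {f : RatFunc ℂ} (P : Finset ℂ) (h0 : (0 : ℂ) ∉ P)
    (hreg : ∀ p ∉ P, 0 ≤ ordAt p f) (hsimple : ∀ p ∈ P, -1 ≤ ordAt p f)
    (hinf : ∀ n < 0, expandCoeff Sgn.plus f n = 0) (n : ℤ) :
    expandCoeff Sgn.plus f n - expandCoeff Sgn.minus f n =
      ∑ p ∈ P, residue f p * p ^ (n - 1) := by
  set T : RatFunc ℂ := ∑ p ∈ P, RatFunc.C (residue f p) * (linFun 1 p)⁻¹ with hT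
  have hholo : ∀ p, HoloAt p (f - T) := by
    intro p
    by_cases hp : p ∈ P
    · rw [hT, ← Finset.add_sum_erase P _ hp, ← sub_sub]
      refine HoloAt.sub (fun n hn => ?_) (HoloAt.sum fun p' hp' =>
        holoAt_C_mul_inv_linFun (Finset.ne_of_mem_erase hp').symm _)
      rw [map_sub, HahnSeries.coeff_sub, loc_C_mul_inv_linFun]
      rcases eq_or_ne n (-1) with rfl | hn1
      · simp [residue_eq_coeff]
      · rw [HahnSeries.coeff_single_of_ne hn1, sub_zero]
        apply HahnSeries.coeff_eq_zero_of_lt_order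
        have := hsimple p hp
        rw [ordAt] at this
        omega
    · exact (holoAt_of_ordAt_nonneg (hreg p hp)).sub (HoloAt.sum fun p' hp' =>
        holoAt_C_mul_inv_linFun (by rintro rfl; exact hp hp') _)
  obtain ⟨Q, hQ⟩ := eq_algebraMap_of_holoAt hholo
  have hf : f = algebraMap _ _ Q + T := by rw [← hQ]; ring
  have hTplus : EndValue Sgn.plus (linFun 1 0)⁻¹ 0 := by
    refine ⟨PowerSeries.X, ?_, by simp⟩
    rw [linFun, map_inv₀, map_sub, map_mul, expHom_plus_X, PowerSeries.coe_X]
    simp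
  -- A positive power of `z` in `Q` would show up in the expansion at infinity, where neither `f`
  -- nor any principal part has one.
  have hQ0 : Q = Polynomial.C (Q.coeff 0) := by
    ext m
    rcases Nat.eq_zero_or_pos m with rfl | hm
    · simp
    rw [Polynomial.coeff_C_of_ne_zero hm.ne', ← expandCoeff_plus_algebraMap, ← hQ, expandCoeff_sub,
      hinf _ (by omega), hT, expandCoeff_sum, zero_sub, neg_eq_zero]
    refine Finset.sum_eq_zero fun p hp => ?_
    have hv : EndValue Sgn.plus (linFun 1 p)⁻¹ (0 * 1⁻¹) := by
      have hX : (RatFunc.X : RatFunc ℂ) ≠ 0 := RatFunc.X_ne_zero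
      have hl := linFun_ne_zero one_ne_zero p
      have e : (linFun 1 p)⁻¹ = (linFun 1 0)⁻¹ * (linFun 1 p * RatFunc.X⁻¹)⁻¹ := by
        have : linFun 1 0 = RatFunc.X := by simp [linFun]
        rw [this]; field_simp
      rw [e]
      exact hTplus.mul ((EndValue.linFun_plus 1 p).inv one_ne_zero)
    rw [expandCoeff_C_mul, hv.expandCoeff_plus_neg (by omega), mul_zero]
  have hconst : expandCoeff Sgn.plus (algebraMap _ _ Q) n =
      expandCoeff Sgn.minus (algebraMap _ _ Q) n := by
    rw [hQ0, RatFunc.algebraMap_C, expandCoeff_plus, expandCoeff_minus, expHom_C, expHom_C,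
      HahnSeries.C_apply, HahnSeries.coeff_single, HahnSeries.coeff_single]
    simp
  conv_lhs => rw [hf]
  rw [expandCoeff_add, expandCoeff_add, hconst, add_sub_add_left_eq_sub, hT, expandCoeff_sum,
    expandCoeff_sum, ← Finset.sum_sub_distrib]
  refine Finset.sum_congr rfl fun p hp => ?_
  rw [expandCoeff_C_mul, expandCoeff_C_mul, ← mul_sub, expandCoeff_inv_linFun_sub]
  rintro rfl; exact h0 hp

end

end Toroidal

/-! ### Genericity, and the combinatorics of diagonal lines meeting a plane partition. -/

namespace Toroidal

noncomputable section

open scoped RatFunc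

/-! ### Positions -/

/-- Genericity of the parameters. -/
structure Generic (q d : ℂ) : Prop where
  q_ne : q ≠ 0
  d_ne : d ≠ 0
  indep : ∀ m n : ℤ, q ^ m * d ^ n = 1 → m = 0 ∧ n = 0

/-- The position of a lattice point. -/
def posZ (q d : ℂ) (x y z : ℤ) : ℂ := q₁ q d ^ (-x) * q₂ q ^ (-y) * q₃ q d ^ (-z)

theorem pos_eq_posZ (q d : ℂ) (b : Box) : pos q d b = posZ q d b.1 b.2.1 b.2.2 := rfl

namespace Generic

variable {q d : ℂ}

theorem q₁_ne (G : Generic q d) : q₁ q d ≠ 0 := mul_ne_zero (inv_ne_zero G.q_ne) G.d_ne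

theorem q₂_ne (G : Generic q d) : q₂ q ≠ 0 := pow_ne_zero 2 G.q_ne

theorem q₃_ne (G : Generic q d) : q₃ q d ≠ 0 := mul_ne_zero (inv_ne_zero G.q_ne) (inv_ne_zero G.d_ne)

theorem q_sub_inv_ne (G : Generic q d) : q - q⁻¹ ≠ 0 := by
  intro h
  have h1 : q ^ (2 : ℤ) * d ^ (0 : ℤ) = 1 := by
    have := G.q_ne
    field_simp at h
    rw [zpow_zero, mul_one]
    norm_cast
    linear_combination h
  exact absurd (G.indep _ _ h1).1 (by norm_num)

theorem posZ_eq (G : Generic q d) (x y z : ℤ) : posZ q d x y z = q ^ (x - 2 * y + z) * d ^ (z - x) := by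
  have hq := G.q_ne
  have hd := G.d_ne
  rw [posZ, q₁, q₂, q₃, mul_zpow, mul_zpow, inv_zpow', inv_zpow', inv_zpow', neg_neg, neg_neg,
    ← zpow_natCast, ← zpow_mul, zpow_add₀ hq, zpow_sub₀ hq, zpow_sub₀ hd, zpow_neg d]
  rw [show ((2 : ℕ) : ℤ) * -y = -(2 * y) by push_cast; ring, zpow_neg]
  field_simp

theorem posZ_ne_zero (G : Generic q d) (x y z : ℤ) : posZ q d x y z ≠ 0 := by
  rw [G.posZ_eq]
  exact mul_ne_zero (zpow_ne_zero _ G.q_ne) (zpow_ne_zero _ G.d_ne)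

/-- In terms of `q` and `d` the exponents are `x - 2y + z` and `z - x`. Their common kernel on the
lattice is spanned by `(1,1,1)`. -/
theorem posZ_inj (G : Generic q d) {x y z x' y' z' : ℤ} :
    posZ q d x y z = posZ q d x' y' z' ↔ x - x' = y - y' ∧ z - z' = y - y' := by
  rw [G.posZ_eq, G.posZ_eq]
  constructor
  · intro h
    have h1 : q ^ ((x - 2 * y + z) - (x' - 2 * y' + z')) * d ^ ((z - x) - (z' - x')) = 1 := by
      rw [zpow_sub₀ G.q_ne, zpow_sub₀ G.d_ne, div_mul_div_comm, h, div_self]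
      exact mul_ne_zero (zpow_ne_zero _ G.q_ne) (zpow_ne_zero _ G.d_ne)
    have := G.indep _ _ h1
    omega
  · intro h
    congr 2 <;> omega

theorem q₁_mul_posZ (G : Generic q d) (x y z : ℤ) : q₁ q d * posZ q d x y z = posZ q d (x - 1) y z := by
  rw [posZ, posZ, show -(x - 1) = 1 + -x by ring, zpow_add₀ G.q₁_ne, zpow_one]
  ring

theorem q₂_mul_posZ (G : Generic q d) (x y z : ℤ) : q₂ q * posZ q d x y z = posZ q d x (y - 1) z := by
  rw [posZ, posZ, show -(y - 1) = 1 + -y by ring, zpow_add₀ G.q₂_ne, zpow_one]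
  ring

theorem q₃_mul_posZ (G : Generic q d) (x y z : ℤ) : q₃ q d * posZ q d x y z = posZ q d x y (z - 1) := by
  rw [posZ, posZ, show -(z - 1) = 1 + -z by ring, zpow_add₀ G.q₃_ne, zpow_one]
  ring

end Generic

theorem posZ_zero (q d : ℂ) : posZ q d 0 0 0 = 1 := by simp [posZ]

/-! ### Lines of lattice points with a common position -/

/-- The integer indicator of a proposition. -/
def ind (P : Prop) : ℤ := open Classical in if P then 1 else 0

theorem ind_pos {P : Prop} (h : P) : ind P = 1 := if_pos h

theorem ind_neg {P : Prop} (h : ¬P) : ind P = 0 := if_neg h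

theorem ind_congr {P Q : Prop} (h : P ↔ Q) : ind P = ind Q := by rw [propext h]

theorem ind_or {P Q : Prop} (h : P → ¬Q) : ind (P ∨ Q) = ind P + ind Q := by
  by_cases hP : P
  · rw [ind_pos (Or.inl hP), ind_pos hP, ind_neg (h hP), add_zero]
  · rw [ind_neg hP, zero_add]; exact ind_congr (or_iff_right hP)

/-- The box `c` lies on the diagonal line through `(x, y, z)`. -/
def OnLine (c : Box) (x y z : ℤ) : Prop :=
  (c.1 : ℤ) - x = c.2.1 - y ∧ (c.2.2 : ℤ) - z = c.2.1 - y

/-- The order at the position of `(x, y, z)` of the factor of the box `c`. -/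
def boxOrd (c : Box) (x y z : ℤ) : ℤ :=
  ind (OnLine c (x + 1) y z) + ind (OnLine c x (y + 1) z) + ind (OnLine c x y (z + 1))
    - ind (OnLine c (x - 1) y z) - ind (OnLine c x (y - 1) z) - ind (OnLine c x y (z - 1))

/-- Membership in the union of `s` and the complement of the octant. -/
def MemExt (s : Finset Box) (x y z : ℤ) : Prop :=
  ∀ a b c : ℕ, (a : ℤ) = x → (b : ℤ) = y → (c : ℤ) = z → (a, b, c) ∈ s

theorem memExt_coe {s : Finset Box} {b : Box} : MemExt s b.1 b.2.1 b.2.2 ↔ b ∈ s := by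
  constructor
  · intro h; exact h _ _ _ rfl rfl rfl
  · intro h x y z hx hy hz
    rw [Nat.cast_inj] at hx hy hz
    subst hx hy hz; exact h

theorem memExt_of_neg {s : Finset Box} {x y z : ℤ} (h : x < 0 ∨ y < 0 ∨ z < 0) :
    MemExt s x y z := by
  intro a b c ha hb hc; omega

theorem memExt_mono {s : Finset Box} (hs : IsLowerSet (s : Set Box)) {x y z x' y' z' : ℤ}
    (hx : x ≤ x') (hy : y ≤ y') (hz : z ≤ z') (h : MemExt s x' y' z') : MemExt s x y z := by
  intro a b c ha hb hc
  have h1 := h x'.toNat y'.toNat z'.toNat (by omega) (by omega) (by omega)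
  refine hs (a := (x'.toNat, y'.toNat, z'.toNat)) ?_ h1
  refine ⟨?_, ?_, ?_⟩ <;> simp only <;> omega

theorem memExt_empty {x y z : ℤ} : MemExt ∅ x y z ↔ x < 0 ∨ y < 0 ∨ z < 0 := by
  constructor
  · intro h
    by_contra! h'
    simpa using h x.toNat y.toNat z.toNat (by omega) (by omega) (by omega)
  · exact memExt_of_neg

theorem memExt_erase {s : Finset Box} {m : Box} (hm : m ∈ s) {x y z : ℤ} :
    MemExt s x y z ↔ MemExt (s.erase m) x y z ∨
      ((m.1 : ℤ) = x ∧ (m.2.1 : ℤ) = y ∧ (m.2.2 : ℤ) = z) := by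
  constructor
  · intro h
    by_cases hmx : (m.1 : ℤ) = x ∧ (m.2.1 : ℤ) = y ∧ (m.2.2 : ℤ) = z
    · exact Or.inr hmx
    · refine Or.inl fun a b c ha hb hc => Finset.mem_erase.2 ⟨?_, h a b c ha hb hc⟩
      rintro rfl
      exact hmx ⟨ha, hb, hc⟩
  · rintro (h | ⟨rfl, rfl, rfl⟩)
    · exact fun a b c ha hb hc => Finset.mem_of_mem_erase (h a b c ha hb hc)
    · exact memExt_coe.2 hm

theorem isLowerSet_erase {s : Finset Box} (hs : IsLowerSet (s : Set Box)) {m : Box}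
    (hm : ∀ c ∈ s, m ≤ c → c = m) : IsLowerSet ((s.erase m : Finset Box) : Set Box) := by
  intro a b hba ha
  simp only [Finset.coe_erase, Set.mem_sdiff, Finset.mem_coe, Set.mem_singleton_iff] at ha ⊢
  refine ⟨hs hba ha.1, ?_⟩
  rintro rfl
  exact ha.2 (hm a ha.1 hba)

theorem memExt_box {s : Finset Box} {m : Box} (hm : ∀ c ∈ s, m ≤ c → c = m) {x y z : ℤ}
    (h : MemExt s x y z) (hx : m.1 ≤ x) (hy : m.2.1 ≤ y) (hz : m.2.2 ≤ z) :
    (m.1 : ℤ) = x ∧ (m.2.1 : ℤ) = y ∧ (m.2.2 : ℤ) = z := by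
  have h1 := h x.toNat y.toNat z.toNat (by omega) (by omega) (by omega)
  have h2 := hm _ h1 (by refine ⟨?_, ?_, ?_⟩ <;> simp only <;> omega)
  rw [Prod.ext_iff, Prod.ext_iff] at h2
  simp only at h2
  omega

/-- The order at a position in terms of the local shape at the end of its line. -/
theorem sum_boxOrd (s : Finset Box) (hs : IsLowerSet (s : Set Box)) (x y z : ℤ)
    (h0 : MemExt s x y z) (h1 : ¬MemExt s (x + 1) (y + 1) (z + 1)) :
    -ind (x = y ∧ z = y) + ∑ c ∈ s, boxOrd c x y z =
      ind (MemExt s (x + 1) y z) + ind (MemExt s x (y + 1) z) + ind (MemExt s x y (z + 1))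
        - ind (MemExt s x (y + 1) (z + 1)) - ind (MemExt s (x + 1) y (z + 1))
        - ind (MemExt s (x + 1) (y + 1) z) - 1 := by
  induction s using Finset.strongInduction generalizing x y z with
  | H s ih =>
  rcases s.eq_empty_or_nonempty with rfl | hne
  · rw [memExt_empty] at h0 h1
    simp only [memExt_empty, Finset.sum_empty, ind]
    split_ifs <;> omega
  · obtain ⟨m, hm⟩ := Finset.exists_maximal hne
    have hms : m ∈ s := hm.prop
    have hmax : ∀ c ∈ s, m ≤ c → c = m := fun c hc h => le_antisymm (hm.le_of_ge hc h) h
    have ht := isLowerSet_erase hs hmax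
    have key := ih _ (Finset.erase_ssubset hms) ht
    have hsum : ∀ x y z, ∑ c ∈ s, boxOrd c x y z =
        boxOrd m x y z + ∑ c ∈ s.erase m, boxOrd c x y z :=
      fun x y z => (Finset.add_sum_erase s _ hms).symm
    have hmt : ∀ x y z, MemExt (s.erase m) x y z →
        ¬((m.1 : ℤ) = x ∧ (m.2.1 : ℤ) = y ∧ (m.2.2 : ℤ) = z) := by
      rintro x y z h ⟨rfl, rfl, rfl⟩
      simp [memExt_coe] at h
    have hind : ∀ x y z, ind (MemExt s x y z) = ind (MemExt (s.erase m) x y z) +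
        ind ((m.1 : ℤ) = x ∧ (m.2.1 : ℤ) = y ∧ (m.2.2 : ℤ) = z) := by
      intro x y z
      rw [ind_congr (memExt_erase hms), ind_or (hmt x y z)]
    have hMm : MemExt s m.1 m.2.1 m.2.2 := memExt_coe.2 hms
    by_cases hL : OnLine m x y z
    · have hmx : (m.1 : ℤ) = x ∧ (m.2.1 : ℤ) = y ∧ (m.2.2 : ℤ) = z := by
        rw [OnLine] at hL
        rcases lt_trichotomy (m.1 : ℤ) x with h | h | h
        · have := memExt_box hmax h0 (by omega) (by omega) (by omega)
          omega
        · omega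
        · exact absurd (memExt_mono hs (by omega) (by omega) (by omega) hMm) h1
      obtain ⟨rfl, rfl, rfl⟩ := hmx
      have hf : ∀ x y z : ℤ, m.1 ≤ x → m.2.1 ≤ y → m.2.2 ≤ z →
          ¬((m.1 : ℤ) = x ∧ (m.2.1 : ℤ) = y ∧ (m.2.2 : ℤ) = z) → ind (MemExt s x y z) = 0 :=
        fun x y z hx hy hz hne => ind_neg fun h => hne (memExt_box hmax h hx hy hz)
      have ht' : ∀ x y z : ℤ, x ≤ m.1 → y ≤ m.2.1 → z ≤ m.2.2 →
          ¬((m.1 : ℤ) = x ∧ (m.2.1 : ℤ) = y ∧ (m.2.2 : ℤ) = z) →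
          MemExt (s.erase m) x y z :=
        fun x y z hx hy hz hne => ((memExt_erase hms).1 (memExt_mono hs hx hy hz hMm)).resolve_right
          hne
      -- Without `m` the line ends one step earlier, and there all six neighbours are present,
      -- giving `3 - 3 - 1 = -1`. With `m` none of the six neighbours is present, giving `-1` again,
      -- in accordance with `boxOrd m` vanishing on its own line.
      have key' := key (m.1 - 1) (m.2.1 - 1) (m.2.2 - 1)
        (ht' _ _ _ (by omega) (by omega) (by omega) (by omega))
        (by simp only [sub_add_cancel]; rw [memExt_coe]; simp)
      simp only [sub_add_cancel] at key'
      rw [ind_pos (ht' m.1 _ _ (by omega) (by omega) (by omega) (by omega)),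
        ind_pos (ht' _ m.2.1 _ (by omega) (by omega) (by omega) (by omega)),
        ind_pos (ht' _ _ m.2.2 (by omega) (by omega) (by omega) (by omega)),
        ind_pos (ht' _ m.2.1 m.2.2 (by omega) (by omega) (by omega) (by omega)),
        ind_pos (ht' m.1 _ m.2.2 (by omega) (by omega) (by omega) (by omega)),
        ind_pos (ht' m.1 m.2.1 _ (by omega) (by omega) (by omega) (by omega))] at key'
      rw [hf _ _ _ (by omega) (by omega) (by omega) (by omega),
        hf _ _ _ (by omega) (by omega) (by omega) (by omega),
        hf _ _ _ (by omega) (by omega) (by omega) (by omega),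
        hf _ _ _ (by omega) (by omega) (by omega) (by omega),
        hf _ _ _ (by omega) (by omega) (by omega) (by omega),
        hf _ _ _ (by omega) (by omega) (by omega) (by omega), hsum]
      have hb0 : boxOrd m m.1 m.2.1 m.2.2 = 0 := by
        simp only [boxOrd, ind, OnLine]
        split_ifs <;> omega
      have hsh : ∀ c : Box, boxOrd c (m.1 - 1) (m.2.1 - 1) (m.2.2 - 1) =
          boxOrd c m.1 m.2.1 m.2.2 := by
        intro c
        simp only [boxOrd]
        congr 1; congr 1; congr 1; congr 1; congr 1
        all_goals exact ind_congr (by simp only [OnLine]; omega)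
      simp only [hsh] at key'
      rw [hb0, zero_add]
      have hi : ind (((m.1 : ℤ) - 1 = m.2.1 - 1) ∧ ((m.2.2 : ℤ) - 1 = m.2.1 - 1)) =
          ind (((m.1 : ℤ) = m.2.1) ∧ ((m.2.2 : ℤ) = m.2.1)) := ind_congr (by omega)
      rw [hi] at key'
      omega
    · have hmx : ¬((m.1 : ℤ) = x ∧ (m.2.1 : ℤ) = y ∧ (m.2.2 : ℤ) = z) := by
        rintro ⟨rfl, rfl, rfl⟩; exact hL ⟨by ring, by ring⟩
      have key' := key x y z (((memExt_erase hms).1 h0).resolve_right hmx)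
        (fun h => h1 ((memExt_erase hms).2 (Or.inl h)))
      -- For `m` off the line, lying on the line of one of the six neighbours means being that
      -- neighbour. Hence removing `m` changes both sides by the same indicator.
      have hoff : ∀ a b c : ℤ, 0 ≤ a → a ≤ 1 → 0 ≤ b → b ≤ 1 → 0 ≤ c → c ≤ 1 →
          (OnLine m (x + a) (y + b) (z + c) ↔
            ((m.1 : ℤ) = x + a ∧ (m.2.1 : ℤ) = y + b ∧ (m.2.2 : ℤ) = z + c)) := by
        intro a b c ha ha' hb hb' hc hc'
        constructor
        · intro h
          rw [OnLine] at h
          rcases lt_trichotomy (m.1 : ℤ) (x + a) with h' | h' | h'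
          · exact absurd (memExt_box hmax h0 (by omega) (by omega) (by omega)) hmx
          · omega
          · exact absurd (memExt_mono hs (by omega) (by omega) (by omega) hMm) h1
        · rintro ⟨e1, e2, e3⟩
          rw [OnLine, e1, e2, e3]; omega
      -- The lines through `(x - 1, y, z)` and `(x, y + 1, z + 1)` coincide, and likewise for the
      -- other two negative terms.
      have hb : boxOrd m x y z =
          ind ((m.1 : ℤ) = x + 1 ∧ (m.2.1 : ℤ) = y ∧ (m.2.2 : ℤ) = z) +
          ind ((m.1 : ℤ) = x ∧ (m.2.1 : ℤ) = y + 1 ∧ (m.2.2 : ℤ) = z) +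
          ind ((m.1 : ℤ) = x ∧ (m.2.1 : ℤ) = y ∧ (m.2.2 : ℤ) = z + 1) -
          ind ((m.1 : ℤ) = x ∧ (m.2.1 : ℤ) = y + 1 ∧ (m.2.2 : ℤ) = z + 1) -
          ind ((m.1 : ℤ) = x + 1 ∧ (m.2.1 : ℤ) = y ∧ (m.2.2 : ℤ) = z + 1) -
          ind ((m.1 : ℤ) = x + 1 ∧ (m.2.1 : ℤ) = y + 1 ∧ (m.2.2 : ℤ) = z) := by
        have a1 := hoff 1 0 0 (by simp) (by simp) (by simp) (by simp) (by simp) (by simp)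
        have a2 := hoff 0 1 0 (by simp) (by simp) (by simp) (by simp) (by simp) (by simp)
        have a3 := hoff 0 0 1 (by simp) (by simp) (by simp) (by simp) (by simp) (by simp)
        have b1 := hoff 0 1 1 (by simp) (by simp) (by simp) (by simp) (by simp) (by simp)
        have b2 := hoff 1 0 1 (by simp) (by simp) (by simp) (by simp) (by simp) (by simp)
        have b3 := hoff 1 1 0 (by simp) (by simp) (by simp) (by simp) (by simp) (by simp)
        simp only [add_zero] at a1 a2 a3 b1 b2 b3
        rw [boxOrd, ← ind_congr a1, ← ind_congr a2, ← ind_congr a3, ← ind_congr b1,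
          ← ind_congr b2, ← ind_congr b3]
        congr 1; congr 1; congr 1
        all_goals exact ind_congr (by simp only [OnLine]; omega)
      rw [hsum, hb, hind, hind, hind, hind, hind, hind]
      linarith

/-- Far back the line lies outside the octant, where `MemExt` holds vacuously. Far ahead it leaves
the finite set `s`. -/
theorem exists_end_of_line (s : Finset Box) (x y z : ℤ) :
    ∃ t : ℤ, MemExt s (x + t) (y + t) (z + t) ∧ ¬MemExt s (x + t + 1) (y + t + 1) (z + t + 1) := by
  have hbdd : ∀ t, MemExt s (x + t) (y + t) (z + t) →
      t ≤ max (-x) (max (-y) (-z)) + ∑ c ∈ s, (c.1 : ℤ) + |x| := by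
    intro t h
    by_contra! hlt
    have hnn : 0 ≤ ∑ c ∈ s, (c.1 : ℤ) := Finset.sum_nonneg fun c _ => by positivity
    have hx := le_max_left (-x) (max (-y) (-z))
    have hy := (le_max_left (-y) (-z)).trans (le_max_right (-x) _)
    have hz := (le_max_right (-y) (-z)).trans (le_max_right (-x) _)
    have hax := abs_nonneg x
    have hax' := neg_abs_le x
    have h1 := h (x + t).toNat (y + t).toNat (z + t).toNat (by omega) (by omega) (by omega)
    have h2 := Finset.single_le_sum (f := fun c : Box => (c.1 : ℤ))
      (fun c _ => by positivity) h1
    simp only at h2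
    omega
  obtain ⟨t, ht, hmax⟩ := Int.exists_greatest_of_bdd (P := fun t => MemExt s (x + t) (y + t) (z + t))
    ⟨_, hbdd⟩ ⟨-x - 1, memExt_of_neg (by omega)⟩
  refine ⟨t, ht, fun h => ?_⟩
  have := hmax (t + 1) (by convert h using 1 <;> ring)
  omega

end

end Toroidal

/-! ### The poles of the weight of a plane partition are its corners. -/

namespace Toroidal

noncomputable section

open scoped RatFunc

/-! ### Orders of the weights -/

theorem rootA_apply_eq (q d : ℂ) (c i : ZMod 2) (a : ℂ) :
    rootA q d c a i = if i = c then linFun (q₂ q) a / linFun 1 (q₂ q * a)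
      else (linFun (q₁ q d) a * linFun (q₃ q d) a) /
        (linFun 1 (q₁ q d * a) * linFun 1 (q₃ q d * a)) := by
  simp [rootA, linFun]

theorem psiMacMahon_apply_eq (κ : ℂ) (i : ZMod 2) :
    psiMacMahon κ i = if i = 0 then linFun κ κ⁻¹ / linFun 1 1 else 1 := by
  simp [psiMacMahon, linFun]

theorem boxesWeight_apply (q d : ℂ) (s : Finset Box) (i : ZMod 2) :
    boxesWeight q d s i = ∏ b ∈ s, (rootA q d (color b) (pos q d b) i)⁻¹ := by
  rw [boxesWeight, Finset.prod_apply]; rfl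

theorem rootA_ne_zero {q d : ℂ} (G : Generic q d) (c i : ZMod 2) (a : ℂ) :
    rootA q d c a i ≠ 0 := by
  have h1 := linFun_ne_zero G.q₁_ne a
  have h2 := linFun_ne_zero G.q₂_ne a
  have h3 := linFun_ne_zero G.q₃_ne a
  have h4 := fun b => linFun_ne_zero one_ne_zero b
  rw [rootA_apply_eq]
  split_ifs
  · exact div_ne_zero h2 (h4 _)
  · exact div_ne_zero (mul_ne_zero h1 h3) (mul_ne_zero (h4 _) (h4 _))

theorem boxesWeight_ne_zero {q d : ℂ} (G : Generic q d) (s : Finset Box) (i : ZMod 2) :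
    boxesWeight q d s i ≠ 0 := by
  rw [boxesWeight_apply]
  exact Finset.prod_ne_zero_iff.2 fun b _ => inv_ne_zero (rootA_ne_zero G _ _ _)

theorem psiMacMahon_ne_zero {κ : ℂ} (hκ : κ ≠ 0) (i : ZMod 2) : psiMacMahon κ i ≠ 0 := by
  rw [psiMacMahon_apply_eq]
  split_ifs
  · exact div_ne_zero (linFun_ne_zero hκ _) (linFun_ne_zero one_ne_zero _)
  · exact one_ne_zero

theorem ordAt_div (p : ℂ) {f g : RatFunc ℂ} (hf : f ≠ 0) (hg : g ≠ 0) :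
    ordAt p (f / g) = ordAt p f - ordAt p g := by
  rw [div_eq_mul_inv, ordAt_mul p hf (inv_ne_zero hg), ordAt_inv, sub_eq_add_neg]

theorem ordAt_linFun_ind (p : ℂ) {a : ℂ} (ha : a ≠ 0) (b : ℂ) :
    ordAt p (linFun a b) = ind (a * p = b) := by
  rw [ordAt_linFun p ha, ind]

theorem ordAt_rootA_inv {q d : ℂ} (G : Generic q d) (p a : ℂ) (c i : ZMod 2) :
    ordAt p (rootA q d c a i)⁻¹ =
      if i = c then ind (p = q₂ q * a) - ind (q₂ q * p = a)
      else ind (p = q₁ q d * a) + ind (p = q₃ q d * a)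
        - ind (q₁ q d * p = a) - ind (q₃ q d * p = a) := by
  have h1 := linFun_ne_zero G.q₁_ne a
  have h2 := linFun_ne_zero G.q₂_ne a
  have h3 := linFun_ne_zero G.q₃_ne a
  have h4 := fun b => linFun_ne_zero one_ne_zero b
  rw [rootA_apply_eq, ordAt_inv]
  split_ifs
  · rw [ordAt_div p h2 (h4 _), ordAt_linFun_ind p G.q₂_ne, ordAt_linFun_ind p one_ne_zero, one_mul]
    ring
  · rw [ordAt_div p (mul_ne_zero h1 h3) (mul_ne_zero (h4 _) (h4 _)), ordAt_mul p h1 h3,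
      ordAt_mul p (h4 _) (h4 _), ordAt_linFun_ind p G.q₁_ne, ordAt_linFun_ind p G.q₃_ne,
      ordAt_linFun_ind p one_ne_zero, ordAt_linFun_ind p one_ne_zero, one_mul]
    ring

/-- The color of a lattice point. -/
def colorZ (x z : ℤ) : ZMod 2 := ((x + z : ℤ) : ZMod 2)

theorem color_eq_colorZ (b : Box) : color b = colorZ b.1 b.2.2 := by
  simp [color, colorZ]

theorem colorZ_eq_iff {x z x' z' : ℤ} : colorZ x z = colorZ x' z' ↔ (2 : ℤ) ∣ (x' + z') - (x + z) :=
  ZMod.intCast_eq_intCast_iff_dvd_sub _ _ 2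

/-- A unit shift in `x` or `z` changes the color and a shift in `y` does not. Parity therefore kills
exactly those of the six indicators that do not come from the relevant component of `A`. -/
theorem ordAt_rootA_inv_posZ {q d : ℂ} (G : Generic q d) (c : Box) (x y z : ℤ) :
    ordAt (posZ q d x y z) (rootA q d (color c) (pos q d c) (colorZ x z))⁻¹ = boxOrd c x y z := by
  rw [ordAt_rootA_inv G, pos_eq_posZ, G.q₁_mul_posZ, G.q₂_mul_posZ, G.q₃_mul_posZ, G.q₁_mul_posZ,
    G.q₂_mul_posZ, G.q₃_mul_posZ, color_eq_colorZ, G.posZ_inj, G.posZ_inj, G.posZ_inj, G.posZ_inj,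
    G.posZ_inj, G.posZ_inj, boxOrd]
  simp only [OnLine]
  split_ifs with h
  · rw [colorZ_eq_iff] at h
    rw [ind_neg (P := (c.1 : ℤ) - (x + 1) = _ ∧ _) (by omega),
      ind_neg (P := _ ∧ (c.2.2 : ℤ) - (z + 1) = _) (by omega),
      ind_neg (P := (c.1 : ℤ) - (x - 1) = _ ∧ _) (by omega),
      ind_neg (P := _ ∧ (c.2.2 : ℤ) - (z - 1) = _) (by omega)]
    simp only [zero_add, add_zero, sub_zero]
    congr 1 <;> exact ind_congr (by omega)
  · rw [colorZ_eq_iff] at h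
    rw [ind_neg (P := (c.1 : ℤ) - x = c.2.1 - (y + 1) ∧ _) (by omega),
      ind_neg (P := (c.1 : ℤ) - x = c.2.1 - (y - 1) ∧ _) (by omega)]
    simp only [add_zero, sub_zero]
    congr 1
    · congr 1
      · congr 1 <;> exact ind_congr (by omega)
      · exact ind_congr (by omega)
    · exact ind_congr (by omega)

/-- Genericity of the level. -/
structure GenericLevel (q d κ : ℂ) : Prop where
  ne_zero : κ ≠ 0
  zero_ne : ∀ x y z : ℤ, Even (x + z) → κ * posZ q d x y z ≠ κ⁻¹

/-- Adding a multiple of `(1,1,1)` changes neither the position nor the parity of `x + z`, so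
integer exponents can be made non-negative. -/
theorem GenericLevel.of_ne {q d κ : ℂ} (G : Generic q d) (hκ₀ : κ ≠ 0)
    (hκ : ∀ i j k : ℕ, Even (i + k) → κ ^ 2 ≠ q₁ q d ^ i * q₂ q ^ j * q₃ q d ^ k) :
    GenericLevel q d κ := by
  refine ⟨hκ₀, fun x y z he h => ?_⟩
  set t : ℤ := |x| + |y| + |z|
  have hx := neg_abs_le x
  have hy := neg_abs_le y
  have hz := neg_abs_le z
  have ax := abs_nonneg x
  have ay := abs_nonneg y
  have az := abs_nonneg z
  obtain ⟨i, hi⟩ := Int.eq_ofNat_of_zero_le (show 0 ≤ x + t by omega)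
  obtain ⟨j, hj⟩ := Int.eq_ofNat_of_zero_le (show 0 ≤ y + t by omega)
  obtain ⟨k, hk⟩ := Int.eq_ofNat_of_zero_le (show 0 ≤ z + t by omega)
  have e : posZ q d x y z = posZ q d i j k := G.posZ_inj.2 (by omega)
  refine hκ i j k ?_ ?_
  · rw [← Int.even_coe_nat]
    rw [Int.even_iff] at he ⊢
    push_cast
    omega
  · rw [e, posZ, zpow_neg, zpow_neg, zpow_neg, zpow_natCast, zpow_natCast, zpow_natCast] at h
    have h1 := pow_ne_zero i G.q₁_ne
    have h2 := pow_ne_zero j G.q₂_ne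
    have h3 := pow_ne_zero k G.q₃_ne
    field_simp at h
    exact h

/-- The numerator of `Ψ⁰` has no zero at a lattice point of color `0`, by genericity of the level.
The pole at `1` is seen exactly by the line through the origin. -/
theorem ordAt_psiMacMahon {q d κ : ℂ} (G : Generic q d) (hκ : GenericLevel q d κ) (x y z : ℤ) :
    ordAt (posZ q d x y z) (psiMacMahon κ (colorZ x z)) = -ind (x = y ∧ z = y) := by
  rw [psiMacMahon_apply_eq]
  have h0 : (0 : ZMod 2) = colorZ 0 0 := by simp [colorZ]
  rw [h0]
  split_ifs with h <;> rw [colorZ_eq_iff] at h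
  · rw [ordAt_div _ (linFun_ne_zero hκ.ne_zero _) (linFun_ne_zero one_ne_zero _),
      ordAt_linFun_ind _ hκ.ne_zero, ordAt_linFun_ind _ one_ne_zero,
      ind_neg (hκ.zero_ne x y z (by rw [Int.even_iff]; omega)), zero_sub, one_mul,
      ← posZ_zero q d, G.posZ_inj]
    congr 1; exact ind_congr (by omega)
  · rw [ordAt_one, ind_neg (by omega), neg_zero]

/-- The weight of a set of boxes over the reference state. -/
def fullWeight (q d κ : ℂ) (s : Finset Box) (i : ZMod 2) : RatFunc ℂ :=
  psiMacMahon κ i * boxesWeight q d s i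

theorem fullWeight_ne_zero {q d κ : ℂ} (G : Generic q d) (hκ : GenericLevel q d κ)
    (s : Finset Box) (i : ZMod 2) : fullWeight q d κ s i ≠ 0 :=
  mul_ne_zero (psiMacMahon_ne_zero hκ.ne_zero i) (boxesWeight_ne_zero G s i)

theorem ordAt_fullWeight_eq_add {q d κ : ℂ} (G : Generic q d) (hκ : GenericLevel q d κ)
    (s : Finset Box) (i : ZMod 2) (p : ℂ) :
    ordAt p (fullWeight q d κ s i) = ordAt p (psiMacMahon κ i) +
      ∑ b ∈ s, ordAt p (rootA q d (color b) (pos q d b) i)⁻¹ := by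
  rw [fullWeight, ordAt_mul p (psiMacMahon_ne_zero hκ.ne_zero i) (boxesWeight_ne_zero G s i),
    boxesWeight_apply, ordAt_prod]
  exact fun b _ => inv_ne_zero (rootA_ne_zero G _ _ _)

theorem ordAt_fullWeight {q d κ : ℂ} (G : Generic q d) (hκ : GenericLevel q d κ)
    (s : Finset Box) (x y z : ℤ) :
    ordAt (posZ q d x y z) (fullWeight q d κ s (colorZ x z)) =
      -ind (x = y ∧ z = y) + ∑ c ∈ s, boxOrd c x y z := by
  rw [ordAt_fullWeight_eq_add G hκ, ordAt_psiMacMahon G hκ]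
  simp only [ordAt_rootA_inv_posZ G]

theorem mem_of_le_concave {s : Finset Box} {b c : Box}
    (h : IsLowerSet ((insert b s : Finset Box) : Set Box)) (hc : c ≤ b) (hne : c ≠ b) : c ∈ s := by
  have := h hc (by simp)
  simp only [Finset.coe_insert, Set.mem_insert_iff, Finset.mem_coe] at this
  exact this.resolve_left hne

/-- The line of a concave box `b` ends at `b - (1,1,1)`, possibly outside the octant. All six
neighbours of this end lie weakly below `b` and differ from it, hence are present, and `3 - 3 - 1 =
-1`. -/
theorem ordAt_fullWeight_concave {q d κ : ℂ} (G : Generic q d) (hκ : GenericLevel q d κ)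
    {s : Finset Box} (hs : IsLowerSet (s : Set Box)) {b : Box} (hb : b ∉ s)
    (hbs : IsLowerSet ((insert b s : Finset Box) : Set Box)) :
    ordAt (pos q d b) (fullWeight q d κ s (color b)) = -1 := by
  have key : ∀ x y z : ℤ, x ≤ b.1 → y ≤ b.2.1 → z ≤ b.2.2 →
      ¬((b.1 : ℤ) = x ∧ (b.2.1 : ℤ) = y ∧ (b.2.2 : ℤ) = z) → MemExt s x y z := by
    intro x y z hx hy hz hne a e c ha he hc
    refine mem_of_le_concave hbs ⟨?_, ?_, ?_⟩ ?_
    · simp only; omega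
    · simp only; omega
    · simp only; omega
    · rintro rfl; exact hne ⟨ha, he, hc⟩
  have h := sum_boxOrd s hs (b.1 - 1) (b.2.1 - 1) (b.2.2 - 1)
    (key _ _ _ (by omega) (by omega) (by omega) (by omega))
    (by simp only [sub_add_cancel]; rwa [memExt_coe])
  rw [← ordAt_fullWeight G hκ, sub_add_cancel, sub_add_cancel, sub_add_cancel,
    ind_pos (key _ _ _ (by omega) (by omega) (by omega) (by omega)),
    ind_pos (key _ _ _ (by omega) (by omega) (by omega) (by omega)),
    ind_pos (key _ _ _ (by omega) (by omega) (by omega) (by omega)),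
    ind_pos (key _ _ _ (by omega) (by omega) (by omega) (by omega)),
    ind_pos (key _ _ _ (by omega) (by omega) (by omega) (by omega)),
    ind_pos (key _ _ _ (by omega) (by omega) (by omega) (by omega))] at h
  have e1 : pos q d b = posZ q d (b.1 - 1) (b.2.1 - 1) (b.2.2 - 1) := by
    rw [pos_eq_posZ, G.posZ_inj]; omega
  have e2 : color b = colorZ (b.1 - 1) (b.2.2 - 1) := by
    rw [color_eq_colorZ, colorZ_eq_iff]; omega
  rw [e1, e2, h]; norm_num

/-- Points where a weight has negative order are lattice points of matching color. -/
theorem exists_posZ_of_ordAt_neg {q d κ : ℂ} (G : Generic q d) (hκ : GenericLevel q d κ)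
    {s : Finset Box} {i : ZMod 2} {p : ℂ} (h : ordAt p (fullWeight q d κ s i) < 0) :
    ∃ x y z : ℤ, p = posZ q d x y z ∧ i = colorZ x z := by
  rw [ordAt_fullWeight_eq_add G hκ] at h
  have hind : ∀ P : Prop, 0 ≤ ind P := by
    intro P; rw [ind]; split_ifs <;> norm_num
  by_cases hpsi : ordAt p (psiMacMahon κ i) < 0
  · rw [psiMacMahon_apply_eq] at hpsi
    split_ifs at hpsi with hi
    · rw [ordAt_div _ (linFun_ne_zero hκ.ne_zero _) (linFun_ne_zero one_ne_zero _),
        ordAt_linFun_ind _ hκ.ne_zero, ordAt_linFun_ind _ one_ne_zero] at hpsi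
      refine ⟨0, 0, 0, ?_, by simp [colorZ, hi]⟩
      by_contra hp
      rw [posZ_zero] at hp
      rw [ind_neg (P := 1 * p = 1) (by simpa using hp)] at hpsi
      have := hind (κ * p = κ⁻¹)
      omega
    · rw [ordAt_one] at hpsi; exact absurd hpsi (lt_irrefl _)
  · obtain ⟨c, -, hc⟩ : ∃ c ∈ s, ordAt p (rootA q d (color c) (pos q d c) i)⁻¹ < 0 := by
      by_contra! hall
      have := Finset.sum_nonneg hall
      omega
    rw [ordAt_rootA_inv G] at hc
    split_ifs at hc with hi
    · refine ⟨c.1, c.2.1 + 1, c.2.2, ?_, by rw [hi, color_eq_colorZ]⟩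
      by_contra hp
      rw [ind_neg (P := q₂ q * p = pos q d c)] at hc
      · have := hind (p = q₂ q * pos q d c)
        omega
      · intro h1
        apply hp
        apply mul_left_cancel₀ G.q₂_ne
        rw [h1, G.q₂_mul_posZ, add_sub_cancel_right, pos_eq_posZ]
    · have hodd : ∀ x z : ℤ, x + z = c.1 + c.2.2 + 1 → i = colorZ x z := by
        intro x z hxz
        have h2 : ∀ a b e : ZMod 2, a ≠ b → e = b + 1 → a = e := by decide
        refine h2 _ _ _ hi ?_
        rw [colorZ, hxz, color]
        push_cast
        rfl
      by_contra! hp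
      rw [ind_neg (P := q₁ q d * p = pos q d c), ind_neg (P := q₃ q d * p = pos q d c)] at hc
      · have := hind (p = q₁ q d * pos q d c)
        have := hind (p = q₃ q d * pos q d c)
        omega
      · intro h1
        refine hp c.1 c.2.1 (c.2.2 + 1) ?_ (hodd _ _ (by ring))
        apply mul_left_cancel₀ G.q₃_ne
        rw [h1, G.q₃_mul_posZ, add_sub_cancel_right, pos_eq_posZ]
      · intro h1
        refine hp (c.1 + 1) c.2.1 c.2.2 ?_ (hodd _ _ (by ring))
        apply mul_left_cancel₀ G.q₁_ne
        rw [h1, G.q₁_mul_posZ, add_sub_cancel_right, pos_eq_posZ]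

/-- The weight of a plane partition has poles only at its concave and convex boxes. -/
theorem exists_box_of_ordAt_neg {q d κ : ℂ} (G : Generic q d) (hκ : GenericLevel q d κ)
    {s : Finset Box} (hs : IsLowerSet (s : Set Box)) {i : ZMod 2} {p : ℂ}
    (h : ordAt p (fullWeight q d κ s i) < 0) :
    ∃ b : Box, p = pos q d b ∧ color b = i ∧
      ((b ∉ s ∧ IsLowerSet ((insert b s : Finset Box) : Set Box)) ∨
        (b ∈ s ∧ IsLowerSet ((s.erase b : Finset Box) : Set Box))) := by
  obtain ⟨x₀, y₀, z₀, hp, hi⟩ := exists_posZ_of_ordAt_neg G hκ h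
  obtain ⟨t, h0, h1⟩ := exists_end_of_line s x₀ y₀ z₀
  generalize hx : x₀ + t = x at h0 h1
  generalize hy : y₀ + t = y at h0 h1
  generalize hz : z₀ + t = z at h0 h1
  have hp' : p = posZ q d x y z := by rw [hp, G.posZ_inj]; omega
  have hi' : i = colorZ x z := by rw [hi, colorZ_eq_iff]; omega
  clear hp hi
  subst hp' hi'
  rw [ordAt_fullWeight G hκ, sum_boxOrd s hs x y z h0 h1] at h
  have m1 : MemExt s x (y + 1) (z + 1) → MemExt s x (y + 1) z ∧ MemExt s x y (z + 1) := fun h =>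
    ⟨memExt_mono hs (by omega) (by omega) (by omega) h,
      memExt_mono hs (by omega) (by omega) (by omega) h⟩
  have m2 : MemExt s (x + 1) y (z + 1) → MemExt s (x + 1) y z ∧ MemExt s x y (z + 1) := fun h =>
    ⟨memExt_mono hs (by omega) (by omega) (by omega) h,
      memExt_mono hs (by omega) (by omega) (by omega) h⟩
  have m3 : MemExt s (x + 1) (y + 1) z → MemExt s (x + 1) y z ∧ MemExt s x (y + 1) z := fun h =>
    ⟨memExt_mono hs (by omega) (by omega) (by omega) h,
      memExt_mono hs (by omega) (by omega) (by omega) h⟩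
  -- If `k` of the three single-step neighbours are present, then at most `k(k-1)/2` of the
  -- double-step ones are. So the order is negative only for `k = 0`, or for `k = 3` with all six
  -- present. In the second case the next point of the line is a concave box, in the first the end
  -- of the line is a convex one.
  have cases : (MemExt s x (y + 1) (z + 1) ∧ MemExt s (x + 1) y (z + 1) ∧
      MemExt s (x + 1) (y + 1) z) ∨
      (¬MemExt s (x + 1) y z ∧ ¬MemExt s x (y + 1) z ∧ ¬MemExt s x y (z + 1)) := by
    by_contra hcon
    revert h hcon m1 m2 m3
    generalize MemExt s x (y + 1) (z + 1) = B1
    generalize MemExt s (x + 1) y (z + 1) = B2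
    generalize MemExt s (x + 1) (y + 1) z = B3
    generalize MemExt s (x + 1) y z = A1
    generalize MemExt s x (y + 1) z = A2
    generalize MemExt s x y (z + 1) = A3
    intro h m1 m2 m3 hcon
    by_cases hA1 : A1 <;> by_cases hA2 : A2 <;> by_cases hA3 : A3 <;> by_cases hB1 : B1 <;>
      by_cases hB2 : B2 <;> by_cases hB3 : B3 <;> simp [ind, hA1, hA2, hA3, hB1, hB2, hB3] at *
  rcases cases with ⟨hb1, hb2, hb3⟩ | ⟨ha1, ha2, ha3⟩
  · have hnn : 0 ≤ x + 1 ∧ 0 ≤ y + 1 ∧ 0 ≤ z + 1 := by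
      by_contra hneg
      exact h1 (memExt_of_neg (by omega))
    obtain ⟨a, ha⟩ := Int.eq_ofNat_of_zero_le hnn.1
    obtain ⟨b, hb⟩ := Int.eq_ofNat_of_zero_le hnn.2.1
    obtain ⟨c, hc⟩ := Int.eq_ofNat_of_zero_le hnn.2.2
    refine ⟨(a, b, c), ?_, ?_, Or.inl ⟨?_, ?_⟩⟩
    · rw [pos_eq_posZ, G.posZ_inj]; simp only; omega
    · rw [color_eq_colorZ, colorZ_eq_iff]; simp only; omega
    · rw [ha, hb, hc] at h1
      exact fun hmem => h1 (memExt_coe (b := (a, b, c)).2 hmem)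
    · intro u v hvu hu
      simp only [Finset.coe_insert, Set.mem_insert_iff, Finset.mem_coe] at hu ⊢
      rcases hu with rfl | hu
      · by_cases hv : v = (a, b, c)
        · exact Or.inl hv
        · right
          rw [← memExt_coe]
          obtain ⟨v1, v2, v3⟩ := v
          obtain ⟨l1, l2, l3⟩ := hvu
          simp only [Prod.mk.injEq] at l1 l2 l3 hv ⊢
          rcases lt_or_eq_of_le l1 with l1' | l1'
          · exact memExt_mono hs (by omega) (by omega) (by omega) hb1
          · rcases lt_or_eq_of_le l2 with l2' | l2'
            · exact memExt_mono hs (by omega) (by omega) (by omega) hb2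
            · exact memExt_mono hs (by omega) (by omega) (by omega) hb3
      · exact Or.inr (hs hvu hu)
  · have hnn : 0 ≤ x ∧ 0 ≤ y ∧ 0 ≤ z := by
      by_contra hneg
      rcases lt_or_ge x 0 with hx0 | hx0
      · exact ha2 (memExt_of_neg (by omega))
      · rcases lt_or_ge y 0 with hy0 | hy0
        · exact ha1 (memExt_of_neg (by omega))
        · exact ha1 (memExt_of_neg (by omega))
    obtain ⟨a, ha⟩ := Int.eq_ofNat_of_zero_le hnn.1
    obtain ⟨b, hb⟩ := Int.eq_ofNat_of_zero_le hnn.2.1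
    obtain ⟨c, hc⟩ := Int.eq_ofNat_of_zero_le hnn.2.2
    refine ⟨(a, b, c), ?_, ?_, Or.inr ⟨?_, isLowerSet_erase hs ?_⟩⟩
    · rw [pos_eq_posZ, ha, hb, hc]
    · rw [color_eq_colorZ, ha, hc]
    · rw [ha, hb, hc] at h0
      exact memExt_coe (b := (a, b, c)).1 h0
    · rintro ⟨v1, v2, v3⟩ hv ⟨l1, l2, l3⟩
      have hv' := memExt_coe.2 hv
      simp only [Prod.mk.injEq] at l1 l2 l3 hv' ⊢
      by_contra hne
      rcases lt_or_eq_of_le l1 with l1' | l1'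
      · exact ha1 (memExt_mono hs (by omega) (by omega) (by omega) hv')
      · rcases lt_or_eq_of_le l2 with l2' | l2'
        · exact ha2 (memExt_mono hs (by omega) (by omega) (by omega) hv')
        · exact ha3 (memExt_mono hs (by omega) (by omega) (by omega) hv')

end

end Toroidal

/-! ### Removal operators with multiplicative coefficients, and their quadratic relations. -/

namespace Toroidal

noncomputable section

/-! ### Removal of boxes -/

theorem ket_eq_zero {s : Finset Box} (hs : ¬IsLowerSet (s : Set Box)) : ket s = 0 := dif_neg hs

theorem ket_eq_single {s : Finset Box} (hs : IsLowerSet (s : Set Box)) :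
    ket s = Finsupp.single ⟨s, hs⟩ 1 := dif_pos hs

theorem ket_cells (l : PlanePartition) : ket l.cells = Finsupp.single l 1 :=
  ket_eq_single l.isLowerSet

/-- The operator removing the box `b`, with multiplicative coefficients. -/
def rem (u : Box → ℂ) (h : Box → Box → ℂ) (b : Box) : Module.End ℂ Space :=
  Finsupp.linearCombination ℂ fun l : PlanePartition =>
    if b ∈ l.cells then (u b * ∏ c ∈ l.cells.erase b, h c b) • ket (l.cells.erase b) else 0

/-- The operator adding the box `b`, with multiplicative coefficients. -/
def add (u : Box → ℂ) (h : Box → Box → ℂ) (b : Box) : Module.End ℂ Space :=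
  Finsupp.linearCombination ℂ fun l : PlanePartition =>
    if b ∉ l.cells then (u b * ∏ c ∈ l.cells, h c b) • ket (insert b l.cells) else 0

section Words

variable (u : Box → ℂ) (h : Box → Box → ℂ)

theorem rem_ket {s : Finset Box} (hs : IsLowerSet (s : Set Box)) (b : Box) :
    rem u h b (ket s) =
      if b ∈ s then (u b * ∏ c ∈ s.erase b, h c b) • ket (s.erase b) else 0 := by
  rw [ket_eq_single hs, rem, Finsupp.linearCombination_single, one_smul]

theorem add_ket {s : Finset Box} (hs : IsLowerSet (s : Set Box)) (b : Box) :
    add u h b (ket s) =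
      if b ∉ s then (u b * ∏ c ∈ s, h c b) • ket (insert b s) else 0 := by
  rw [ket_eq_single hs, add, Finsupp.linearCombination_single, one_smul]

theorem rem_ket_of_notMem {s : Finset Box} {b : Box} (hb : b ∉ s) : rem u h b (ket s) = 0 := by
  by_cases hs : IsLowerSet (s : Set Box)
  · rw [rem_ket u h hs, if_neg hb]
  · rw [ket_eq_zero hs, map_zero]

theorem exists_rem_ket (s : Finset Box) (b : Box) :
    ∃ a : ℂ, rem u h b (ket s) = a • ket (s.erase b) := by
  by_cases hs : IsLowerSet (s : Set Box)
  · rw [rem_ket u h hs]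
    split_ifs
    · exact ⟨_, rfl⟩
    · exact ⟨0, by simp⟩
  · exact ⟨0, by rw [ket_eq_zero hs, map_zero, zero_smul]⟩

/-- The removal of a list of boxes, the head being removed first. -/
def remWord (L : List Box) (v : Space) : Space := L.foldl (fun v b => rem u h b v) v

theorem remWord_smul (L : List Box) (a : ℂ) (v : Space) :
    remWord u h L (a • v) = a • remWord u h L v := by
  induction L generalizing v with
  | nil => rfl
  | cons c L ih => simp only [remWord, List.foldl_cons, map_smul] at ih ⊢; exact ih _

theorem exists_remWord_ket (L : List Box) (s : Finset Box) :
    ∃ a : ℂ, remWord u h L (ket s) = a • ket (s \ L.toFinset) := by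
  induction L generalizing s with
  | nil => exact ⟨1, by simp [remWord]⟩
  | cons c L ih =>
    obtain ⟨a, ha⟩ := exists_rem_ket u h s c
    obtain ⟨a', ha'⟩ := ih (s.erase c)
    refine ⟨a * a', ?_⟩
    rw [remWord, List.foldl_cons, ha]
    change remWord u h L _ = _
    rw [remWord_smul, ha', smul_smul, List.toFinset_cons]
    congr 2
    ext x
    simp only [Finset.mem_sdiff, Finset.mem_erase, Finset.mem_insert]
    tauto

theorem remWord_ket_eq_zero (L : List Box) (s : Finset Box) (hL : ¬(L.Nodup ∧ L.toFinset ⊆ s)) :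
    remWord u h L (ket s) = 0 := by
  induction L generalizing s with
  | nil => exact absurd ⟨List.nodup_nil, by simp⟩ hL
  | cons c L ih =>
    rw [remWord, List.foldl_cons]
    change remWord u h L _ = 0
    by_cases hc : c ∈ s
    · obtain ⟨a, ha⟩ := exists_rem_ket u h s c
      rw [ha, remWord_smul, ih, smul_zero]
      rintro ⟨h1, h2⟩
      refine hL ⟨List.nodup_cons.2 ⟨fun hcL => ?_, h1⟩, ?_⟩
      · simpa using h2 (List.mem_toFinset.2 hcL)
      · rw [List.toFinset_cons]
        exact Finset.insert_subset hc (h2.trans (Finset.erase_subset _ _))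
    · rw [rem_ket_of_notMem u h hc, ← zero_smul ℂ (0 : Space), remWord_smul, zero_smul, zero_smul]

/-- The box `b` is a successor of `b'` in one of the three directions. -/
def Covers (b b' : Box) : Prop :=
  b = (b'.1 + 1, b'.2.1, b'.2.2) ∨ b = (b'.1, b'.2.1 + 1, b'.2.2) ∨ b = (b'.1, b'.2.1, b'.2.2 + 1)

open Classical in
/-- The contribution of removing `b` after `b'`, zero if `b` covers `b'`. -/
def pairW (b b' : Box) : ℂ := if Covers b b' then 0 else h b b'

/-- The product of the pair contributions of a list of boxes. -/
def wordW : List Box → ℂ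
  | [] => 1
  | c :: L => (L.map fun c' => pairW h c' c).prod * wordW L

theorem Covers.lt {b b' : Box} (hc : Covers b b') : b' < b := by
  obtain ⟨x, y, z⟩ := b
  obtain ⟨x', y', z'⟩ := b'
  simp only [Covers, Prod.mk.injEq] at hc
  rw [Prod.lt_iff, Prod.lt_iff, Prod.mk_le_mk]
  simp only
  omega

theorem exists_covers_le {b b' : Box} (hlt : b < b') : ∃ c, Covers c b ∧ c ≤ b' := by
  obtain ⟨x, y, z⟩ := b
  obtain ⟨x', y', z'⟩ := b'
  obtain ⟨⟨h1, h2, h3⟩, hne⟩ := lt_iff_le_and_ne.1 hlt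
  simp only at h1 h2 h3
  rcases lt_or_eq_of_le h1 with l1 | rfl
  · exact ⟨(x + 1, y, z), Or.inl rfl, l1, h2, h3⟩
  rcases lt_or_eq_of_le h2 with l2 | rfl
  · exact ⟨(x, y + 1, z), Or.inr (Or.inl rfl), h1, l2, h3⟩
  rcases lt_or_eq_of_le h3 with l3 | rfl
  · exact ⟨(x, y, z + 1), Or.inr (Or.inr rfl), h1, h2, l3⟩
  · exact absurd rfl hne

/-- The interaction of the removed boxes with the remaining set `R` does not depend on the order of
removal. Only the pairs inside `L` see the order, and the zeros built into `pairW` account for the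
inadmissible orders. -/
theorem remWord_ket {R : Finset Box} (hR : IsLowerSet (R : Set Box)) (L : List Box)
    (hL : L.Nodup) (hd : Disjoint R L.toFinset)
    (hs : IsLowerSet ((R ∪ L.toFinset : Finset Box) : Set Box)) :
    remWord u h L (ket (R ∪ L.toFinset)) =
      ((∏ c ∈ L.toFinset, (u c * ∏ e ∈ R, h e c)) * wordW h L) • ket R := by
  induction L with
  | nil => simp [remWord, wordW]
  | cons c L ih =>
    obtain ⟨hcL, hLn⟩ := List.nodup_cons.1 hL
    have hcL' : c ∉ L.toFinset := by simpa using hcL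
    rw [List.toFinset_cons] at hd hs ⊢
    rw [Finset.disjoint_insert_right] at hd
    have herase : (R ∪ insert c L.toFinset).erase c = R ∪ L.toFinset := by
      ext x
      simp only [Finset.mem_erase, Finset.mem_union, Finset.mem_insert]
      constructor
      · rintro ⟨h1, h2 | h2 | h2⟩
        · exact Or.inl h2
        · exact absurd h2 h1
        · exact Or.inr h2
      · rintro (h2 | h2)
        · exact ⟨by rintro rfl; exact hd.1 h2, Or.inl h2⟩
        · exact ⟨by rintro rfl; exact hcL' h2, Or.inr (Or.inr h2)⟩
    rw [remWord, List.foldl_cons]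
    change remWord u h L _ = _
    rw [rem_ket u h hs, if_pos (by simp), herase, remWord_smul]
    by_cases hs' : IsLowerSet ((R ∪ L.toFinset : Finset Box) : Set Box)
    · rw [ih hLn hd.2 hs', smul_smul, Finset.prod_insert hcL', wordW, Finset.prod_union hd.2]
      congr 1
      have : (L.map fun c' => pairW h c' c).prod = ∏ x ∈ L.toFinset, h x c := by
        rw [List.prod_toFinset _ hLn]
        congr 1
        refine List.map_congr_left fun x hx => if_neg fun hcov => ?_
        have hx' : x ∈ ((R ∪ L.toFinset : Finset Box) : Set Box) := by simp [hx]
        have := hs' hcov.lt.le hx'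
        simp only [Finset.coe_union, Set.mem_union, Finset.mem_coe] at this
        exact this.elim hd.1 hcL'
      rw [this]
      ring
    · rw [ket_eq_zero hs', ← zero_smul ℂ (0 : Space), remWord_smul, zero_smul, smul_zero]
      -- If removing `c` spoils the lower set, some box above `c` is still present. Then a box
      -- covering `c` is present too, and it is removed only later in `L`.
      have : ∃ x ∈ L, Covers x c := by
        by_contra! hno
        refine hs' (herase ▸ isLowerSet_erase hs fun x hx hcx => ?_)
        by_contra hne
        obtain ⟨e, hec, hex⟩ := exists_covers_le (lt_of_le_of_ne hcx (Ne.symm hne))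
        have he := hs hex hx
        simp only [Finset.coe_union, Finset.coe_insert, Set.mem_union, Set.mem_insert_iff,
          Finset.mem_coe, List.mem_toFinset] at he
        rcases he with he | he | he
        · exact hd.1 (hR hec.lt.le he)
        · exact hec.lt.ne' he
        · exact hno e he hec
      obtain ⟨x, hx, hxc⟩ := this
      have h0 : (L.map fun c' => pairW h c' c).prod = 0 :=
        List.prod_eq_zero (List.mem_map.2 ⟨x, hx, if_pos hxc⟩)
      rw [wordW, h0, zero_mul, mul_zero, zero_smul]

theorem remWord_ket_sdiff {s T : Finset Box} (hs : IsLowerSet (s : Set Box))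
    (hR : IsLowerSet ((s \ T : Finset Box) : Set Box)) {L : List Box} (hL : L.Nodup)
    (hT : L.toFinset = T) (hsub : T ⊆ s) :
    remWord u h L (ket s) =
      ((∏ c ∈ T, (u c * ∏ e ∈ s \ T, h e c)) * wordW h L) • ket (s \ T) := by
  subst hT
  have hu : (s \ L.toFinset) ∪ L.toFinset = s := Finset.sdiff_union_of_subset hsub
  have := remWord_ket u h hR L hL Finset.sdiff_disjoint (by rwa [hu])
  rwa [hu] at this

end Words

/-! ### The structure function at pairs of boxes -/

/-- The value `g_{i,j}(z, w)`. -/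
def gVal (q d : ℂ) (i j : ZMod 2) (z w : ℂ) : ℂ :=
  if i = j then z - q₂ q * w else (z - q₁ q d * w) * (z - q₃ q d * w)

/-- The value of the structure function at a pair of boxes. -/
def gBox (q d : ℂ) (b b' : Box) : ℂ := gVal q d (color b) (color b') (pos q d b) (pos q d b')

/-- A zero of `g` only places `b'` on the diagonal line of a successor of `b`. It need not be that
successor. -/
theorem exists_onLine_of_gBox_eq_zero {q d : ℂ} (G : Generic q d) {b b' : Box}
    (h : gBox q d b b' = 0) : OnLine b' (b.1 + 1) b.2.1 b.2.2 ∨ OnLine b' b.1 (b.2.1 + 1) b.2.2 ∨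
      OnLine b' b.1 b.2.1 (b.2.2 + 1) := by
  simp only [OnLine]
  rw [gBox, gVal, pos_eq_posZ, pos_eq_posZ, G.q₁_mul_posZ, G.q₂_mul_posZ, G.q₃_mul_posZ] at h
  split_ifs at h
  · rw [sub_eq_zero, G.posZ_inj] at h
    omega
  · rw [mul_eq_zero, sub_eq_zero, sub_eq_zero, G.posZ_inj, G.posZ_inj] at h
    omega

theorem gBox_eq_zero_of_covers {q d : ℂ} (G : Generic q d) {b b' : Box} (h : Covers b' b) :
    gBox q d b b' = 0 := by
  obtain ⟨x, y, z⟩ := b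
  obtain ⟨x', y', z'⟩ := b'
  simp only [Covers, Prod.mk.injEq] at h
  rw [gBox, gVal, pos_eq_posZ, pos_eq_posZ, G.q₁_mul_posZ, G.q₂_mul_posZ, G.q₃_mul_posZ]
  simp only [color_eq_colorZ, colorZ_eq_iff]
  split_ifs with hc
  · rw [sub_eq_zero, G.posZ_inj]
    omega
  · rw [mul_eq_zero, sub_eq_zero, sub_eq_zero, G.posZ_inj, G.posZ_inj]
    omega

/-- A set of boxes without unit squares, if it is convex. -/
def NoSquare (T : Finset Box) : Prop := ∀ c ∈ T, ∀ c' ∈ T,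
  ¬(c.1 + 1 ≤ c'.1 ∧ c.2.1 + 1 ≤ c'.2.1 ∧ c.2.2 ≤ c'.2.2) ∧
  ¬(c.1 + 1 ≤ c'.1 ∧ c.2.1 ≤ c'.2.1 ∧ c.2.2 + 1 ≤ c'.2.2) ∧
  ¬(c.1 ≤ c'.1 ∧ c.2.1 + 1 ≤ c'.2.1 ∧ c.2.2 + 1 ≤ c'.2.2)

/-- A non-zero shift by a multiple of `(1,1,1)` along the line would put `b` and `b'` at least one
unit apart in two coordinates, in the same direction. This is what `NoSquare` excludes. -/
theorem NoSquare.covers_of_gBox_eq_zero {q d : ℂ} (G : Generic q d) {T : Finset Box}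
    (hT : NoSquare T) {b b' : Box} (hb : b ∈ T) (hb' : b' ∈ T) (h : gBox q d b b' = 0) :
    Covers b' b := by
  have h1 := hT b hb b' hb'
  have h2 := hT b' hb' b hb
  have h3 := exists_onLine_of_gBox_eq_zero G h
  obtain ⟨x, y, z⟩ := b
  obtain ⟨x', y', z'⟩ := b'
  simp only [Covers, Prod.mk.injEq, OnLine] at *
  omega

/-- The exchange property of the coefficients of a system of box operators. -/
def ExchangeSystem (q d : ℂ) (h : Box → Box → ℂ) : Prop :=
  ∀ b b', b ≠ b' → gBox q d b b' ≠ 0 → gBox q d b' b ≠ 0 →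
    sgn (color b) (color b') * gBox q d b' b * h b' b + gBox q d b b' * h b b' = 0

theorem sgn_mul_self (i j : ZMod 2) : sgn i j * sgn i j = 1 := by
  rw [sgn]; split_ifs <;> norm_num

/-- The two orders of removing a pair carry the same factor `θ` times a value of `g`. If both values
of `g` are non-zero this is the exchange property, and if one vanishes the corresponding order is
forbidden. With this parametrisation relations between words become polynomial identities. -/
theorem exists_pairW_eq {q d : ℂ} (G : Generic q d) {h : Box → Box → ℂ}
    (hh : ExchangeSystem q d h) {T : Finset Box} (hT : NoSquare T) {b b' : Box} (hb : b ∈ T)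
    (hb' : b' ∈ T) (hne : b ≠ b') : ∃ θ : ℂ,
      pairW h b b' = -(sgn (color b) (color b') * θ * gBox q d b' b) ∧
      pairW h b' b = θ * gBox q d b b' := by
  have hsgn := sgn_mul_self (color b) (color b')
  have c1 : gBox q d b b' = 0 → Covers b' b := hT.covers_of_gBox_eq_zero G hb hb'
  have c2 : gBox q d b' b = 0 → Covers b b' := hT.covers_of_gBox_eq_zero G hb' hb
  by_cases h1 : gBox q d b b' = 0
  · have hc := c1 h1
    have h2 : gBox q d b' b ≠ 0 := fun h2 => lt_asymm hc.lt (c2 h2).lt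
    refine ⟨-(sgn (color b) (color b') * pairW h b b' / gBox q d b' b), ?_, ?_⟩
    · field_simp
      linear_combination (-pairW h b b') * hsgn
    · rw [h1, mul_zero, pairW, if_pos hc]
  · refine ⟨pairW h b' b / gBox q d b b', ?_, by field_simp⟩
    by_cases h2 : gBox q d b' b = 0
    · rw [h2, mul_zero, neg_zero, pairW, if_pos (c2 h2)]
    · have n1 : ¬Covers b b' := fun hc => h2 (gBox_eq_zero_of_covers G hc)
      have n2 : ¬Covers b' b := fun hc => h1 (gBox_eq_zero_of_covers G hc)
      have := hh b b' hne h1 h2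
      rw [pairW, pairW, if_neg n1, if_neg n2]
      field_simp
      linear_combination this

/-- The complement of a plane partition in another one is convex. -/
theorem mem_of_le_of_le {R T : Finset Box} (hR : IsLowerSet (R : Set Box)) (hd : Disjoint R T)
    (hs : IsLowerSet ((R ∪ T : Finset Box) : Set Box)) {c c' x : Box} (hc : c ∈ T) (hc' : c' ∈ T)
    (h1 : c ≤ x) (h2 : x ≤ c') : x ∈ T := by
  have hx : x ∈ ((R ∪ T : Finset Box) : Set Box) := hs h2 (by simp [hc'])
  simp only [Finset.coe_union, Set.mem_union, Finset.mem_coe] at hx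
  rcases hx with hx | hx
  · exact absurd hc (Finset.disjoint_left.1 hd (hR h1 hx))
  · exact hx

/-- A convex set of boxes without a unit square contains no bigger rectangles. -/
theorem noSquare_of_convex {T : Finset Box}
    (hT : ∀ c c' x : Box, c ∈ T → c' ∈ T → c ≤ x → x ≤ c' → x ∈ T)
    (h12 : ∀ x y z : ℕ, (x, y, z) ∈ T → (x + 1, y, z) ∈ T → (x, y + 1, z) ∈ T →
      (x + 1, y + 1, z) ∉ T)
    (h13 : ∀ x y z : ℕ, (x, y, z) ∈ T → (x + 1, y, z) ∈ T → (x, y, z + 1) ∈ T →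
      (x + 1, y, z + 1) ∉ T)
    (h23 : ∀ x y z : ℕ, (x, y, z) ∈ T → (x, y + 1, z) ∈ T → (x, y, z + 1) ∈ T →
      (x, y + 1, z + 1) ∉ T) : NoSquare T := by
  rintro ⟨x, y, z⟩ hc ⟨x', y', z'⟩ hc'
  have key : ∀ a b c : ℕ, x ≤ a → y ≤ b → z ≤ c → a ≤ x' → b ≤ y' → c ≤ z' → (a, b, c) ∈ T :=
    fun a b c k1 k2 k3 k4 k5 k6 => hT _ _ _ hc hc' ⟨k1, k2, k3⟩ ⟨k4, k5, k6⟩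
  simp only
  refine ⟨fun hx => ?_, fun hx => ?_, fun hx => ?_⟩
  · exact h12 x y z hc (key _ _ _ (by omega) (by omega) (by omega) (by omega) (by omega) (by omega))
      (key _ _ _ (by omega) (by omega) (by omega) (by omega) (by omega) (by omega))
      (key _ _ _ (by omega) (by omega) (by omega) (by omega) (by omega) (by omega))
  · exact h13 x y z hc (key _ _ _ (by omega) (by omega) (by omega) (by omega) (by omega) (by omega))
      (key _ _ _ (by omega) (by omega) (by omega) (by omega) (by omega) (by omega))
      (key _ _ _ (by omega) (by omega) (by omega) (by omega) (by omega) (by omega))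
  · exact h23 x y z hc (key _ _ _ (by omega) (by omega) (by omega) (by omega) (by omega) (by omega))
      (key _ _ _ (by omega) (by omega) (by omega) (by omega) (by omega) (by omega))
      (key _ _ _ (by omega) (by omega) (by omega) (by omega) (by omega) (by omega))

theorem end_ext_ket {T T' : Module.End ℂ Space}
    (h : ∀ s : Finset Box, IsLowerSet (s : Set Box) → T (ket s) = T' (ket s)) : T = T' := by
  refine Finsupp.lhom_ext' fun l => LinearMap.ext_ring ?_
  simpa [ket_cells] using h l.cells l.isLowerSet

/-! ### Quadratic relations for removal operators -/

/-- Unless `b` and `b'` are distinct boxes of `s` whose joint removal leaves a plane partition, both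
words vanish. Otherwise both terms are the same product of two values of `g`, with opposite signs.
-/
theorem rem_exchange {q d : ℂ} (G : Generic q d) (u : Box → ℂ) {h : Box → Box → ℂ}
    (hh : ExchangeSystem q d h) (b b' : Box) :
    (sgn (color b) (color b') * gBox q d b b') • (rem u h b * rem u h b') +
      gBox q d b' b • (rem u h b' * rem u h b) = 0 := by
  refine end_ext_ket fun s hs => ?_
  have e1 : (rem u h b * rem u h b') (ket s) = remWord u h [b', b] (ket s) := rfl
  have e2 : (rem u h b' * rem u h b) (ket s) = remWord u h [b, b'] (ket s) := rfl
  simp only [LinearMap.add_apply, LinearMap.smul_apply, LinearMap.zero_apply, e1, e2]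
  have ht : [b', b].toFinset = [b, b'].toFinset := by ext; simp [or_comm]
  by_cases hg : [b, b'].Nodup ∧ [b, b'].toFinset ⊆ s
  · obtain ⟨hnd, hsub⟩ := hg
    have hnd' : [b', b].Nodup := by simpa [eq_comm] using hnd
    have hne : b ≠ b' := by simpa using hnd
    set T := [b, b'].toFinset with hT
    by_cases hR : IsLowerSet ((s \ T : Finset Box) : Set Box)
    · have hd : Disjoint (s \ T) T := Finset.sdiff_disjoint
      have hu : s = (s \ T) ∪ T := (Finset.sdiff_union_of_subset hsub).symm
      have hs' := hs
      rw [hu] at hs'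
      have w1 := remWord_ket_sdiff u h hs hR hnd rfl hsub
      have w2 := remWord_ket_sdiff u h hs hR hnd' ht hsub
      rw [w1, w2]
      have hcard : T.card ≤ 2 := by rw [hT]; exact List.toFinset_card_le _
      have hbig : ∀ x y z : Box, x ∈ T → y ∈ T → z ∈ T → x ≠ y → x ≠ z → y ≠ z → False := by
        intro x y z hx hy hz hxy hxz hyz
        have : ({x, y, z} : Finset Box).card ≤ T.card := Finset.card_le_card (by
          intro a ha
          simp only [Finset.mem_insert, Finset.mem_singleton] at ha
          rcases ha with rfl | rfl | rfl <;> assumption)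
        rw [Finset.card_eq_three.2 ⟨x, y, z, hxy, hxz, hyz, rfl⟩] at this
        omega
      -- A unit square needs four boxes, and `T` has at most two.
      have hns : NoSquare T := by
        refine noSquare_of_convex (fun c c' x hc hc' => mem_of_le_of_le hR hd hs' hc hc') ?_ ?_ ?_
        all_goals
          intro x y z k1 k2 k3 _
          exact hbig _ _ _ k1 k2 k3 (by simp) (by simp) (by simp)
      obtain ⟨θ, t1, t2⟩ := exists_pairW_eq G hh hns (b := b) (b' := b') (by simp [hT])
        (by simp [hT]) hne
      simp only [wordW, List.map_cons, List.map_nil, List.prod_cons, List.prod_nil, mul_one]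
      rw [smul_smul, smul_smul, ← add_smul, t1, t2]
      rw [show ∀ a c : ℂ, a = 0 → a • ket (s \ T) = 0 from fun a c ha => by rw [ha, zero_smul]]
      · exact 0
      · linear_combination (-(gBox q d b b' * gBox q d b' b * θ *
          ∏ c ∈ T, (u c * ∏ e ∈ s \ T, h e c))) * sgn_mul_self (color b) (color b')
    · obtain ⟨a1, h1⟩ := exists_remWord_ket u h [b, b'] s
      obtain ⟨a2, h2⟩ := exists_remWord_ket u h [b', b] s
      rw [h1, h2, ht, ket_eq_zero hR]
      simp
  · rw [remWord_ket_eq_zero u h _ _ hg, remWord_ket_eq_zero u h [b', b]]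
    · simp
    · rw [ht]
      intro hg'
      refine hg ⟨?_, hg'.2⟩
      simpa [eq_comm] using hg'.1

end

end Toroidal

/-! ### The polynomial identity behind the Serre relations, and the symmetrised brackets as cubic
words. -/

namespace Toroidal

noncomputable section

/-! ### The Serre relations for removal operators -/

/-- With `a = q₁`, `b = q₃` and `a b = q⁻²`, this is the cubic Serre relation after each pair of
boxes has been replaced by its value of `g`, cleared of denominators. The alternating signs come
from the antisymmetric parametrisation of pairs of equal color. -/
theorem serre_polynomial_identity {R : Type*} [CommRing R] (a b x y z w : R) :
    let g := fun s t : R => a * b * s - t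
    let A := fun s : R => (s - a * w) * (s - b * w)
    let B := fun s : R => (w - a * s) * (w - b * s)
    let P := fun s t r : R => g s t * g s r * g t r * (a * b * (A s * A t * A r)
      - (1 + a * b + (a * b) ^ 2) * (A s * A t * B r)
      + (1 + a * b + (a * b) ^ 2) * (A s * B t * B r) - a * b * (B s * B t * B r))
    P x y z - P y x z - P x z y - P z y x + P y z x + P z x y = 0 := by
  intro g A B P
  simp only [P, g, A, B]
  ring

theorem serre_identity {a b Q e : ℂ} (he : e = a * b) (hQ : Q * e = 1) {g : ℂ → ℂ → ℂ}
    {A B : ℂ → ℂ} {w : ℂ} (hg : ∀ s t, g s t = s - Q * t)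
    (hA : ∀ s, A s = (s - a * w) * (s - b * w)) (hB : ∀ s, B s = (w - a * s) * (w - b * s))
    {P : ℂ → ℂ → ℂ → ℂ} (hP : ∀ s t r, P s t r = g s t * g s r * g t r * (A s * A t * A r
      - (Q + 1 + e) * (A s * A t * B r) + (Q + 1 + e) * (A s * B t * B r) - B s * B t * B r))
    (x y z : ℂ) : P x y z - P y x z - P x z y - P z y x + P y z x + P z x y = 0 := by
  have h0 : e ≠ 0 := by rintro rfl; simp at hQ
  have hg' : ∀ s t, g s t = Q * (a * b * s - t) := by
    intro s t
    rw [hg, ← he]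
    linear_combination (-s) * hQ
  have hc : Q + 1 + e = Q * (1 + a * b + (a * b) ^ 2) := by
    rw [← he]
    linear_combination (-1 - e) * hQ
  have hP' : ∀ s t r, P s t r = Q ^ 4 * ((a * b * s - t) * (a * b * s - r) * (a * b * t - r) *
      (a * b * (A s * A t * A r)
      - (1 + a * b + (a * b) ^ 2) * (A s * A t * B r)
      + (1 + a * b + (a * b) ^ 2) * (A s * B t * B r) - a * b * (B s * B t * B r))) := by
    intro s t r
    rw [hP, hg', hg', hg', hc, ← he]
    generalize A s = As
    generalize A t = At
    generalize A r = Ar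
    generalize B s = Bs
    generalize B t = Bt
    generalize B r = Br
    linear_combination (-(Q ^ 3 * (e * s - t) * (e * s - r) * (e * t - r)) *
      (As * At * Ar - Bs * Bt * Br)) * hQ
  have key : ∀ p₁ p₂ p₃ p₄ p₅ p₆ : ℂ, p₁ - p₂ - p₃ - p₄ + p₅ + p₆ = 0 →
      Q ^ 4 * p₁ - Q ^ 4 * p₂ - Q ^ 4 * p₃ - Q ^ 4 * p₄ + Q ^ 4 * p₅ + Q ^ 4 * p₆ = 0 := by
    intro p₁ p₂ p₃ p₄ p₅ p₆ h
    linear_combination Q ^ 4 * h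
  simp only [hP', hA, hB]
  exact key _ _ _ _ _ _ (serre_polynomial_identity a b x y z w)

section SerreSum

variable {A : Type*} [Ring A] [Algebra ℂ A]

/-- The sum over the permutations of the iterated brackets. -/
def serreSum (q : ℂ) (x : Fin 3 → A) (y : A) : A :=
  ∑ σ : Equiv.Perm (Fin 3), qBracket (q ^ (-2 : ℤ)) (x (σ 0))
      (qBracket 1 (x (σ 1)) (qBracket (q ^ 2) (x (σ 2)) y))

/-- The cubic word combination occurring in the Serre relation. -/
def serreWord (c : ℂ) (r t s y : A) : A :=
  r * (t * (s * y)) - c • (r * (t * (y * s))) + c • (r * (y * (t * s))) - y * (r * (t * s))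

theorem sum_perm_fin_three {M : Type*} [AddCommMonoid M] (f : Fin 3 → Fin 3 → Fin 3 → M) :
    ∑ σ : Equiv.Perm (Fin 3), f (σ 0) (σ 1) (σ 2) =
      f 0 1 2 + f 1 0 2 + f 0 2 1 + f 2 1 0 + f 1 2 0 + f 2 0 1 := by
  have : (Finset.univ : Finset (Equiv.Perm (Fin 3))) =
      {1, Equiv.swap 0 1, Equiv.swap 1 2, Equiv.swap 0 2, Equiv.swap 0 1 * Equiv.swap 1 2,
        Equiv.swap 1 2 * Equiv.swap 0 1} := by decide
  rw [this]
  repeat rw [Finset.sum_insert (by decide)]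
  rw [Finset.sum_singleton]
  have e1 : (Equiv.swap 0 1 : Equiv.Perm (Fin 3)) 2 = 2 := by decide
  have e2 : (Equiv.swap 1 2 : Equiv.Perm (Fin 3)) 0 = 0 := by decide
  have e3 : (Equiv.swap 0 2 : Equiv.Perm (Fin 3)) 1 = 1 := by decide
  simp only [Equiv.Perm.coe_one, id_eq, Equiv.Perm.coe_mul, Function.comp_apply,
    Equiv.swap_apply_left, Equiv.swap_apply_right, e1, e2, e3]
  abel

/-- After symmetrisation the eight words of the nested brackets collapse to four, with the quantum
integer `[3] = q² + 1 + q⁻²` as coefficient. -/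
theorem serreSum_eq {q : ℂ} (hq : q ≠ 0) (x : Fin 3 → A) (y : A) :
    serreSum q x y = ∑ σ : Equiv.Perm (Fin 3),
      serreWord (q ^ 2 + 1 + q ^ (-2 : ℤ)) (x (σ 0)) (x (σ 1)) (x (σ 2)) y := by
  rw [serreSum, sum_perm_fin_three (fun a b c => qBracket (q ^ (-2 : ℤ)) (x a)
      (qBracket 1 (x b) (qBracket (q ^ 2) (x c) y))),
    sum_perm_fin_three (fun a b c => serreWord (q ^ 2 + 1 + q ^ (-2 : ℤ)) (x a) (x b) (x c) y)]
  have hQ : q ^ (-2 : ℤ) * q ^ 2 = 1 := by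
    rw [← zpow_natCast, ← zpow_add₀ hq]; simp
  generalize q ^ (-2 : ℤ) = e at *
  generalize q ^ 2 = Q at *
  have hb : ∀ r t s : A, qBracket e r (qBracket 1 t (qBracket Q s y)) =
      r * (t * (s * y)) - Q • (r * (t * (y * s))) - r * (s * (y * t)) + Q • (r * (y * (s * t)))
      - e • (t * (s * (y * r))) + t * (y * (s * r)) + e • (s * (y * (t * r)))
      - y * (s * (t * r)) := by
    intro r t s
    simp only [qBracket, mul_sub, sub_mul, smul_mul_assoc, mul_smul_comm, smul_sub, smul_smul,
      mul_assoc, hQ, one_smul, one_mul]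
    abel
  simp only [hb, serreWord]
  module

end SerreSum

end

end Toroidal

/-! ### The Serre relations for the removal of four given boxes. -/

namespace Toroidal

noncomputable section

section BoxSerre

variable {q d : ℂ} {u : Box → ℂ} {h : Box → Box → ℂ}

/-- The scalar by which the cubic word combination acts, in terms of pair contributions. -/
def serreCoeff (h : Box → Box → ℂ) (c : ℂ) (r t s y : Box) : ℂ :=
  wordW h [y, s, t, r] - c * wordW h [s, y, t, r] + c * wordW h [s, t, y, r]
    - wordW h [s, t, r, y]

theorem serreWord_rem_ket (c : ℂ) (r t s y : Box) (S : Finset Box) :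
    serreWord c (rem u h r) (rem u h t) (rem u h s) (rem u h y) (ket S) =
      remWord u h [y, s, t, r] (ket S) - c • remWord u h [s, y, t, r] (ket S)
        + c • remWord u h [s, t, y, r] (ket S) - remWord u h [s, t, r, y] (ket S) := by
  simp only [serreWord, LinearMap.sub_apply, LinearMap.add_apply, LinearMap.smul_apply]
  rfl

theorem serreWord_rem_ket_eq_zero (c : ℂ) {r t s y : Box} {S : Finset Box}
    (hz : ∀ L : List Box, L.Perm [r, t, s, y] → remWord u h L (ket S) = 0) :
    serreWord c (rem u h r) (rem u h t) (rem u h s) (rem u h y) (ket S) = 0 := by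
  rw [serreWord_rem_ket, hz, hz, hz, hz]
  · simp
  all_goals
    rw [List.perm_iff_count]
    intro a
    simp only [List.count_cons, List.count_nil]
    ring

theorem serreWord_rem_ket_eq_smul (c : ℂ) {r t s y : Box} {S : Finset Box} {C : ℂ} {k : Space}
    (hz : ∀ L : List Box, L.Perm [r, t, s, y] → remWord u h L (ket S) = (C * wordW h L) • k) :
    serreWord c (rem u h r) (rem u h t) (rem u h s) (rem u h y) (ket S) =
      (C * serreCoeff h c r t s y) • k := by
  rw [serreWord_rem_ket, hz, hz, hz, hz]
  · rw [serreCoeff]; module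
  all_goals
    rw [List.perm_iff_count]
    intro a
    simp only [List.count_cons, List.count_nil]
    ring

theorem card_filter_color_le {T : Finset Box} {b : Fin 3 → Box} {y : Box}
    (hT : T = [b 0, b 1, b 2, y].toFinset) (hc : ∀ j, color (b j) ≠ color y) {x : Box}
    (hx : x ∈ T) (hxy : color x = color y) : x = y := by
  rw [hT] at hx
  simp only [List.toFinset_cons, List.toFinset_nil, insert_empty_eq, Finset.mem_insert,
    Finset.mem_singleton] at hx
  rcases hx with rfl | rfl | rfl | rfl
  · exact absurd hxy (hc 0)
  · exact absurd hxy (hc 1)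
  · exact absurd hxy (hc 2)
  · rfl

/-- A unit square in any coordinate plane has colors adding up to `0`. Four boxes of which exactly
three share a color have color sum `1`, so a skew shape of this kind is not a square. -/
theorem noSquare_of_colors {R T : Finset Box} (hR : IsLowerSet (R : Set Box)) (hd : Disjoint R T)
    (hs : IsLowerSet ((R ∪ T : Finset Box) : Set Box)) {b : Fin 3 → Box} {y : Box}
    (hT : T = [b 0, b 1, b 2, y].toFinset) (hcard : T.card = 4)
    (hc : ∀ j, color (b j) ≠ color y) : NoSquare T := by
  have hbig : ∀ x₁ x₂ x₃ x₄ : Box, x₁ ∈ T → x₂ ∈ T → x₃ ∈ T → x₄ ∈ T → x₁ ≠ x₂ → x₁ ≠ x₃ →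
      x₁ ≠ x₄ → x₂ ≠ x₃ → x₂ ≠ x₄ → x₃ ≠ x₄ → color x₁ + color x₂ + color x₃ + color x₄ = 0 →
      False := by
    intro x₁ x₂ x₃ x₄ h1 h2 h3 h4 n12 n13 n14 n23 n24 n34 hsum
    have hsub : ({x₁, x₂, x₃, x₄} : Finset Box) ⊆ T := by
      intro a ha
      simp only [Finset.mem_insert, Finset.mem_singleton] at ha
      rcases ha with rfl | rfl | rfl | rfl <;> assumption
    have heq : ({x₁, x₂, x₃, x₄} : Finset Box) = T := by
      refine Finset.eq_of_subset_of_card_le hsub ?_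
      rw [hcard, Finset.card_insert_of_notMem (by simp [n12, n13, n14]),
        Finset.card_eq_three.2 ⟨x₂, x₃, x₄, n23, n24, n34, rfl⟩]
    have hy : y ∈ ({x₁, x₂, x₃, x₄} : Finset Box) := by rw [heq, hT]; simp
    have e : ∀ {x}, x ∈ T → x ≠ y → color x = color y + 1 := by
      intro x hx hxy
      have h5 : color x ≠ color y := fun h => hxy (card_filter_color_le hT hc hx h)
      have : ∀ a b : ZMod 2, a ≠ b → a = b + 1 := by decide
      exact this _ _ h5
    have four : ∀ a : ZMod 2, a + (a + 1) + (a + 1) + (a + 1) ≠ 0 ∧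
        (a + 1) + a + (a + 1) + (a + 1) ≠ 0 ∧ (a + 1) + (a + 1) + a + (a + 1) ≠ 0 ∧
        (a + 1) + (a + 1) + (a + 1) + a ≠ 0 := by decide
    simp only [Finset.mem_insert, Finset.mem_singleton] at hy
    rcases hy with rfl | rfl | rfl | rfl
    · rw [e h2 n12.symm, e h3 n13.symm, e h4 n14.symm] at hsum
      exact (four _).1 hsum
    · rw [e h1 n12, e h3 n23.symm, e h4 n24.symm] at hsum
      exact (four _).2.1 hsum
    · rw [e h1 n13, e h2 n23, e h4 n34.symm] at hsum
      exact (four _).2.2.1 hsum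
    · rw [e h1 n14, e h2 n24, e h3 n34] at hsum
      exact (four _).2.2.2 hsum
  have hz : ∀ a b : ZMod 2, (a + b) + (a + 1 + b) + (a + b) + (a + 1 + b) = 0 ∧
      (a + b) + (a + 1 + b) + (a + (b + 1)) + (a + 1 + (b + 1)) = 0 ∧
      (a + b) + (a + b) + (a + (b + 1)) + (a + (b + 1)) = 0 := by decide
  refine noSquare_of_convex (fun c c' x hc hc' => mem_of_le_of_le hR hd hs hc hc') ?_ ?_ ?_
  · intro x y z k1 k2 k3 k4
    refine hbig _ _ _ _ k1 k2 k3 k4 (by simp) (by simp) (by simp) (by simp) (by simp) (by simp) ?_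
    simpa [color] using (hz x z).1
  · intro x y z k1 k2 k3 k4
    refine hbig _ _ _ _ k1 k2 k3 k4 (by simp) (by simp) (by simp) (by simp) (by simp) (by simp) ?_
    simpa [color] using (hz x z).2.1
  · intro x y z k1 k2 k3 k4
    refine hbig _ _ _ _ k1 k2 k3 k4 (by simp) (by simp) (by simp) (by simp) (by simp) (by simp) ?_
    simpa [color] using (hz x z).2.2

/-- Each of the six pairs contributes its factor `θ` to every word, so the sum is the product of all
`θ` times the polynomial identity, up to sign. -/
theorem sum_serreCoeff (G : Generic q d) (hh : ExchangeSystem q d h) {T : Finset Box}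
    (hT : NoSquare T) {b₀ b₁ b₂ y : Box} (m₀ : b₀ ∈ T) (m₁ : b₁ ∈ T) (m₂ : b₂ ∈ T) (my : y ∈ T)
    (n₀₁ : b₀ ≠ b₁) (n₀₂ : b₀ ≠ b₂) (n₁₂ : b₁ ≠ b₂) (c₁ : color b₁ = color b₀)
    (c₂ : color b₂ = color b₀) (cy : color b₀ ≠ color y) :
    serreCoeff h (q ^ 2 + 1 + q ^ (-2 : ℤ)) b₀ b₁ b₂ y +
      serreCoeff h (q ^ 2 + 1 + q ^ (-2 : ℤ)) b₁ b₀ b₂ y +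
      serreCoeff h (q ^ 2 + 1 + q ^ (-2 : ℤ)) b₀ b₂ b₁ y +
      serreCoeff h (q ^ 2 + 1 + q ^ (-2 : ℤ)) b₂ b₁ b₀ y +
      serreCoeff h (q ^ 2 + 1 + q ^ (-2 : ℤ)) b₁ b₂ b₀ y +
      serreCoeff h (q ^ 2 + 1 + q ^ (-2 : ℤ)) b₂ b₀ b₁ y = 0 := by
  have hny : ∀ {x}, color x = color b₀ → x ≠ y := by rintro x hx rfl; exact cy hx.symm
  obtain ⟨θ₀₁, s1, s2⟩ := exists_pairW_eq G hh hT m₀ m₁ n₀₁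
  obtain ⟨θ₀₂, s3, s4⟩ := exists_pairW_eq G hh hT m₀ m₂ n₀₂
  obtain ⟨θ₁₂, s5, s6⟩ := exists_pairW_eq G hh hT m₁ m₂ n₁₂
  obtain ⟨θ₀, t1, t2⟩ := exists_pairW_eq G hh hT m₀ my (hny rfl)
  obtain ⟨θ₁, t3, t4⟩ := exists_pairW_eq G hh hT m₁ my (hny c₁)
  obtain ⟨θ₂, t5, t6⟩ := exists_pairW_eq G hh hT m₂ my (hny c₂)
  obtain ⟨g, hg⟩ : ∃ g : ℂ → ℂ → ℂ, ∀ s t, g s t = s - q₂ q * t := ⟨_, fun _ _ => rfl⟩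
  obtain ⟨A, hA⟩ : ∃ A : ℂ → ℂ, ∀ s, A s = (s - q₁ q d * pos q d y) * (s - q₃ q d * pos q d y) :=
    ⟨_, fun _ => rfl⟩
  obtain ⟨B, hB⟩ : ∃ B : ℂ → ℂ, ∀ s, B s = (pos q d y - q₁ q d * s) * (pos q d y - q₃ q d * s) :=
    ⟨_, fun _ => rfl⟩
  -- The positions enter in reversed order because the rightmost operator of a word removes its box
  -- first.
  have hid := serre_identity (a := q₁ q d) (b := q₃ q d) (Q := q ^ 2) (e := q ^ (-2 : ℤ))
    (by have := G.q_ne; have := G.d_ne; rw [q₁, q₃, zpow_neg]; field_simp)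
    (by rw [← zpow_natCast, ← zpow_add₀ G.q_ne]; simp) hg hA hB (fun _ _ _ => rfl)
    (pos q d b₂) (pos q d b₁) (pos q d b₀)
  beta_reduce at hid
  have gs : ∀ {x x'}, color x = color b₀ → color x' = color b₀ →
      gBox q d x x' = g (pos q d x) (pos q d x') := by
    intro x x' e1 e2
    rw [gBox, gVal, if_pos (e1.trans e2.symm), hg]
  have gA : ∀ {x}, color x = color b₀ → gBox q d x y = A (pos q d x) := by
    intro x e1
    rw [gBox, gVal, if_neg (e1 ▸ cy), hA]
  have gB : ∀ {x}, color x = color b₀ → gBox q d y x = B (pos q d x) := by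
    intro x e1
    rw [gBox, gVal, if_neg (e1 ▸ cy.symm), hB]
  have sg1 : ∀ {x x'}, color x = color b₀ → color x' = color b₀ →
      sgn (color x) (color x') = 1 := by
    intro x x' e1 e2
    rw [sgn, if_pos (e1.trans e2.symm)]
  have sg2 : ∀ {x}, color x = color b₀ → sgn (color x) (color y) = -1 := by
    intro x e1
    rw [sgn, if_neg (e1 ▸ cy)]
  rw [sg1 rfl c₁, gs c₁ rfl] at s1
  rw [gs rfl c₁] at s2
  rw [sg1 rfl c₂, gs c₂ rfl] at s3
  rw [gs rfl c₂] at s4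
  rw [sg1 c₁ c₂, gs c₂ c₁] at s5
  rw [gs c₁ c₂] at s6
  rw [sg2 rfl, gB rfl] at t1
  rw [gA rfl] at t2
  rw [sg2 c₁, gB c₁] at t3
  rw [gA c₁] at t4
  rw [sg2 c₂, gB c₂] at t5
  rw [gA c₂] at t6
  simp only [serreCoeff, wordW, List.map_cons, List.map_nil, List.prod_cons, List.prod_nil,
    s1, s2, s3, s4, s5, s6, t1, t2, t3, t4, t5, t6]
  linear_combination (θ₀₁ * θ₀₂ * θ₁₂ * θ₀ * θ₁ * θ₂) * hid

theorem zmod_two_eq_of_ne {a b c : ZMod 2} (h1 : a ≠ c) (h2 : b ≠ c) : a = b := by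
  revert a b c; decide

/-- If a box is repeated or missing, or if the remainder is not a plane partition, then all words
vanish. In the remaining case all words share one scalar factor and one target vector, and
`sum_serreCoeff` applies. -/
theorem rem_serre (G : Generic q d) (u : Box → ℂ) (hh : ExchangeSystem q d h) (b : Fin 3 → Box)
    (y : Box) (hc : ∀ j, color (b j) ≠ color y) :
    serreSum q (fun j => rem u h (b j)) (rem u h y) = 0 := by
  rw [serreSum_eq G.q_ne, sum_perm_fin_three (fun i j k => serreWord (q ^ 2 + 1 + q ^ (-2 : ℤ))
    (rem u h (b i)) (rem u h (b j)) (rem u h (b k)) (rem u h y))]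
  refine end_ext_ket fun s hs => ?_
  simp only [LinearMap.add_apply, LinearMap.zero_apply]
  set L₀ : List Box := [b 0, b 1, b 2, y] with hL₀
  have hperm : ∀ i j k : Fin 3, [i, j, k].Perm [0, 1, 2] → [b i, b j, b k, y].Perm L₀ := by
    intro i j k hp
    exact (hp.map b).append_right [y]
  have p1 := hperm 0 1 2 (by decide)
  have p2 := hperm 1 0 2 (by decide)
  have p3 := hperm 0 2 1 (by decide)
  have p4 := hperm 2 1 0 (by decide)
  have p5 := hperm 1 2 0 (by decide)
  have p6 := hperm 2 0 1 (by decide)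
  have zero_case : (∀ L : List Box, L.Perm L₀ → remWord u h L (ket s) = 0) →
      serreWord (q ^ 2 + 1 + q ^ (-2 : ℤ)) (rem u h (b 0)) (rem u h (b 1)) (rem u h (b 2))
        (rem u h y) (ket s) +
      serreWord (q ^ 2 + 1 + q ^ (-2 : ℤ)) (rem u h (b 1)) (rem u h (b 0)) (rem u h (b 2))
        (rem u h y) (ket s) +
      serreWord (q ^ 2 + 1 + q ^ (-2 : ℤ)) (rem u h (b 0)) (rem u h (b 2)) (rem u h (b 1))
        (rem u h y) (ket s) +
      serreWord (q ^ 2 + 1 + q ^ (-2 : ℤ)) (rem u h (b 2)) (rem u h (b 1)) (rem u h (b 0))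
        (rem u h y) (ket s) +
      serreWord (q ^ 2 + 1 + q ^ (-2 : ℤ)) (rem u h (b 1)) (rem u h (b 2)) (rem u h (b 0))
        (rem u h y) (ket s) +
      serreWord (q ^ 2 + 1 + q ^ (-2 : ℤ)) (rem u h (b 2)) (rem u h (b 0)) (rem u h (b 1))
        (rem u h y) (ket s) = 0 := by
    intro hz
    rw [serreWord_rem_ket_eq_zero _ fun L hL => hz L (hL.trans p1),
      serreWord_rem_ket_eq_zero _ fun L hL => hz L (hL.trans p2),
      serreWord_rem_ket_eq_zero _ fun L hL => hz L (hL.trans p3),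
      serreWord_rem_ket_eq_zero _ fun L hL => hz L (hL.trans p4),
      serreWord_rem_ket_eq_zero _ fun L hL => hz L (hL.trans p5),
      serreWord_rem_ket_eq_zero _ fun L hL => hz L (hL.trans p6)]
    simp
  by_cases hg : L₀.Nodup ∧ L₀.toFinset ⊆ s
  swap
  · refine zero_case fun L hL => remWord_ket_eq_zero u h L s fun hg' => hg ⟨?_, ?_⟩
    · exact hL.nodup_iff.1 hg'.1
    · rw [← List.toFinset_eq_of_perm _ _ hL]; exact hg'.2
  obtain ⟨hnd, hsub⟩ := hg
  by_cases hR : IsLowerSet ((s \ L₀.toFinset : Finset Box) : Set Box)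
  swap
  · refine zero_case fun L hL => ?_
    obtain ⟨a, ha⟩ := exists_remWord_ket u h L s
    rw [ha, List.toFinset_eq_of_perm _ _ hL, ket_eq_zero hR, smul_zero]
  have hw : ∀ L : List Box, L.Perm L₀ → remWord u h L (ket s) =
      ((∏ c ∈ L₀.toFinset, (u c * ∏ e ∈ s \ L₀.toFinset, h e c)) * wordW h L) •
        ket (s \ L₀.toFinset) := fun L hL =>
    remWord_ket_sdiff u h hs hR (hL.nodup_iff.2 hnd) (List.toFinset_eq_of_perm _ _ hL) hsub
  rw [serreWord_rem_ket_eq_smul _ fun L hL => hw L (hL.trans p1),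
    serreWord_rem_ket_eq_smul _ fun L hL => hw L (hL.trans p2),
    serreWord_rem_ket_eq_smul _ fun L hL => hw L (hL.trans p3),
    serreWord_rem_ket_eq_smul _ fun L hL => hw L (hL.trans p4),
    serreWord_rem_ket_eq_smul _ fun L hL => hw L (hL.trans p5),
    serreWord_rem_ket_eq_smul _ fun L hL => hw L (hL.trans p6)]
  have hcard : L₀.toFinset.card = 4 := by rw [List.toFinset_card_of_nodup hnd]; rfl
  have hns : NoSquare L₀.toFinset := noSquare_of_colors hR Finset.sdiff_disjoint
    (by rwa [Finset.sdiff_union_of_subset hsub]) rfl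
    hcard hc
  have hne : (b 0 ≠ b 1 ∧ b 0 ≠ b 2 ∧ b 0 ≠ y) ∧ (b 1 ≠ b 2 ∧ b 1 ≠ y) ∧ b 2 ≠ y := by
    simpa [hL₀] using hnd
  have hsum := sum_serreCoeff G hh hns (b₀ := b 0) (b₁ := b 1) (b₂ := b 2) (y := y)
    (by simp [hL₀]) (by simp [hL₀]) (by simp [hL₀]) (by simp [hL₀]) hne.1.1 hne.1.2.1 hne.2.1.1
    (zmod_two_eq_of_ne (hc 1) (hc 0)) (zmod_two_eq_of_ne (hc 2) (hc 0)) (hc 0)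
  simp only [← add_smul, ← mul_add, hsum, mul_zero, zero_smul]

end BoxSerre

end

end Toroidal

/-! ### From relations between single boxes to relations between currents. -/

namespace Toroidal

noncomputable section

/-! ### Currents of removal operators -/

variable {q d : ℂ} {u : Box → ℂ} {h : Box → Box → ℂ}

/-- The modes of the current removing boxes of color `i`. -/
def remOp (q d : ℂ) (u : Box → ℂ) (h : Box → Box → ℂ) (i : ZMod 2) (k : ℤ) : Module.End ℂ Space :=
  Finsupp.linearCombination ℂ fun l : PlanePartition =>
    ∑ b ∈ l.cells with color b = i, pos q d b ^ k • rem u h b (ket l.cells)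

/-- The modes of the current adding boxes of color `i`. -/
def addOp (q d : ℂ) (u : Box → ℂ) (h : Box → Box → ℂ) (i : ZMod 2) (k : ℤ) : Module.End ℂ Space :=
  Finsupp.linearCombination ℂ fun l : PlanePartition =>
    ∑ b ∈ concaveBoxes i l, pos q d b ^ k • add u h b (ket l.cells)

/-- The modes of the current removing boxes of color `i` in a finite set. -/
def remOpIn (q d : ℂ) (u : Box → ℂ) (h : Box → Box → ℂ) (B : Finset Box) (i : ZMod 2) (k : ℤ) :
    Module.End ℂ Space :=
  ∑ b ∈ B with color b = i, pos q d b ^ k • rem u h b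

theorem remOp_ket {B : Finset Box} (l : PlanePartition) (hl : l.cells ⊆ B) (i : ZMod 2) (k : ℤ) :
    remOp q d u h i k (ket l.cells) = remOpIn q d u h B i k (ket l.cells) := by
  rw [ket_cells, remOp, Finsupp.linearCombination_single, one_smul, ← ket_cells, remOpIn,
    LinearMap.sum_apply]
  refine Finset.sum_subset (Finset.filter_subset_filter _ hl) fun b hb hb' => ?_
  rw [rem_ket_of_notMem, smul_zero]
  intro hbl
  exact hb' (Finset.mem_filter.2 ⟨hbl, (Finset.mem_filter.1 hb).2⟩)

/-- The span of the plane partitions inside a finite set of boxes. -/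
def inside (B : Finset Box) : Submodule ℂ Space :=
  Finsupp.supported ℂ ℂ {l : PlanePartition | l.cells ⊆ B}

theorem inside_induction {B : Finset Box} {p : Space → Prop} {v : Space} (hv : v ∈ inside B)
    (hk : ∀ l : PlanePartition, l.cells ⊆ B → p (ket l.cells)) (h0 : p 0)
    (ha : ∀ x y, p x → p y → p (x + y)) (hs : ∀ (c : ℂ) x, p x → p (c • x)) : p v := by
  rw [inside, Finsupp.supported_eq_span_single] at hv
  refine Submodule.span_induction ?_ h0 (fun x y _ _ => ha x y) (fun c x _ => hs c x) hv
  rintro _ ⟨l, hl, rfl⟩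
  have := hk l hl
  rwa [ket_cells] at this

theorem ket_mem_inside {B s : Finset Box} (hs : s ⊆ B) : ket s ∈ inside B := by
  by_cases hl : IsLowerSet (s : Set Box)
  · rw [ket_eq_single hl]
    exact Finsupp.single_mem_supported ℂ 1 hs
  · rw [ket_eq_zero hl]; exact Submodule.zero_mem _

theorem rem_mem_inside {B : Finset Box} (b : Box) {v : Space} (hv : v ∈ inside B) :
    rem u h b v ∈ inside B := by
  refine inside_induction (p := fun v => rem u h b v ∈ inside B) hv (fun l hl => ?_) ?_
    (fun x y hx hy => ?_) fun c x hx => ?_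
  · obtain ⟨a, ha⟩ := exists_rem_ket u h l.cells b
    rw [ha]
    exact Submodule.smul_mem _ _ (ket_mem_inside ((Finset.erase_subset _ _).trans hl))
  · rw [map_zero]; exact Submodule.zero_mem _
  · rw [map_add]; exact Submodule.add_mem _ hx hy
  · rw [map_smul]; exact Submodule.smul_mem _ _ hx

theorem remOpIn_mem_inside {B : Finset Box} (i : ZMod 2) (k : ℤ) {v : Space} (hv : v ∈ inside B) :
    remOpIn q d u h B i k v ∈ inside B := by
  rw [remOpIn, LinearMap.sum_apply]
  exact Submodule.sum_mem _ fun b _ => Submodule.smul_mem _ _ (rem_mem_inside b hv)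

/-- A mode of the full current is an infinite sum of removal operators. On the invariant subspace of
partitions inside `B` it is a finite one, so products can be expanded there. -/
theorem remOp_eq_remOpIn {B : Finset Box} (i : ZMod 2) (k : ℤ) {v : Space} (hv : v ∈ inside B) :
    remOp q d u h i k v = remOpIn q d u h B i k v := by
  refine inside_induction (p := fun v => remOp q d u h i k v = remOpIn q d u h B i k v) hv
    (fun l hl => remOp_ket l hl i k) ?_ (fun x y hx hy => ?_) fun c x hx => ?_
  · rw [map_zero, map_zero]
  · rw [map_add, map_add, hx, hy]
  · rw [map_smul, map_smul, hx]

/-! ### Quadratic relations between currents -/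

section Quadratic

variable {A : Type*} [Ring A] [Algebra ℂ A]

/-- Against `δ(z / α) δ(w / β)` the polynomial `g(z, w)` may be replaced by its value `g(α, β)`. -/
theorem gMul_sum {ι : Type*} (i j : ZMod 2) (S : Finset ι) (α β : ι → ℂ)
    (hα : ∀ t ∈ S, α t ≠ 0) (hβ : ∀ t ∈ S, β t ≠ 0) (M : ι → A) (a b : ℤ) :
    gMul q d i j (fun a' b' => ∑ t ∈ S, (α t ^ a' * β t ^ b') • M t) a b =
      ∑ t ∈ S, (α t ^ a * β t ^ b * gVal q d i j (α t) (β t)) • M t := by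
  rw [gMul]
  split_ifs with hij
  · rw [Finset.smul_sum, ← Finset.sum_sub_distrib]
    refine Finset.sum_congr rfl fun t ht => ?_
    rw [gVal, if_pos hij, smul_smul, ← sub_smul, zpow_add_one₀ (hα t ht), zpow_add_one₀ (hβ t ht)]
    congr 1; ring
  · rw [Finset.smul_sum, Finset.smul_sum, ← Finset.sum_sub_distrib, ← Finset.sum_add_distrib]
    refine Finset.sum_congr rfl fun t ht => ?_
    rw [gVal, if_neg hij, smul_smul, smul_smul, ← sub_smul, ← add_smul, zpow_add₀ (hα t ht) a 2,
      zpow_add₀ (hβ t ht) b 2, zpow_add_one₀ (hα t ht), zpow_add_one₀ (hβ t ht)]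
    congr 1
    norm_cast
    ring

end Quadratic

theorem pos_ne_zero (G : Generic q d) (b : Box) : pos q d b ≠ 0 := G.posZ_ne_zero _ _ _

theorem remOpIn_mul (B : Finset Box) (i j : ZMod 2) (a b : ℤ) :
    remOpIn q d u h B i a * remOpIn q d u h B j b =
      ∑ t ∈ {x ∈ B | color x = i} ×ˢ {x ∈ B | color x = j},
        (pos q d t.1 ^ a * pos q d t.2 ^ b) • (rem u h t.1 * rem u h t.2) := by
  rw [remOpIn, remOpIn, Finset.sum_mul_sum, Finset.sum_product]
  refine Finset.sum_congr rfl fun x _ => Finset.sum_congr rfl fun y _ => ?_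
  rw [smul_mul_smul_comm]

theorem remOpIn_exchangeE (G : Generic q d) (hh : ExchangeSystem q d h) (B : Finset Box)
    (i j : ZMod 2) (a b : ℤ) :
    exchangeE q d i j (remOpIn q d u h B i) (remOpIn q d u h B j) a b = 0 := by
  have h1 : (fun a' b' => remOpIn q d u h B i a' * remOpIn q d u h B j b') = fun a' b' =>
      ∑ t ∈ {x ∈ B | color x = i} ×ˢ {x ∈ B | color x = j},
        (pos q d t.1 ^ a' * pos q d t.2 ^ b') • (rem u h t.1 * rem u h t.2) := by
    funext a' b'; exact remOpIn_mul _ _ _ _ _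
  have h2 : (fun b' a' => remOpIn q d u h B j b' * remOpIn q d u h B i a') = fun b' a' =>
      ∑ t ∈ {x ∈ B | color x = i} ×ˢ {x ∈ B | color x = j},
        (pos q d t.2 ^ b' * pos q d t.1 ^ a') • (rem u h t.2 * rem u h t.1) := by
    funext b' a'
    rw [remOpIn_mul, Finset.sum_product_right, Finset.sum_product]
  rw [exchangeE, gMulSwap, h1, h2, gMul_sum _ _ _ _ _ (fun t _ => pos_ne_zero G _)
    (fun t _ => pos_ne_zero G _), gMul_sum _ _ _ _ _ (fun t _ => pos_ne_zero G _)
    (fun t _ => pos_ne_zero G _), Finset.smul_sum, ← Finset.sum_add_distrib]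
  refine Finset.sum_eq_zero fun t ht => ?_
  rw [Finset.mem_product, Finset.mem_filter, Finset.mem_filter] at ht
  have := rem_exchange G u hh t.1 t.2
  rw [gBox, gBox, ht.1.2, ht.2.2] at this
  calc _ = (pos q d t.1 ^ a * pos q d t.2 ^ b) •
        ((sgn i j * gVal q d i j (pos q d t.1) (pos q d t.2)) • (rem u h t.1 * rem u h t.2) +
        gVal q d j i (pos q d t.2) (pos q d t.1) • (rem u h t.2 * rem u h t.1)) := by module
    _ = 0 := by rw [this, smul_zero]

theorem remOp_mul_apply {B : Finset Box} (i j : ZMod 2) (a b : ℤ) {v : Space}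
    (hv : v ∈ inside B) : remOp q d u h i a (remOp q d u h j b v) =
      remOpIn q d u h B i a (remOpIn q d u h B j b v) := by
  rw [remOp_eq_remOpIn j b hv, remOp_eq_remOpIn i a (remOpIn_mem_inside j b hv)]

theorem remOp_exchangeE (G : Generic q d) (hh : ExchangeSystem q d h) (i j : ZMod 2) (a b : ℤ) :
    exchangeE q d i j (remOp q d u h i) (remOp q d u h j) a b = 0 := by
  refine end_ext_ket fun s hs => ?_
  have hv : ket s ∈ inside s := ket_mem_inside subset_rfl
  have key := LinearMap.congr_fun (remOpIn_exchangeE (u := u) G hh s i j a b) (ket s)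
  rw [← key]
  simp only [exchangeE, gMulSwap, gMul]
  split_ifs <;>
    simp only [LinearMap.add_apply, LinearMap.sub_apply, LinearMap.smul_apply,
      Module.End.mul_apply, remOp_mul_apply _ _ _ _ hv]

/-! ### Serre relations between currents -/

theorem serre_eq_serreSum {A : Type*} [Ring A] [Algebra ℂ A] (X Y : ℤ → A) (a : Fin 3 → ℤ)
    (b : ℤ) : serre q X Y a b =
      ((Nat.factorial 3 : ℂ)⁻¹) • serreSum q (fun j => X (a j)) (Y b) := rfl

theorem serreSum_apply_congr (G : Generic q d) {X X' : Fin 3 → Module.End ℂ Space}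
    {Y Y' : Module.End ℂ Space} {D : Submodule ℂ Space} (hX : ∀ j, ∀ v ∈ D, X j v = X' j v)
    (hY : ∀ v ∈ D, Y v = Y' v) (hX' : ∀ j, ∀ v ∈ D, X' j v ∈ D) (hY' : ∀ v ∈ D, Y' v ∈ D)
    {v : Space} (hv : v ∈ D) : serreSum q X Y v = serreSum q X' Y' v := by
  rw [serreSum_eq G.q_ne, serreSum_eq G.q_ne, LinearMap.sum_apply, LinearMap.sum_apply]
  refine Finset.sum_congr rfl fun σ _ => ?_
  simp only [serreWord, LinearMap.add_apply, LinearMap.sub_apply, LinearMap.smul_apply,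
    Module.End.mul_apply]
  simp (maxDischargeDepth := 6) only [hX, hY, hX', hY', hv]

theorem sum_piFinset_fin_three {M : Type*} [AddCommMonoid M] (S : Finset Box)
    (f : Box → Box → Box → M) :
    ∑ t ∈ Fintype.piFinset fun _ : Fin 3 => S, f (t 0) (t 1) (t 2) =
      ∑ x ∈ S, ∑ y ∈ S, ∑ z ∈ S, f x y z := by
  simp_rw [← Finset.sum_product']
  refine Finset.sum_nbij' (fun t => (t 0, t 1, t 2)) (fun p => ![p.1, p.2.1, p.2.2]) ?_ ?_ ?_ ?_ ?_
  · intro t ht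
    rw [Fintype.mem_piFinset] at ht
    simp [ht]
  · intro p hp
    simp only [Finset.mem_product] at hp
    rw [Fintype.mem_piFinset]
    intro j
    fin_cases j <;> simp [hp]
  · intro t _
    funext j
    fin_cases j <;> rfl
  · intro p _; rfl
  · intro t _; rfl

theorem qBracket_sum_left {A ι : Type*} [Ring A] [Algebra ℂ A] (p : ℂ) (S : Finset ι) (c : ι → ℂ)
    (x : ι → A) (y : A) :
    qBracket p (∑ t ∈ S, c t • x t) y = ∑ t ∈ S, c t • qBracket p (x t) y := by
  simp only [qBracket, Finset.sum_mul, Finset.mul_sum, Finset.smul_sum, smul_sub,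
    Finset.sum_sub_distrib, smul_mul_assoc, mul_smul_comm, smul_comm p]

theorem qBracket_sum_right {A ι : Type*} [Ring A] [Algebra ℂ A] (p : ℂ) (S : Finset ι) (c : ι → ℂ)
    (x : ι → A) (y : A) :
    qBracket p y (∑ t ∈ S, c t • x t) = ∑ t ∈ S, c t • qBracket p y (x t) := by
  simp only [qBracket, Finset.sum_mul, Finset.mul_sum, Finset.smul_sum, smul_sub,
    Finset.sum_sub_distrib, smul_mul_assoc, mul_smul_comm, smul_comm p]

theorem serreSum_sum {A : Type*} [Ring A] [Algebra ℂ A] (S S' : Finset Box)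
    (α : Fin 3 → Box → ℂ) (β : Box → ℂ) (x y : Box → A) :
    serreSum q (fun j => ∑ t ∈ S, α j t • x t) (∑ t ∈ S', β t • y t) =
      ∑ w ∈ S', β w • ∑ t ∈ Fintype.piFinset fun _ : Fin 3 => S,
        (∏ j, α j (t j)) • serreSum q (fun j => x (t j)) (y w) := by
  have expand : ∀ σ : Equiv.Perm (Fin 3),
      qBracket (q ^ (-2 : ℤ)) (∑ t ∈ S, α (σ 0) t • x t) (qBracket 1 (∑ t ∈ S, α (σ 1) t • x t)
        (qBracket (q ^ 2) (∑ t ∈ S, α (σ 2) t • x t) (∑ t ∈ S', β t • y t))) =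
      ∑ w ∈ S', β w • ∑ t ∈ Fintype.piFinset fun _ : Fin 3 => S, (∏ j, α j (t j)) •
        qBracket (q ^ (-2 : ℤ)) (x (t (σ 0))) (qBracket 1 (x (t (σ 1)))
          (qBracket (q ^ 2) (x (t (σ 2))) (y w))) := by
    intro σ
    rw [qBracket_sum_right, qBracket_sum_right, qBracket_sum_right]
    refine Finset.sum_congr rfl fun w _ => ?_
    congr 1
    -- Reindexing the triples by `σ` puts the summation variables in the order of the factors, so
    -- the sums can be pulled out one bracket at a time.
    have h1 : ∑ t ∈ Fintype.piFinset fun _ : Fin 3 => S, (∏ j, α j (t j)) •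
        qBracket (q ^ (-2 : ℤ)) (x (t (σ 0))) (qBracket 1 (x (t (σ 1)))
          (qBracket (q ^ 2) (x (t (σ 2))) (y w))) =
        ∑ t ∈ Fintype.piFinset fun _ : Fin 3 => S,
          (α (σ 0) (t 0) * (α (σ 1) (t 1) * α (σ 2) (t 2))) •
        qBracket (q ^ (-2 : ℤ)) (x (t 0)) (qBracket 1 (x (t 1))
          (qBracket (q ^ 2) (x (t 2)) (y w))) := by
      refine Finset.sum_nbij' (fun t => t ∘ σ) (fun t => t ∘ σ.symm) ?_ ?_ ?_ ?_ ?_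
      · intro t ht
        rw [Fintype.mem_piFinset] at ht ⊢
        exact fun j => ht _
      · intro t ht
        rw [Fintype.mem_piFinset] at ht ⊢
        exact fun j => ht _
      · intro t _; funext j; simp
      · intro t _; funext j; simp
      · intro t _
        congr 1
        rw [← Equiv.prod_comp σ, Fin.prod_univ_three]
        simp only [Function.comp_apply, mul_assoc]
    rw [h1, sum_piFinset_fin_three S fun x₀ x₁ x₂ =>
      (α (σ 0) x₀ * (α (σ 1) x₁ * α (σ 2) x₂)) • qBracket (q ^ (-2 : ℤ)) (x x₀)
        (qBracket 1 (x x₁) (qBracket (q ^ 2) (x x₂) (y w)))]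
    rw [qBracket_sum_left]
    refine Finset.sum_congr rfl fun x₀ _ => ?_
    rw [qBracket_sum_left, qBracket_sum_right, Finset.smul_sum]
    refine Finset.sum_congr rfl fun x₁ _ => ?_
    rw [qBracket_sum_left, qBracket_sum_right, qBracket_sum_right, Finset.smul_sum,
      Finset.smul_sum]
    refine Finset.sum_congr rfl fun x₂ _ => ?_
    rw [smul_smul, smul_smul, mul_assoc]
  rw [serreSum, Finset.sum_congr rfl fun σ _ => expand σ, Finset.sum_comm]
  refine Finset.sum_congr rfl fun w _ => ?_
  rw [← Finset.smul_sum, Finset.sum_comm]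
  congr 1
  refine Finset.sum_congr rfl fun t _ => ?_
  rw [← Finset.smul_sum, serreSum]

theorem remOpIn_serre (G : Generic q d) (hh : ExchangeSystem q d h) (B : Finset Box)
    (i : ZMod 2) (a : Fin 3 → ℤ) (b : ℤ) :
    serre q (remOpIn q d u h B i) (remOpIn q d u h B (i + 1)) a b = 0 := by
  rw [serre_eq_serreSum]
  simp only [remOpIn]
  rw [serreSum_sum]
  rw [Finset.sum_eq_zero, smul_zero]
  intro w hw
  rw [Finset.sum_eq_zero, smul_zero]
  intro t ht
  rw [rem_serre G u hh, smul_zero]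
  intro j
  rw [Fintype.mem_piFinset] at ht
  rw [(Finset.mem_filter.1 (ht j)).2, (Finset.mem_filter.1 hw).2]
  exact (by decide : ∀ i : ZMod 2, i ≠ i + 1) i

theorem remOp_serre (G : Generic q d) (hh : ExchangeSystem q d h) (i : ZMod 2) (a : Fin 3 → ℤ)
    (b : ℤ) : serre q (remOp q d u h i) (remOp q d u h (i + 1)) a b = 0 := by
  refine end_ext_ket fun s hs => ?_
  have key := LinearMap.congr_fun (remOpIn_serre (u := u) G hh s i a b) (ket s)
  rw [← key, serre_eq_serreSum, serre_eq_serreSum, LinearMap.smul_apply, LinearMap.smul_apply]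
  congr 1
  exact serreSum_apply_congr G (D := inside s) (fun j v hv => remOp_eq_remOpIn i (a j) hv)
    (fun v hv => remOp_eq_remOpIn (i + 1) b hv) (fun j v hv => remOpIn_mem_inside i (a j) hv)
    (fun v hv => remOpIn_mem_inside (i + 1) b hv) (ket_mem_inside subset_rfl)

end

end Toroidal

/-! ### Adding boxes as the transpose of removing them, and commutators of the two. -/

namespace Toroidal

noncomputable section

/-! ### Adjoint operators -/

/-- The bilinear form for which the plane partitions are orthonormal. -/
def dot : Space →ₗ[ℂ] Space →ₗ[ℂ] ℂ :=
  Finsupp.linearCombination ℂ fun l : PlanePartition => Finsupp.lapply l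

theorem dot_ket (l : PlanePartition) (w : Space) : dot (ket l.cells) w = w l := by
  rw [ket_cells, dot, Finsupp.linearCombination_single, one_smul, Finsupp.lapply_apply]

theorem dot_apply_ket (v : Space) (m : PlanePartition) : dot v (ket m.cells) = v m := by
  induction v using Finsupp.induction_linear with
  | zero => simp
  | add v w hv hw => rw [map_add, LinearMap.add_apply, hv, hw, Finsupp.add_apply]
  | single l c =>
    rw [dot, Finsupp.linearCombination_single, ket_cells, LinearMap.smul_apply,
      Finsupp.lapply_apply]
    by_cases hlm : l = m
    · simp [hlm]
    · rw [Finsupp.single_eq_of_ne (fun h => hlm h), Finsupp.single_eq_of_ne (fun h => hlm h.symm),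
        smul_zero]

/-- Adjointness with respect to `dot`. -/
def Adj (T T' : Module.End ℂ Space) : Prop := ∀ v w, dot (T v) w = dot v (T' w)

theorem adj_of_ket {T T' : Module.End ℂ Space}
    (h : ∀ l m : PlanePartition, T (ket l.cells) m = T' (ket m.cells) l) : Adj T T' := by
  have : dot ∘ₗ T = dot.compl₂ T' := by
    refine Finsupp.lhom_ext' fun l => LinearMap.ext_ring ?_
    refine Finsupp.lhom_ext' fun m => LinearMap.ext_ring ?_
    have := h l m
    rw [← dot_apply_ket, ← dot_ket] at this
    simpa [ket_cells] using this
  intro v w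
  exact LinearMap.congr_fun (LinearMap.congr_fun this v) w

namespace Adj

variable {T T' S S' : Module.End ℂ Space}

theorem mul (hT : Adj T T') (hS : Adj S S') : Adj (T * S) (S' * T') := fun v w => by
  rw [Module.End.mul_apply, Module.End.mul_apply, hT, hS]

theorem add (hT : Adj T T') (hS : Adj S S') : Adj (T + S) (T' + S') := fun v w => by
  simp only [LinearMap.add_apply, map_add, hT v w, hS v w]

theorem sub (hT : Adj T T') (hS : Adj S S') : Adj (T - S) (T' - S') := fun v w => by
  simp only [LinearMap.sub_apply, map_sub, hT v w, hS v w]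

theorem smul (c : ℂ) (hT : Adj T T') : Adj (c • T) (c • T') := fun v w => by
  simp only [LinearMap.smul_apply, map_smul, hT v w]

theorem sum {ι : Type*} {s : Finset ι} {T T' : ι → Module.End ℂ Space}
    (h : ∀ i ∈ s, Adj (T i) (T' i)) : Adj (∑ i ∈ s, T i) (∑ i ∈ s, T' i) := fun v w => by
  simp only [LinearMap.sum_apply, map_sum]
  exact Finset.sum_congr rfl fun i hi => h i hi v w

theorem eq_zero (h : Adj 0 T') : T' = 0 := by
  refine LinearMap.ext fun w => Finsupp.ext fun l => ?_
  have := h (ket l.cells) w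
  rw [dot_ket] at this
  simpa using this.symm

end Adj

variable {q d : ℂ} {u : Box → ℂ} {h : Box → Box → ℂ}

theorem Adj.gMul {i j : ZMod 2} {T T' : ℤ → ℤ → Module.End ℂ Space}
    (hT : ∀ a b, Adj (T a b) (T' a b)) (a b : ℤ) :
    Adj (gMul q d i j T a b) (gMul q d i j T' a b) := by
  rw [Toroidal.gMul, Toroidal.gMul]
  split_ifs
  · exact (hT _ _).sub ((hT _ _).smul _)
  · exact ((hT _ _).sub ((hT _ _).smul _)).add ((hT _ _).smul _)

/-- Transposition reverses products, which turns the `E` form of the exchange relation into the `F`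
form up to the sign `(-1)^{i+j}`. -/
theorem exchangeF_eq_zero_of_adj {i j : ZMod 2} {X X' Y Y' : ℤ → Module.End ℂ Space}
    (hX : ∀ a, Adj (X a) (X' a)) (hY : ∀ a, Adj (Y a) (Y' a))
    (hE : ∀ a b, exchangeE q d i j X Y a b = 0) (a b : ℤ) :
    exchangeF q d i j X' Y' a b = 0 := by
  have h1 : Adj (exchangeE q d i j X Y a b)
      (sgn i j • Toroidal.gMul q d i j (fun a' b' => Y' b' * X' a') a b +
        gMulSwap q d j i (fun a' b' => X' a' * Y' b') a b) :=
    ((Adj.gMul (fun a b => (hX a).mul (hY b)) a b).smul _).add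
      (Adj.gMul (fun b a => (hY b).mul (hX a)) b a)
  rw [hE] at h1
  have h2 : exchangeF q d i j X' Y' a b =
      sgn i j • (sgn i j • Toroidal.gMul q d i j (fun a' b' => Y' b' * X' a') a b +
        gMulSwap q d j i (fun a' b' => X' a' * Y' b') a b) := by
    rw [exchangeF, smul_add, smul_smul, sgn_mul_self, one_smul, add_comm]
  rw [h2, h1.eq_zero, smul_zero]

/-- Reversal maps the cubic word to minus itself with the three `X` in the opposite order. The sum
over permutations absorbs the change of order. -/
theorem serreSum_eq_zero_of_adj (G : Generic q d) {X X' : Fin 3 → Module.End ℂ Space}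
    {Y Y' : Module.End ℂ Space} (hX : ∀ a, Adj (X a) (X' a)) (hY : Adj Y Y')
    (hE : serreSum q X Y = 0) : serreSum q X' Y' = 0 := by
  have h1 : Adj (serreSum q X Y) ((-1 : ℂ) • serreSum q X' Y') := by
    have e : (-1 : ℂ) • serreSum q X' Y' = ∑ σ : Equiv.Perm (Fin 3),
        ((-1 : ℂ) • serreWord (q ^ 2 + 1 + q ^ (-2 : ℤ)) (X' (σ 2)) (X' (σ 1)) (X' (σ 0)) Y') := by
      rw [serreSum_eq G.q_ne, ← Finset.smul_sum,
        ← Equiv.sum_comp (Equiv.mulRight (Equiv.swap (0 : Fin 3) 2))]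
      congr 1
    rw [e, serreSum_eq G.q_ne]
    refine Adj.sum fun σ _ => ?_
    have e2 : (-1 : ℂ) • serreWord (q ^ 2 + 1 + q ^ (-2 : ℤ)) (X' (σ 2)) (X' (σ 1)) (X' (σ 0)) Y' =
        Y' * X' (σ 2) * X' (σ 1) * X' (σ 0) -
        (q ^ 2 + 1 + q ^ (-2 : ℤ)) • (X' (σ 2) * Y' * X' (σ 1) * X' (σ 0)) +
        (q ^ 2 + 1 + q ^ (-2 : ℤ)) • (X' (σ 2) * X' (σ 1) * Y' * X' (σ 0)) -
        X' (σ 2) * X' (σ 1) * X' (σ 0) * Y' := by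
      simp only [serreWord, mul_assoc]
      module
    rw [e2, serreWord]
    exact ((((hX _).mul ((hX _).mul ((hX _).mul hY))).sub
      (((hX _).mul ((hX _).mul (hY.mul (hX _)))).smul _)).add
      (((hX _).mul (hY.mul ((hX _).mul (hX _)))).smul _)).sub
      (hY.mul ((hX _).mul ((hX _).mul (hX _))))
  rw [hE] at h1
  exact (smul_eq_zero.1 h1.eq_zero).resolve_left (by norm_num)

/-- Both coefficients are products over the boxes of the smaller partition. -/
theorem adj_rem_add (b : Box) : Adj (rem u h b) (add u h b) := by
  refine adj_of_ket fun l m => ?_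
  rw [rem_ket u h l.isLowerSet, add_ket u h m.isLowerSet]
  have ket_apply : ∀ (s : Finset Box) (m : PlanePartition),
      ket s m = if s = m.cells then 1 else 0 := by
    intro s m
    split_ifs with e
    · rw [e, ket_cells]; simp
    · by_cases hs : IsLowerSet (s : Set Box)
      · rw [ket_eq_single hs, Finsupp.single_eq_of_ne]
        rintro rfl; exact e rfl
      · rw [ket_eq_zero hs]; rfl
  have hiff : (b ∈ l.cells ∧ l.cells.erase b = m.cells) ↔
      (b ∉ m.cells ∧ insert b m.cells = l.cells) := by
    constructor
    · rintro ⟨h1, h2⟩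
      rw [← h2]
      exact ⟨Finset.notMem_erase _ _, Finset.insert_erase h1⟩
    · rintro ⟨h1, h2⟩
      rw [← h2]
      exact ⟨Finset.mem_insert_self _ _, Finset.erase_insert h1⟩
  by_cases hc : b ∈ l.cells ∧ l.cells.erase b = m.cells
  · have hc' := hiff.1 hc
    rw [if_pos hc.1, if_pos hc'.1, Finsupp.smul_apply, Finsupp.smul_apply, ket_apply, ket_apply,
      if_pos hc.2, if_pos hc'.2, hc.2]
  · have hc' := fun h => hc (hiff.2 h)
    have z1 : (if b ∈ l.cells then (u b * ∏ c ∈ l.cells.erase b, h c b) • ket (l.cells.erase b)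
        else 0 : Space) m = 0 := by
      split_ifs with hb
      · rw [Finsupp.smul_apply, ket_apply, if_neg (fun e => hc ⟨hb, e⟩), smul_zero]
      · rfl
    have z2 : (if b ∉ m.cells then (u b * ∏ c ∈ m.cells, h c b) • ket (insert b m.cells)
        else 0 : Space) l = 0 := by
      split_ifs with hb
      · rfl
      · rw [Finsupp.smul_apply, ket_apply, if_neg (fun e => hc' ⟨hb, e⟩), smul_zero]
    rw [z1, z2]

theorem mem_concaveBoxes {i : ZMod 2} {l : PlanePartition} {b : Box} :
    b ∈ concaveBoxes i l ↔
      b ∉ l.cells ∧ IsLowerSet ((insert b l.cells : Finset Box) : Set Box) ∧ color b = i := by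
  rw [concaveBoxes, Set.Finite.mem_toFinset]; rfl

theorem mem_convexBoxes {i : ZMod 2} {l : PlanePartition} {b : Box} :
    b ∈ convexBoxes i l ↔
      b ∈ l.cells ∧ IsLowerSet ((l.cells.erase b : Finset Box) : Set Box) ∧ color b = i := by
  classical simp [convexBoxes]

theorem addOp_ket {B : Finset Box} {l : PlanePartition} {i : ZMod 2} (hB : concaveBoxes i l ⊆ B)
    (k : ℤ) : addOp q d u h i k (ket l.cells) =
      ∑ b ∈ B with color b = i, pos q d b ^ k • add u h b (ket l.cells) := by
  rw [ket_cells, addOp, Finsupp.linearCombination_single, one_smul, ← ket_cells]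
  refine Finset.sum_subset (fun b hb => Finset.mem_filter.2 ⟨hB hb, (mem_concaveBoxes.1 hb).2.2⟩)
    fun b hb hb' => ?_
  rw [add_ket u h l.isLowerSet]
  split_ifs with hbl
  · rw [smul_zero]
  · rw [ket_eq_zero, smul_zero, smul_zero]
    exact fun hls => hb' (mem_concaveBoxes.2 ⟨hbl, hls, (Finset.mem_filter.1 hb).2⟩)

theorem adj_remOp_addOp (i : ZMod 2) (k : ℤ) : Adj (remOp q d u h i k) (addOp q d u h i k) := by
  refine adj_of_ket fun l m => ?_
  rw [remOp_ket (B := l.cells ∪ concaveBoxes i m) l Finset.subset_union_left,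
    addOp_ket (B := l.cells ∪ concaveBoxes i m) Finset.subset_union_right, remOpIn,
    LinearMap.sum_apply, Finsupp.finsetSum_apply, Finsupp.finsetSum_apply]
  refine Finset.sum_congr rfl fun b _ => ?_
  rw [LinearMap.smul_apply, Finsupp.smul_apply, Finsupp.smul_apply, ← dot_apply_ket, ← dot_ket,
    adj_rem_add]

theorem addOp_exchangeF (G : Generic q d) (hh : ExchangeSystem q d h) (i j : ZMod 2) (a b : ℤ) :
    exchangeF q d i j (addOp q d u h i) (addOp q d u h j) a b = 0 :=
  exchangeF_eq_zero_of_adj (fun a => adj_remOp_addOp i a) (fun a => adj_remOp_addOp j a)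
    (remOp_exchangeE G hh i j) a b

theorem addOp_serre (G : Generic q d) (hh : ExchangeSystem q d h) (i : ZMod 2) (a : Fin 3 → ℤ)
    (b : ℤ) : serre q (addOp q d u h i) (addOp q d u h (i + 1)) a b = 0 := by
  have h1 := remOp_serre (u := u) G hh i a b
  rw [serre_eq_serreSum, smul_eq_zero, or_iff_right (by simp [Nat.factorial_ne_zero])] at h1
  rw [serre_eq_serreSum, serreSum_eq_zero_of_adj G (fun j => adj_remOp_addOp i (a j))
    (adj_remOp_addOp (i + 1) b) h1, smul_zero]

/-! ### Commutators of adding and removing operators -/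

variable {u' : Box → ℂ} {h' : Box → Box → ℂ}

/-- When the two moves are possible, `b` and `c` are incomparable. Adding first puts the factor `h c
b` into the addition and `h' b c` into the removal, and the other order has neither; their product
is `1`. -/
theorem rem_add_comm (hc : ∀ b c : Box, ¬b ≤ c → ¬c ≤ b → h c b * h' b c = 1) {b c : Box}
    (hbc : b ≠ c) {s : Finset Box} (hs : IsLowerSet (s : Set Box)) :
    rem u' h' c (add u h b (ket s)) = add u h b (rem u' h' c (ket s)) := by
  rw [add_ket u h hs, rem_ket u' h' hs]
  by_cases hbs : b ∈ s
  · rw [if_neg (by simpa using hbs), map_zero]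
    split_ifs with hcs
    · rw [map_smul]
      by_cases hl : IsLowerSet ((s.erase c : Finset Box) : Set Box)
      · rw [add_ket u h hl, if_neg (by simp [hbs, hbc]), smul_zero]
      · rw [ket_eq_zero hl, map_zero, smul_zero]
    · rw [map_zero]
  rw [if_pos hbs, map_smul]
  by_cases hcs : c ∈ s
  swap
  · rw [rem_ket_of_notMem u' h' (by simp [hcs, hbc.symm]), if_neg hcs, map_zero, smul_zero]
  rw [if_pos hcs, map_smul]
  have hset : (insert b s).erase c = insert b (s.erase c) :=
    Finset.erase_insert_of_ne hbc
  by_cases hF : IsLowerSet ((insert b (s.erase c) : Finset Box) : Set Box)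
  · have h1 : IsLowerSet ((s.erase c : Finset Box) : Set Box) := by
      have e : ((s.erase c : Finset Box) : Set Box) =
          (s : Set Box) ∩ ((insert b (s.erase c) : Finset Box) : Set Box) := by
        ext x
        simp only [Finset.coe_erase, Finset.coe_insert, Set.mem_inter_iff, Set.mem_insert_iff,
          Set.mem_sdiff, Finset.mem_coe, Set.mem_singleton_iff]
        constructor
        · rintro ⟨k1, k2⟩; exact ⟨k1, Or.inr ⟨k1, k2⟩⟩
        · rintro ⟨k1, rfl | k2⟩
          · exact absurd k1 hbs
          · exact k2
      rw [e]; exact hs.inter hF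
    have h2 : IsLowerSet ((insert b s : Finset Box) : Set Box) := by
      have e : ((insert b s : Finset Box) : Set Box) =
          (s : Set Box) ∪ ((insert b (s.erase c) : Finset Box) : Set Box) := by
        ext x
        simp only [Finset.coe_erase, Finset.coe_insert, Set.mem_union, Set.mem_insert_iff,
          Set.mem_sdiff, Finset.mem_coe, Set.mem_singleton_iff]
        tauto
      rw [e]; exact hs.union hF
    rw [rem_ket u' h' h2, add_ket u h h1, if_pos (Finset.mem_insert_of_mem hcs),
      if_pos (by simp [hbs]), hset, smul_smul, smul_smul]
    congr 1
    rw [Finset.prod_insert (by simp [hbs]), ← Finset.mul_prod_erase s _ hcs]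
    have := hc b c (fun hle => hbs (hs hle hcs)) (fun hle => by
      have := hF hle (by simp)
      simp [hbc.symm] at this)
    linear_combination (u b * u' c * (∏ e ∈ s.erase c, h e b) * ∏ e ∈ s.erase c, h' e c) * this
  · have z1 : rem u' h' c (ket (insert b s)) = 0 := by
      obtain ⟨a, ha⟩ := exists_rem_ket u' h' (insert b s) c
      rw [ha, hset, ket_eq_zero hF, smul_zero]
    have z2 : add u h b (ket (s.erase c)) = 0 := by
      by_cases hl : IsLowerSet ((s.erase c : Finset Box) : Set Box)
      · rw [add_ket u h hl, if_pos (by simp [hbs]), ket_eq_zero hF, smul_zero]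
      · rw [ket_eq_zero hl, map_zero]
    rw [z1, z2, smul_zero, smul_zero]

/-- The boxes of a plane partition together with its concave boxes. -/
def nearBoxes (l : PlanePartition) : Finset Box :=
  l.cells ∪ (concaveBoxes 0 l ∪ concaveBoxes 1 l)

theorem mem_nearBoxes_of_concave {l : PlanePartition} {i : ZMod 2} {b : Box}
    (hb : b ∈ concaveBoxes i l) : b ∈ nearBoxes l := by
  rw [nearBoxes, Finset.mem_union, Finset.mem_union]
  have : ∀ i : ZMod 2, i = 0 ∨ i = 1 := by decide
  rcases this i with rfl | rfl
  · exact Or.inr (Or.inl hb)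
  · exact Or.inr (Or.inr hb)

theorem remOp_addOp_ket (l : PlanePartition) (i j : ZMod 2) (a k : ℤ) :
    remOp q d u' h' i a (addOp q d u h j k (ket l.cells)) =
      ∑ c ∈ nearBoxes l with color c = i, ∑ b ∈ nearBoxes l with color b = j,
        (pos q d c ^ a * pos q d b ^ k) • rem u' h' c (add u h b (ket l.cells)) := by
  rw [addOp_ket (B := nearBoxes l) (fun b hb => mem_nearBoxes_of_concave hb), map_sum,
    Finset.sum_comm]
  refine Finset.sum_congr rfl fun b hb => ?_
  have hmem : add u h b (ket l.cells) ∈ inside (nearBoxes l) := by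
    rw [add_ket u h l.isLowerSet]
    split_ifs
    · exact Submodule.zero_mem _
    · exact Submodule.smul_mem _ _ (ket_mem_inside
        (Finset.insert_subset (Finset.mem_filter.1 hb).1 Finset.subset_union_left))
  rw [map_smul, remOp_eq_remOpIn i a hmem, remOpIn, LinearMap.sum_apply, Finset.smul_sum]
  refine Finset.sum_congr rfl fun c _ => ?_
  rw [LinearMap.smul_apply, smul_smul, mul_comm]

theorem addOp_remOp_ket (l : PlanePartition) (i j : ZMod 2) (a k : ℤ) :
    addOp q d u h j k (remOp q d u' h' i a (ket l.cells)) =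
      ∑ c ∈ nearBoxes l with color c = i, ∑ b ∈ nearBoxes l with color b = j,
        (pos q d c ^ a * pos q d b ^ k) • add u h b (rem u' h' c (ket l.cells)) := by
  rw [remOp_ket (B := nearBoxes l) l Finset.subset_union_left, remOpIn, LinearMap.sum_apply,
    map_sum]
  refine Finset.sum_congr rfl fun c _ => ?_
  rw [LinearMap.smul_apply, map_smul]
  have key : addOp q d u h j k (rem u' h' c (ket l.cells)) =
      ∑ b ∈ nearBoxes l with color b = j, pos q d b ^ k • add u h b (rem u' h' c (ket l.cells)) := by
    obtain ⟨e, he⟩ := exists_rem_ket u' h' l.cells c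
    rw [he]
    by_cases hl : IsLowerSet ((l.cells.erase c : Finset Box) : Set Box)
    · have := addOp_ket (q := q) (d := d) (u := u) (h := h) (B := nearBoxes l)
        (l := ⟨l.cells.erase c, hl⟩) (i := j) ?_ k
      · simp only at this
        simp only [map_smul, this, Finset.smul_sum]
        exact Finset.sum_congr rfl fun b _ => smul_comm _ _ _
      -- A box that can be added after removing `c` is either `c` itself or was already concave.
      · intro b hb
        obtain ⟨k1, k2, k3⟩ := mem_concaveBoxes.1 hb
        by_cases hbl : b ∈ l.cells
        · exact Finset.mem_union_left _ hbl
        · refine mem_nearBoxes_of_concave (mem_concaveBoxes.2 ⟨hbl, ?_, k3⟩)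
          have e : ((insert b l.cells : Finset Box) : Set Box) =
              (l.cells : Set Box) ∪ ((insert b (l.cells.erase c) : Finset Box) : Set Box) := by
            ext x
            simp only [Finset.coe_erase, Finset.coe_insert, Set.mem_union, Set.mem_insert_iff,
              Set.mem_sdiff, Finset.mem_coe, Set.mem_singleton_iff]
            tauto
          rw [e]; exact l.isLowerSet.union k2
    · rw [ket_eq_zero hl]
      simp
  rw [key, Finset.smul_sum]
  exact Finset.sum_congr rfl fun b _ => smul_smul _ _ _

/-- Only the terms adding and removing the same box survive, so the commutator is diagonal and
vanishes for different colors. -/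
theorem commutator_ket (G : Generic q d) (hc : ∀ b c : Box, ¬b ≤ c → ¬c ≤ b → h c b * h' b c = 1)
    (l : PlanePartition) (i j : ZMod 2) (a k : ℤ) :
    (remOp q d u' h' i a * addOp q d u h j k - addOp q d u h j k * remOp q d u' h' i a)
      (ket l.cells) =
      if i = j then ∑ b ∈ nearBoxes l with color b = i, pos q d b ^ (a + k) •
        (rem u' h' b (add u h b (ket l.cells)) - add u h b (rem u' h' b (ket l.cells))) else 0 := by
  rw [LinearMap.sub_apply, Module.End.mul_apply, Module.End.mul_apply, remOp_addOp_ket,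
    addOp_remOp_ket, ← Finset.sum_sub_distrib]
  simp only [← Finset.sum_sub_distrib, ← smul_sub]
  have off : ∀ b c : Box, b ≠ c → rem u' h' c (add u h b (ket l.cells)) -
      add u h b (rem u' h' c (ket l.cells)) = 0 := fun b c hbc => by
    rw [rem_add_comm hc hbc l.isLowerSet, sub_self]
  split_ifs with hij
  · subst hij
    refine Finset.sum_congr rfl fun c hcm => ?_
    rw [Finset.sum_eq_single_of_mem c hcm, zpow_add₀ (pos_ne_zero G c)]
    intro b _ hbc
    rw [off b c hbc, smul_zero]
  · refine Finset.sum_eq_zero fun c hcm => Finset.sum_eq_zero fun b hbm => ?_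
    rw [off b c, smul_zero]
    rintro rfl
    exact hij ((Finset.mem_filter.1 hcm).2.symm.trans (Finset.mem_filter.1 hbm).2)

open Classical in
theorem commutator_box_of_notMem {l : PlanePartition} {b : Box} (hb : b ∉ l.cells) :
    rem u' h' b (add u h b (ket l.cells)) - add u h b (rem u' h' b (ket l.cells)) =
      if IsLowerSet ((insert b l.cells : Finset Box) : Set Box) then
        (u b * u' b * ∏ c ∈ l.cells, (h c b * h' c b)) • ket l.cells else 0 := by
  rw [rem_ket_of_notMem u' h' hb, map_zero, sub_zero, add_ket u h l.isLowerSet, if_pos hb, map_smul]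
  split_ifs with hl
  · rw [rem_ket u' h' hl, if_pos (Finset.mem_insert_self _ _), Finset.erase_insert hb, smul_smul,
      Finset.prod_mul_distrib]
    congr 1; ring
  · rw [ket_eq_zero hl, map_zero, smul_zero]

open Classical in
theorem commutator_box_of_mem {l : PlanePartition} {b : Box} (hb : b ∈ l.cells) :
    rem u' h' b (add u h b (ket l.cells)) - add u h b (rem u' h' b (ket l.cells)) =
      if IsLowerSet ((l.cells.erase b : Finset Box) : Set Box) then
        -(u b * u' b * ∏ c ∈ l.cells.erase b, (h c b * h' c b)) • ket l.cells else 0 := by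
  rw [add_ket u h l.isLowerSet, if_neg (by simpa using hb), map_zero, zero_sub,
    rem_ket u' h' l.isLowerSet, if_pos hb, map_smul]
  split_ifs with hl
  · rw [add_ket u h hl, if_pos (Finset.notMem_erase _ _), Finset.insert_erase hb, smul_smul,
      Finset.prod_mul_distrib, neg_smul]
    congr 2; ring
  · rw [ket_eq_zero hl, map_zero, smul_zero, neg_zero]

end

end Toroidal

/-! ### Pair coefficients from leading coefficients of the weights, and residues at corners. -/

namespace Toroidal

noncomputable section

/-! ### The coefficient systems of the MacMahon module -/

/-- The leading coefficient at the position of `b` of the factor of the box `c`. -/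
def rootLc (q d : ℂ) (c b : Box) : ℂ :=
  lcAt (pos q d b) (rootA q d (color c) (pos q d c) (color b))⁻¹

open Classical in
/-- The pair coefficients for adding boxes. -/
def coeffF (q d : ℂ) (c b : Box) : ℂ := if BoxLT b c then rootLc q d c b else 1

open Classical in
/-- The pair coefficients for removing boxes. -/
def coeffE (q d : ℂ) (c b : Box) : ℂ := if BoxLT c b then rootLc q d c b else 1

/-- The coefficient of removing the last box. -/
def vacE (q d κ : ℂ) (b : Box) : ℂ :=
  (q - q⁻¹)⁻¹ * (lcAt (pos q d b) (psiMacMahon κ (color b)) * (pos q d b)⁻¹)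

theorem BoxLT.trans {a b c : Box} (h1 : BoxLT a b) (h2 : BoxLT b c) : BoxLT a c := by
  simp only [BoxLT] at *; omega

theorem BoxLT.asymm {a b : Box} (h1 : BoxLT a b) : ¬BoxLT b a := by
  simp only [BoxLT] at *; omega

theorem BoxLT.irrefl (a : Box) : ¬BoxLT a a := by
  simp only [BoxLT]; omega

theorem BoxLT.trichotomy {a b : Box} (h : a ≠ b) : BoxLT a b ∨ BoxLT b a := by
  obtain ⟨x, y, z⟩ := a
  obtain ⟨x', y', z'⟩ := b
  simp only [BoxLT, ne_eq, Prod.mk.injEq] at *; omega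

theorem BoxLT.of_le {a b : Box} (h : a ≤ b) (hne : a ≠ b) : BoxLT a b := by
  obtain ⟨x, y, z⟩ := a
  obtain ⟨x', y', z'⟩ := b
  obtain ⟨h1, h2, h3⟩ := h
  simp only [BoxLT, ne_eq, Prod.mk.injEq] at *; omega

variable {q d κ : ℂ}

theorem lcAt_div (p : ℂ) (f g : RatFunc ℂ) : lcAt p (f / g) = lcAt p f / lcAt p g := by
  rw [div_eq_mul_inv, lcAt_mul, lcAt_inv, div_eq_mul_inv]

theorem rootLc_eq {b c : Box} (h1 : gBox q d b c ≠ 0) (h2 : gBox q d c b ≠ 0) :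
    rootLc q d c b = -(sgn (color b) (color c) * (gBox q d b c / gBox q d c b)) := by
  rw [rootLc, rootA_apply_eq]
  by_cases hc : color b = color c
  · rw [if_pos hc, sgn, if_pos hc]
    rw [gBox, gVal, if_pos hc] at h1 ⊢
    rw [gBox, gVal, if_pos hc.symm] at h2 ⊢
    have h2' : q₂ q * pos q d b - pos q d c ≠ 0 := fun h => h2 (by linear_combination -h)
    rw [inv_div, lcAt_div, lcAt_linFun _ (by rw [one_mul]; exact sub_ne_zero.1 h1),
      lcAt_linFun _ (sub_ne_zero.1 h2')]
    rw [one_mul, one_mul, ← div_neg, neg_sub]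
  · rw [if_neg hc, sgn, if_neg hc]
    rw [gBox, gVal, if_neg hc] at h1 ⊢
    rw [gBox, gVal, if_neg (Ne.symm hc)] at h2 ⊢
    obtain ⟨h11, h13⟩ := mul_ne_zero_iff.1 h1
    obtain ⟨h21, h23⟩ := mul_ne_zero_iff.1 h2
    have h21' : q₁ q d * pos q d b - pos q d c ≠ 0 := fun h => h21 (by linear_combination -h)
    have h23' : q₃ q d * pos q d b - pos q d c ≠ 0 := fun h => h23 (by linear_combination -h)
    rw [inv_div, lcAt_div, lcAt_mul, lcAt_mul,
      lcAt_linFun _ (by rw [one_mul]; exact sub_ne_zero.1 h11),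
      lcAt_linFun _ (by rw [one_mul]; exact sub_ne_zero.1 h13),
      lcAt_linFun _ (sub_ne_zero.1 h21'), lcAt_linFun _ (sub_ne_zero.1 h23')]
    rw [one_mul, neg_mul, one_mul, neg_neg]
    congr 1
    ring

theorem gBox_mul_rootLc {b c : Box} (h1 : gBox q d b c ≠ 0) (h2 : gBox q d c b ≠ 0) :
    gBox q d c b * rootLc q d c b = -(sgn (color b) (color c) * gBox q d b c) := by
  rw [rootLc_eq h1 h2]; field_simp

theorem sgn_comm (i j : ZMod 2) : sgn i j = sgn j i := by
  rw [sgn, sgn]; simp only [eq_comm]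

/-- The exchange property constrains only the ratio of `h c b` to `h b c`. For generic pairs `rootLc
c b` and `rootLc b c` are reciprocal, so it does not matter which box of the pair carries the
factor. -/
theorem exchangeSystem_of_rootLc {h : Box → Box → ℂ}
    (hh : ∀ b c, b ≠ c → (h c b = rootLc q d c b ∧ h b c = 1) ∨
      (h b c = rootLc q d b c ∧ h c b = 1)) : ExchangeSystem q d h := by
  intro b c hbc h1 h2
  have hs := sgn_mul_self (color b) (color c)
  rcases hh b c hbc with ⟨e1, e2⟩ | ⟨e1, e2⟩ <;> rw [e1, e2]
  · linear_combination sgn (color b) (color c) * gBox_mul_rootLc h1 h2 - gBox q d b c * hs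
  · have := gBox_mul_rootLc h2 h1
    rw [sgn_comm] at this
    linear_combination this

theorem exchangeSystem_coeffE : ExchangeSystem q d (coeffE q d) := by
  refine exchangeSystem_of_rootLc fun b c hbc => ?_
  rcases BoxLT.trichotomy hbc with h | h
  · exact Or.inr ⟨if_pos h, if_neg h.asymm⟩
  · exact Or.inl ⟨if_pos h, if_neg h.asymm⟩

theorem exchangeSystem_coeffF : ExchangeSystem q d (coeffF q d) := by
  refine exchangeSystem_of_rootLc fun b c hbc => ?_
  rcases BoxLT.trichotomy hbc with h | h
  · exact Or.inl ⟨if_pos h, if_neg h.asymm⟩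
  · exact Or.inr ⟨if_pos h, if_neg h.asymm⟩

theorem gBox_ne_zero_of_incomparable (G : Generic q d) {b c : Box} (h1 : ¬b ≤ c) (h2 : ¬c ≤ b) :
    gBox q d b c ≠ 0 := by
  intro h
  have h3 := exists_onLine_of_gBox_eq_zero G h
  obtain ⟨x, y, z⟩ := b
  obtain ⟨x', y', z'⟩ := c
  simp only [OnLine, Prod.mk_le_mk] at *
  omega

theorem coeffF_mul_coeffE (G : Generic q d) (b c : Box) (h1 : ¬b ≤ c) (h2 : ¬c ≤ b) :
    coeffF q d c b * coeffE q d b c = 1 := by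
  rw [coeffF, coeffE]
  split_ifs
  · have g1 := gBox_ne_zero_of_incomparable G h1 h2
    have g2 := gBox_ne_zero_of_incomparable G h2 h1
    have hs := sgn_mul_self (color b) (color c)
    rw [rootLc_eq g1 g2, rootLc_eq g2 g1, sgn_comm (color c)]
    field_simp
    linear_combination hs
  · exact one_mul 1

/-- The total order divides the factors of the weight at `b` between `F` (boxes after `b`) and `E`
(boxes before `b`). Their product recovers the whole weight. -/
theorem coeffF_mul_coeffE_self {b c : Box} (h : c ≠ b) :
    coeffF q d c b * coeffE q d c b = rootLc q d c b := by
  rw [coeffF, coeffE]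
  rcases BoxLT.trichotomy h with h | h
  · rw [if_neg h.asymm, if_pos h, one_mul]
  · rw [if_pos h, if_neg h.asymm, mul_one]

/-- This sign accounts for a convex box entering the commutator with a minus: including the box in
the weight reverses the residue. -/
theorem rootLc_self (G : Generic q d) (b : Box) : rootLc q d b b = -1 := by
  have h : gBox q d b b ≠ 0 := by
    intro h
    have := exists_onLine_of_gBox_eq_zero G h
    simp only [OnLine] at this
    omega
  rw [rootLc_eq h h, div_self h, mul_one, sgn, if_pos rfl]

theorem lcAt_boxesWeight (s : Finset Box) (b : Box) :
    lcAt (pos q d b) (boxesWeight q d s (color b)) = ∏ c ∈ s, rootLc q d c b := by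
  rw [boxesWeight_apply, lcAt_prod]; rfl

theorem isLowerSet_below {s : Finset Box} (hs : IsLowerSet (s : Set Box)) {t : Finset Box} {b : Box}
    (ht : ∀ c, c ∈ t ↔ c ∈ s ∧ BoxLT c b) : IsLowerSet (t : Set Box) := by
  intro x y hyx hx
  rw [Finset.mem_coe, ht] at hx ⊢
  refine ⟨hs hyx hx.1, ?_⟩
  by_cases hne : y = x
  · exact hne ▸ hx.2
  · exact (BoxLT.of_le hyx hne).trans hx.2

/-- The total order refines the componentwise one. Hence the boxes of `s` before `b` form a plane
partition for which `b` is concave. -/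
theorem ordAt_fullWeight_below (G : Generic q d) (hκ : GenericLevel q d κ) {s : Finset Box}
    (hs : IsLowerSet (s : Set Box)) {b : Box}
    (hbs : IsLowerSet ((insert b s : Finset Box) : Set Box)) {t : Finset Box}
    (ht : ∀ c, c ∈ t ↔ c ∈ s ∧ BoxLT c b) :
    ordAt (pos q d b) (fullWeight q d κ t (color b)) = -1 := by
  refine ordAt_fullWeight_concave G hκ (isLowerSet_below hs ht)
    (fun h => BoxLT.irrefl b ((ht b).1 h).2) ?_
  intro x y hyx hx
  rw [Finset.coe_insert, Set.mem_insert_iff, Finset.mem_coe] at hx ⊢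
  by_cases hyb : y = b
  · exact Or.inl hyb
  rcases hx with rfl | hx
  · exact Or.inr ((ht y).2 ⟨mem_of_le_concave hbs hyx hyb, BoxLT.of_le hyx hyb⟩)
  · exact Or.inr (isLowerSet_below hs ht hyx hx)

theorem lcAt_X (p : ℂ) (hp : p ≠ 0) : lcAt p RatFunc.X = p := by
  have : (RatFunc.X : RatFunc ℂ) = linFun 1 0 := by simp [linFun]
  rw [this, lcAt_linFun _ (by simpa using hp)]; ring

theorem ordAt_X (p : ℂ) (hp : p ≠ 0) : ordAt p RatFunc.X = 0 := by
  have : (RatFunc.X : RatFunc ℂ) = linFun 1 0 := by simp [linFun]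
  rw [this, ordAt_linFun _ one_ne_zero, if_neg (by simpa using hp)]

section Concave

variable {s : Finset Box} {b : Box}

-- The full weight and its part before `b` both have a simple pole at `b`, so the quotient, which is
-- the part after `b`, is regular and non-zero there.
open Classical in
theorem ordAt_boxesWeight_above (G : Generic q d) (hκ : GenericLevel q d κ)
    (hs : IsLowerSet (s : Set Box)) (hb : b ∉ s)
    (hbs : IsLowerSet ((insert b s : Finset Box) : Set Box)) :
    ordAt (pos q d b) (boxesWeight q d {c ∈ s | BoxLT b c} (color b)) = 0 := by
  have h1 := ordAt_fullWeight_concave G hκ hs hb hbs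
  have h2 := ordAt_fullWeight_below G hκ hs hbs (t := {c ∈ s | BoxLT c b}) (fun c => by simp)
  have h3 : fullWeight q d κ s (color b) = fullWeight q d κ {c ∈ s | BoxLT c b} (color b) *
      boxesWeight q d {c ∈ s | BoxLT b c} (color b) := by
    rw [fullWeight, fullWeight, mul_assoc, boxesWeight_apply, boxesWeight_apply, boxesWeight_apply]
    congr 1
    rw [← Finset.prod_filter_mul_prod_filter_not s fun c => BoxLT c b]
    congr 1
    refine Finset.prod_congr (Finset.filter_congr fun c hc => ?_) fun _ _ => rfl
    have hne : c ≠ b := fun h => hb (h ▸ hc)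
    exact ⟨fun h => (BoxLT.trichotomy hne).resolve_left h, fun h => h.asymm⟩
  rw [h3, ordAt_mul _ (fullWeight_ne_zero G hκ _ _) (boxesWeight_ne_zero G _ _), h2] at h1
  omega

theorem vacE_mul_prod (s : Finset Box) (b : Box) :
    vacE q d κ b * ∏ c ∈ s, rootLc q d c b =
      (q - q⁻¹)⁻¹ * (lcAt (pos q d b) (fullWeight q d κ s (color b)) * (pos q d b)⁻¹) := by
  rw [fullWeight, lcAt_mul, lcAt_boxesWeight, vacE]; ring

end Concave

variable {i : ZMod 2} {l : PlanePartition} {b : Box}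

theorem regularAt_lWeightAbove (G : Generic q d) (hκ : GenericLevel q d κ)
    (hb : b ∈ concaveBoxes i l) : RegularAt (lWeightAbove q d l b i) (pos q d b) := by
  obtain ⟨h1, h2, rfl⟩ := mem_concaveBoxes.1 hb
  exact regularAt_of_ordAt_nonneg (boxesWeight_ne_zero G _ _)
    (ordAt_boxesWeight_above G hκ l.isLowerSet h1 h2).ge

theorem coeffA_eq (G : Generic q d) (hκ : GenericLevel q d κ) (hb : b ∈ concaveBoxes i l) :
    coeffA q d i l b = ∏ c ∈ l.cells, coeffF q d c b := by
  obtain ⟨h1, h2, rfl⟩ := mem_concaveBoxes.1 hb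
  classical
  rw [coeffA, lWeightAbove, value_eq_lcAt (boxesWeight_ne_zero G _ _)
    (ordAt_boxesWeight_above G hκ l.isLowerSet h1 h2), lcAt_boxesWeight, Finset.prod_filter]
  rfl

theorem coeffB_eq (G : Generic q d) (hκ : GenericLevel q d κ) (hb : b ∈ convexBoxes i l) :
    coeffB q d (psiMacMahon κ) i l b =
      vacE q d κ b * ∏ c ∈ l.cells.erase b, coeffE q d c b := by
  obtain ⟨h1, h2, rfl⟩ := mem_convexBoxes.1 hb
  classical
  have hp := pos_ne_zero G b
  have hord := ordAt_fullWeight_below G hκ h2 (b := b)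
    (by rw [Finset.insert_erase h1]; exact l.isLowerSet) (t := {c ∈ l.cells | BoxLT c b})
    (fun c => by
      rw [Finset.mem_filter, Finset.mem_erase]
      exact ⟨fun h => ⟨⟨fun e => BoxLT.irrefl b (e ▸ h.2), h.1⟩, h.2⟩, fun h => ⟨h.1.2, h.2⟩⟩)
  have e1 : lWeightBelow q d (psiMacMahon κ) l b (color b) =
    fullWeight q d κ {c ∈ l.cells | BoxLT c b} (color b) := by
    rw [lWeightBelow, Pi.mul_apply, fullWeight]
  rw [coeffB, e1, residue_eq_lcAt, lcAt_div, lcAt_X _ hp]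
  · rw [div_eq_mul_inv, ← vacE_mul_prod, Finset.prod_filter, ← Finset.mul_prod_erase _ _ h1,
      if_neg (BoxLT.irrefl b), one_mul]
    simp only [coeffE]
  · rw [ordAt_div _ (fullWeight_ne_zero G hκ _ _) RatFunc.X_ne_zero, hord, ordAt_X _ hp, sub_zero]

theorem prod_coeffF_ne_zero (G : Generic q d) (s : Finset Box) (b : Box) :
    ∏ c ∈ s, coeffF q d c b ≠ 0 := by
  refine Finset.prod_ne_zero_iff.2 fun c _ => ?_
  rw [coeffF]
  split_ifs
  · exact lcAt_ne_zero _ (inv_ne_zero (rootA_ne_zero G _ _ _))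
  · exact one_ne_zero

theorem vacE_mul_prod_coeffE_ne_zero (G : Generic q d) (hκ : GenericLevel q d κ) (s : Finset Box)
    (b : Box) : vacE q d κ b * ∏ c ∈ s, coeffE q d c b ≠ 0 := by
  refine mul_ne_zero (mul_ne_zero (inv_ne_zero G.q_sub_inv_ne) (mul_ne_zero
    (lcAt_ne_zero _ (psiMacMahon_ne_zero hκ.ne_zero _)) (inv_ne_zero (pos_ne_zero G b))))
    (Finset.prod_ne_zero_iff.2 fun c _ => ?_)
  rw [coeffE]
  split_ifs
  · exact lcAt_ne_zero _ (inv_ne_zero (rootA_ne_zero G _ _ _))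
  · exact one_ne_zero

/-! ### The commutator of the adding and removing currents -/

/-- The boxes that can be added to or removed from a plane partition. -/
def IsCorner (s : Finset Box) (b : Box) : Prop :=
  (b ∉ s ∧ IsLowerSet ((insert b s : Finset Box) : Set Box)) ∨
    (b ∈ s ∧ IsLowerSet ((s.erase b : Finset Box) : Set Box))

/-- The box next to the first corner in the `x` direction lies strictly below the second, hence in
`s`. Then the first corner can be neither added nor removed. Thus corners of one partition have
distinct positions. -/
theorem IsCorner.not_lt {s : Finset Box} (hs : IsLowerSet (s : Set Box)) {x y z t : ℕ}
    (h1 : IsCorner s (x, y, z)) (h2 : IsCorner s (x + (t + 1), y + (t + 1), z + (t + 1))) :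
    False := by
  have hle : ((x, y, z) : Box) ≤ (x + (t + 1), y + (t + 1), z + (t + 1)) := by
    simp only [Prod.mk_le_mk]; omega
  have hle1 : ((x, y, z) : Box) ≤ (x + 1, y, z) := by simp only [Prod.mk_le_mk]; omega
  have hle2 : ((x + 1, y, z) : Box) ≤ (x + (t + 1), y + (t + 1), z + (t + 1)) := by
    simp only [Prod.mk_le_mk]; omega
  have key : ((x + 1, y, z) : Box) ∈ s := by
    rcases h2 with ⟨-, h⟩ | ⟨h, -⟩
    · exact mem_of_le_concave h hle2 (by simp only [ne_eq, Prod.mk.injEq]; omega)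
    · exact hs hle2 h
  rcases h1 with ⟨h, -⟩ | ⟨-, h⟩
  · exact h (hs hle1 key)
  · have : ((x, y, z) : Box) ∈ (((s.erase (x, y, z) : Finset Box)) : Set Box) :=
      h hle1 (by rw [Finset.mem_coe, Finset.mem_erase]; exact ⟨by simp, key⟩)
    simp at this

theorem IsCorner.pos_inj (G : Generic q d) {s : Finset Box} (hs : IsLowerSet (s : Set Box))
    {b c : Box} (hb : IsCorner s b) (hc : IsCorner s c) (h : pos q d b = pos q d c) : b = c := by
  rw [pos_eq_posZ, pos_eq_posZ, G.posZ_inj] at h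
  obtain ⟨x, y, z⟩ := b
  obtain ⟨x', y', z'⟩ := c
  simp only at h
  rcases lt_trichotomy x x' with hx | hx | hx
  · obtain ⟨t, rfl⟩ := Nat.exists_eq_add_of_lt hx
    obtain rfl : y' = y + (t + 1) := by omega
    obtain rfl : z' = z + (t + 1) := by omega
    exact (IsCorner.not_lt hs hb hc).elim
  · simp only [Prod.mk.injEq]; omega
  · obtain ⟨t, rfl⟩ := Nat.exists_eq_add_of_lt hx
    obtain rfl : y = y' + (t + 1) := by omega
    obtain rfl : z = z' + (t + 1) := by omega
    exact (IsCorner.not_lt hs hc hb).elim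

theorem fullWeight_insert {s : Finset Box} {b : Box} (hb : b ∉ s) (i : ZMod 2) :
    fullWeight q d κ (insert b s) i =
      fullWeight q d κ s i * (rootA q d (color b) (pos q d b) i)⁻¹ := by
  rw [fullWeight, fullWeight, boxesWeight_apply, boxesWeight_apply, Finset.prod_insert hb]; ring

theorem ordAt_rootA_inv_self (G : Generic q d) (b : Box) :
    ordAt (pos q d b) (rootA q d (color b) (pos q d b) (color b))⁻¹ = 0 := by
  have := ordAt_rootA_inv_posZ G b b.1 b.2.1 b.2.2
  rw [← pos_eq_posZ, ← color_eq_colorZ] at this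
  rw [this]
  simp only [boxOrd, OnLine]
  rw [ind_neg (by omega), ind_neg (by omega), ind_neg (by omega), ind_neg (by omega),
    ind_neg (by omega), ind_neg (by omega)]
  rfl

/-- A convex box is concave once removed, and its own factor has order `0` at its position. -/
theorem ordAt_fullWeight_corner (G : Generic q d) (hκ : GenericLevel q d κ) {s : Finset Box}
    (hs : IsLowerSet (s : Set Box)) {b : Box} (hb : IsCorner s b) :
    ordAt (pos q d b) (fullWeight q d κ s (color b)) = -1 := by
  rcases hb with ⟨h1, h2⟩ | ⟨h1, h2⟩
  · exact ordAt_fullWeight_concave G hκ hs h1 h2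
  · rw [← Finset.insert_erase h1, fullWeight_insert (Finset.notMem_erase _ _),
      ordAt_mul _ (fullWeight_ne_zero G hκ _ _) (inv_ne_zero (rootA_ne_zero G _ _ _)),
      ordAt_rootA_inv_self G, add_zero]
    exact ordAt_fullWeight_concave G hκ h2 (Finset.notMem_erase _ _)
      (by rw [Finset.insert_erase h1]; exact hs)

open Classical in
theorem commutator_box (G : Generic q d) (hκ : GenericLevel q d κ) (l : PlanePartition) (b : Box) :
    rem (vacE q d κ) (coeffE q d) b (add 1 (coeffF q d) b (ket l.cells)) -
        add 1 (coeffF q d) b (rem (vacE q d κ) (coeffE q d) b (ket l.cells)) =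
      if IsCorner l.cells b then ((q - q⁻¹)⁻¹ *
        (residue (fullWeight q d κ l.cells (color b)) (pos q d b) * (pos q d b)⁻¹)) • ket l.cells
      else 0 := by
  by_cases hb : b ∈ l.cells
  · rw [commutator_box_of_mem hb]
    by_cases hl : IsLowerSet ((l.cells.erase b : Finset Box) : Set Box)
    · have hcor : IsCorner l.cells b := Or.inr ⟨hb, hl⟩
      rw [if_pos hl, if_pos hcor, residue_eq_lcAt (ordAt_fullWeight_corner G hκ l.isLowerSet hcor)]
      rw [Finset.prod_congr rfl fun c hc => coeffF_mul_coeffE_self (Finset.ne_of_mem_erase hc),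
        Pi.one_apply, one_mul, vacE_mul_prod]
      conv_rhs => rw [← Finset.insert_erase hb, fullWeight_insert (Finset.notMem_erase _ _),
        lcAt_mul, ← rootLc, rootLc_self G, Finset.insert_erase hb]
      congr 1; ring
    · rw [if_neg hl, if_neg (by rintro (⟨h, -⟩ | ⟨-, h⟩); exacts [h hb, hl h])]
  · rw [commutator_box_of_notMem hb]
    by_cases hl : IsLowerSet ((insert b l.cells : Finset Box) : Set Box)
    · have hcor : IsCorner l.cells b := Or.inl ⟨hb, hl⟩
      rw [if_pos hl, if_pos hcor, residue_eq_lcAt (ordAt_fullWeight_corner G hκ l.isLowerSet hcor)]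
      rw [Finset.prod_congr rfl fun c hc => coeffF_mul_coeffE_self (ne_of_mem_of_not_mem hc hb),
        Pi.one_apply, one_mul, vacE_mul_prod]
    · rw [if_neg hl, if_neg (by rintro (⟨-, h⟩ | ⟨h, -⟩); exacts [hl h, hb h])]

end

end Toroidal

/-! ### Cartan currents, their exchange relations, and the commutator of the currents. -/

namespace Toroidal

noncomputable section

/-! ### The Cartan currents -/

variable {q d κ : ℂ}

/-- The coefficients of the Cartan currents of the MacMahon module. -/
def cartanOp (q d κ : ℂ) (s : Sgn) (i : ZMod 2) (n : ℤ) : Module.End ℂ Space :=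
  Finsupp.linearCombination ℂ fun l : PlanePartition =>
    expandCoeff s (fullWeight q d κ l.cells i) n • ket l.cells

theorem cartanOp_ket (s : Sgn) (i : ZMod 2) (n : ℤ) (t : Finset Box) :
    cartanOp q d κ s i n (ket t) = expandCoeff s (fullWeight q d κ t i) n • ket t := by
  by_cases ht : IsLowerSet (t : Set Box)
  · rw [ket_eq_single ht, cartanOp, Finsupp.linearCombination_single, one_smul, ket_eq_single ht]
  · rw [ket_eq_zero ht, map_zero, smul_zero]

/-- The value of the factor of the box `b` at the point of expansion. -/
def rootEnd (q : ℂ) (i : ZMod 2) (b : Box) : ℂ := if i = color b then (q₂ q)⁻¹ else q₂ q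

theorem Generic.q₁_mul_q₃ (G : Generic q d) : q₁ q d * q₃ q d = (q₂ q)⁻¹ := by
  have := G.q_ne
  have := G.d_ne
  rw [q₁, q₃, q₂]; field_simp

theorem endValue_rootA_inv_plus (G : Generic q d) (i : ZMod 2) (b : Box) :
    EndValue Sgn.plus (rootA q d (color b) (pos q d b) i)⁻¹ (rootEnd q i b) := by
  have h1 := G.q₂_ne
  have h2 := G.q₁_ne
  have h3 := G.q₃_ne
  rw [rootA_apply_eq, rootEnd]
  split_ifs
  · have := (EndValue.div_linFun_plus (a := q₂ q) (pos q d b) (c := 1) (q₂ q * pos q d b)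
      one_ne_zero).inv (by simpa using h1)
    simpa using this
  · have := (((EndValue.div_linFun_plus (a := q₁ q d) (pos q d b) (c := 1) (q₁ q d * pos q d b)
      one_ne_zero).mul (EndValue.div_linFun_plus (a := q₃ q d) (pos q d b) (c := 1)
      (q₃ q d * pos q d b) one_ne_zero)).inv (by simp [h2, h3]))
    rw [div_one, div_one, G.q₁_mul_q₃, inv_inv, div_mul_div_comm] at this
    exact this

theorem endValue_rootA_inv_minus (G : Generic q d) (i : ZMod 2) (b : Box) :
    EndValue Sgn.minus (rootA q d (color b) (pos q d b) i)⁻¹ (rootEnd q i b)⁻¹ := by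
  have h1 := G.q₂_ne
  have h2 := G.q₁_ne
  have h3 := G.q₃_ne
  have hp := pos_ne_zero G b
  have e : ∀ {x : ℂ}, x ≠ 0 → pos q d b / (x * pos q d b) = x⁻¹ := fun hx => by field_simp
  rw [rootA_apply_eq, rootEnd]
  split_ifs
  · have := (EndValue.div_linFun_minus (q₂ q) (b := pos q d b) (c := 1) (e := q₂ q * pos q d b)
      (mul_ne_zero h1 hp)).inv (div_ne_zero hp (mul_ne_zero h1 hp))
    rwa [e h1] at this
  · have := (((EndValue.div_linFun_minus (q₁ q d) (b := pos q d b) (c := 1)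
      (e := q₁ q d * pos q d b) (mul_ne_zero h2 hp)).mul (EndValue.div_linFun_minus (q₃ q d)
      (b := pos q d b) (c := 1) (e := q₃ q d * pos q d b) (mul_ne_zero h3 hp))).inv
      (mul_ne_zero (div_ne_zero hp (mul_ne_zero h2 hp)) (div_ne_zero hp (mul_ne_zero h3 hp))))
    rw [e h2, e h3, ← mul_inv, inv_inv, G.q₁_mul_q₃, div_mul_div_comm] at this
    exact this

/-- The value of a weight at infinity. -/
def weightEnd (q κ : ℂ) (s : Finset Box) (i : ZMod 2) : ℂ :=
  (if i = 0 then κ else 1) * ∏ b ∈ s, rootEnd q i b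

theorem endValue_fullWeight_plus (G : Generic q d) (s : Finset Box) (i : ZMod 2) :
    EndValue Sgn.plus (fullWeight q d κ s i) (weightEnd q κ s i) := by
  rw [fullWeight, weightEnd, boxesWeight_apply, psiMacMahon_apply_eq]
  refine EndValue.mul ?_ (EndValue.prod fun b _ => endValue_rootA_inv_plus G i b)
  split_ifs
  · simpa using EndValue.div_linFun_plus (a := κ) κ⁻¹ (c := 1) 1 one_ne_zero
  · exact EndValue.one

theorem endValue_fullWeight_minus (G : Generic q d) (s : Finset Box) (i : ZMod 2) :
    EndValue Sgn.minus (fullWeight q d κ s i) (weightEnd q κ s i)⁻¹ := by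
  rw [fullWeight, weightEnd, boxesWeight_apply, psiMacMahon_apply_eq, mul_inv,
    ← Finset.prod_inv_distrib]
  refine EndValue.mul ?_ (EndValue.prod fun b _ => endValue_rootA_inv_minus G i b)
  split_ifs
  · simpa using EndValue.div_linFun_minus κ (b := κ⁻¹) (c := 1) (e := 1) one_ne_zero
  · rw [inv_one]; exact EndValue.one

theorem weightEnd_ne_zero (G : Generic q d) (hκ : κ ≠ 0) (s : Finset Box) (i : ZMod 2) :
    weightEnd q κ s i ≠ 0 := by
  refine mul_ne_zero ?_ (Finset.prod_ne_zero_iff.2 fun b _ => ?_)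
  · split_ifs
    exacts [hκ, one_ne_zero]
  · rw [rootEnd]
    split_ifs
    exacts [inv_ne_zero G.q₂_ne, G.q₂_ne]

/-- A box contributes `q₂⁻¹` to the component of its color and `q₂` to the other, so only the vacuum
value `κ` remains. -/
theorem weightEnd_zero_mul_one (G : Generic q d) (s : Finset Box) :
    weightEnd q κ s 0 * weightEnd q κ s 1 = κ := by
  have h : ∀ b : Box, rootEnd q 0 b * rootEnd q 1 b = 1 := by
    intro b
    have h2 := G.q₂_ne
    have : ∀ c : ZMod 2, c = 0 ∨ c = 1 := by decide
    rw [rootEnd, rootEnd]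
    rcases this (color b) with h | h <;> simp [h, h2]
  rw [weightEnd, weightEnd, mul_mul_mul_comm, ← Finset.prod_mul_distrib,
    Finset.prod_congr rfl fun b _ => h b]
  simp

theorem cartanOp_plus_of_neg (G : Generic q d) (i : ZMod 2) {n : ℤ} (hn : n < 0) :
    cartanOp q d κ Sgn.plus i n = 0 :=
  end_ext_ket fun s _ => by
    rw [cartanOp_ket, (endValue_fullWeight_plus G s i).expandCoeff_plus_neg hn, zero_smul]; rfl

theorem cartanOp_minus_of_pos (G : Generic q d) (i : ZMod 2) {n : ℤ} (hn : 0 < n) :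
    cartanOp q d κ Sgn.minus i n = 0 :=
  end_ext_ket fun s _ => by
    rw [cartanOp_ket, (endValue_fullWeight_minus G s i).expandCoeff_minus_pos hn, zero_smul]; rfl

theorem cartanOp_comm (s s' : Sgn) (i j : ZMod 2) (a b : ℤ) :
    cartanOp q d κ s i a * cartanOp q d κ s' j b = cartanOp q d κ s' j b * cartanOp q d κ s i a :=
  end_ext_ket fun t _ => by
    rw [Module.End.mul_apply, Module.End.mul_apply, cartanOp_ket, cartanOp_ket, map_smul, map_smul,
      cartanOp_ket, cartanOp_ket, smul_comm]

theorem cartanOp_plus_mul_minus (G : Generic q d) (hκ : κ ≠ 0) (i : ZMod 2) :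
    cartanOp q d κ Sgn.plus i 0 * cartanOp q d κ Sgn.minus i 0 = 1 :=
  end_ext_ket fun t _ => by
    rw [Module.End.mul_apply, cartanOp_ket, map_smul, cartanOp_ket, smul_smul,
      (endValue_fullWeight_plus G t i).expandCoeff_zero,
      (endValue_fullWeight_minus G t i).expandCoeff_zero,
      inv_mul_cancel₀ (weightEnd_ne_zero G hκ t i), one_smul, Module.End.one_apply]

/-! ### Exchange relations with the Cartan currents -/

/-- The rational function `g_{i,j}(z, p)`. -/
def gLeft (q d : ℂ) (i j : ZMod 2) (p : ℂ) : RatFunc ℂ :=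
  if i = j then linFun 1 (q₂ q * p) else linFun 1 (q₁ q d * p) * linFun 1 (q₃ q d * p)

/-- The rational function `g_{j,i}(p, z)`. -/
def gRight (q d : ℂ) (i j : ZMod 2) (p : ℂ) : RatFunc ℂ :=
  if i = j then -linFun (q₂ q) p else linFun (q₁ q d) p * linFun (q₃ q d) p

/-- The affine root is, up to sign, the ratio of the two structure functions. This is why adding or
removing a box intertwines the Cartan currents correctly. -/
theorem gRight_mul_rootA_inv (G : Generic q d) (i j : ZMod 2) (p : ℂ) :
    gRight q d i j p * (rootA q d j p i)⁻¹ = -(RatFunc.C (sgn i j) * gLeft q d i j p) := by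
  have h1 := linFun_ne_zero G.q₁_ne p
  have h2 := linFun_ne_zero G.q₂_ne p
  have h3 := linFun_ne_zero G.q₃_ne p
  rw [gRight, gLeft, rootA_apply_eq, sgn]
  split_ifs
  · rw [map_one, inv_div, neg_mul, mul_div_cancel₀ _ h2, one_mul]
  · rw [map_neg, map_one, inv_div, mul_div_cancel₀ _ (mul_ne_zero h1 h3), neg_mul, one_mul, neg_neg]

theorem expandCoeff_linFun_mul (s : Sgn) (a b : ℂ) (f : RatFunc ℂ) (n : ℤ) :
    expandCoeff s (linFun a b * f) n = a * expandCoeff s f (n + 1) - b * expandCoeff s f n := by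
  rw [linFun, sub_mul, mul_assoc, expandCoeff_sub, expandCoeff_C_mul, expandCoeff_C_mul,
    expandCoeff_X_mul]

theorem expandCoeff_neg (s : Sgn) (f : RatFunc ℂ) (n : ℤ) :
    expandCoeff s (-f) n = -expandCoeff s f n := by
  rw [← zero_sub, expandCoeff_sub, expandCoeff_zero, zero_sub]

theorem gMul_expandCoeff (s : Sgn) (i j : ZMod 2) (f : RatFunc ℂ) {p : ℂ} (hp : p ≠ 0) (a b : ℤ) :
    gMul q d i j (fun a b => expandCoeff s f a * p ^ b) a b =
      expandCoeff s (gLeft q d i j p * f) a * p ^ b := by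
  rw [gMul, gLeft]
  split_ifs
  · rw [expandCoeff_linFun_mul, zpow_add_one₀ hp, smul_eq_mul]; ring
  · rw [mul_assoc, expandCoeff_linFun_mul, expandCoeff_linFun_mul, expandCoeff_linFun_mul,
      zpow_add₀ hp b 2, zpow_add_one₀ hp, smul_eq_mul, smul_eq_mul, add_assoc a 1 1, one_add_one_eq_two]
    simp only [zpow_ofNat]
    ring

theorem gMulSwap_expandCoeff (s : Sgn) (i j : ZMod 2) (f : RatFunc ℂ) {p : ℂ} (hp : p ≠ 0)
    (a b : ℤ) : gMulSwap q d j i (fun a b => expandCoeff s f a * p ^ b) a b =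
      expandCoeff s (gRight q d i j p * f) a * p ^ b := by
  rw [gMulSwap, gMul, gRight]
  simp only [eq_comm (a := j)]
  split_ifs
  · rw [neg_mul, expandCoeff_neg, expandCoeff_linFun_mul, zpow_add_one₀ hp, smul_eq_mul]; ring
  · rw [mul_assoc, expandCoeff_linFun_mul, expandCoeff_linFun_mul, expandCoeff_linFun_mul,
      zpow_add₀ hp b 2, zpow_add_one₀ hp, smul_eq_mul, smul_eq_mul, add_assoc a 1 1, one_add_one_eq_two]
    simp only [zpow_ofNat]
    ring

theorem gMul_apply_sum {ι : Type*} {i j : ZMod 2} {T : ℤ → ℤ → Module.End ℂ Space} {v : Space}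
    {S : Finset ι} {τ : ι → ℤ → ℤ → ℂ} {m : ι → Space}
    (h : ∀ a b, T a b v = ∑ t ∈ S, τ t a b • m t) (a b : ℤ) :
    gMul q d i j T a b v = ∑ t ∈ S, gMul q d i j (τ t) a b • m t := by
  simp only [gMul]
  split_ifs <;>
    simp only [LinearMap.add_apply, LinearMap.sub_apply, LinearMap.smul_apply, h, Finset.smul_sum,
      smul_smul, ← Finset.sum_sub_distrib, ← Finset.sum_add_distrib, ← sub_smul, ← add_smul,
      smul_eq_mul]

theorem gMulSwap_apply_sum {ι : Type*} {i j : ZMod 2} {T : ℤ → ℤ → Module.End ℂ Space} {v : Space}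
    {S : Finset ι} {τ : ι → ℤ → ℤ → ℂ} {m : ι → Space}
    (h : ∀ a b, T a b v = ∑ t ∈ S, τ t a b • m t) (a b : ℤ) :
    gMulSwap q d i j T a b v = ∑ t ∈ S, gMulSwap q d i j (τ t) a b • m t :=
  gMul_apply_sum (fun a b => h b a) b a

/-- The delta function fixes `w` at the position of `b`. What remains is an identity of rational
functions in `z`, valid in both expansions. -/
theorem scalar_exchange (G : Generic q d) (s : Sgn) (i : ZMod 2) (b : Box) (f : RatFunc ℂ)
    (m n : ℤ) :
    sgn i (color b) * gMul q d i (color b) (fun m n => expandCoeff s f m * pos q d b ^ n) m n +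
      gMulSwap q d (color b) i (fun m n => expandCoeff s
        (f * (rootA q d (color b) (pos q d b) i)⁻¹) m * pos q d b ^ n) m n = 0 := by
  rw [gMul_expandCoeff _ _ _ _ (pos_ne_zero G b), gMulSwap_expandCoeff _ _ _ _ (pos_ne_zero G b),
    mul_left_comm _ f, gRight_mul_rootA_inv G, ← mul_assoc, ← expandCoeff_C_mul, ← add_mul,
    ← expandCoeff_add]
  have : RatFunc.C (sgn i (color b)) * (gLeft q d i (color b) (pos q d b) * f) +
      f * -(RatFunc.C (sgn i (color b)) * gLeft q d i (color b) (pos q d b)) = 0 := by ring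
  rw [this, expandCoeff_zero, zero_mul]

variable {u : Box → ℂ} {h : Box → Box → ℂ}

theorem cartanOp_remOp_exchangeE (G : Generic q d) (s : Sgn) (i j : ZMod 2) (a b : ℤ) :
    exchangeE q d i j (cartanOp q d κ s i) (remOp q d u h j) a b = 0 := by
  refine end_ext_ket fun t ht => ?_
  have hrem : ∀ k, remOp q d u h j k (ket t) =
      ∑ c ∈ t with color c = j, pos q d c ^ k • rem u h c (ket t) := fun k => by
    have := remOp_ket (q := q) (d := d) (u := u) (h := h) (B := t) ⟨t, ht⟩ subset_rfl j k
    rwa [remOpIn, LinearMap.sum_apply] at this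
  have h1 : ∀ a b, (cartanOp q d κ s i a * remOp q d u h j b) (ket t) =
      ∑ c ∈ t with color c = j, (expandCoeff s (fullWeight q d κ (t.erase c) i) a *
        pos q d c ^ b) • rem u h c (ket t) := by
    intro a b
    rw [Module.End.mul_apply, hrem, map_sum]
    refine Finset.sum_congr rfl fun c _ => ?_
    obtain ⟨e, he⟩ := exists_rem_ket u h t c
    rw [he, map_smul, map_smul, cartanOp_ket, smul_smul, smul_smul, smul_smul]
    congr 1; ring
  have h2 : ∀ a b, (remOp q d u h j b * cartanOp q d κ s i a) (ket t) =
      ∑ c ∈ t with color c = j, (expandCoeff s (fullWeight q d κ t i) a *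
        pos q d c ^ b) • rem u h c (ket t) := by
    intro a b
    rw [Module.End.mul_apply, cartanOp_ket, map_smul, hrem, Finset.smul_sum]
    exact Finset.sum_congr rfl fun c _ => smul_smul _ _ _
  rw [exchangeE, LinearMap.add_apply, LinearMap.smul_apply, gMul_apply_sum h1,
    gMulSwap_apply_sum h2, Finset.smul_sum, ← Finset.sum_add_distrib]
  refine Finset.sum_eq_zero fun c hc => ?_
  obtain ⟨hct, rfl⟩ := Finset.mem_filter.1 hc
  rw [smul_smul, ← add_smul]
  have := scalar_exchange G s i c (fullWeight q d κ (t.erase c) i) a b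
  rw [← fullWeight_insert (Finset.notMem_erase _ _), Finset.insert_erase hct] at this
  rw [this, zero_smul]

theorem cartanOp_addOp_exchangeF (G : Generic q d) (s : Sgn) (i j : ZMod 2) (a b : ℤ) :
    exchangeF q d i j (cartanOp q d κ s i) (addOp q d u h j) a b = 0 := by
  refine end_ext_ket fun t ht => ?_
  have hadd : ∀ k, addOp q d u h j k (ket t) =
      ∑ c ∈ concaveBoxes j ⟨t, ht⟩, pos q d c ^ k • add u h c (ket t) := fun k => by
    rw [ket_eq_single ht, addOp, Finsupp.linearCombination_single, one_smul, ket_eq_single ht]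
  have hc' : ∀ c ∈ concaveBoxes j ⟨t, ht⟩, c ∉ t ∧ color c = j := fun c hc =>
    ⟨(mem_concaveBoxes.1 hc).1, (mem_concaveBoxes.1 hc).2.2⟩
  have h1 : ∀ a b, (cartanOp q d κ s i a * addOp q d u h j b) (ket t) =
      ∑ c ∈ concaveBoxes j ⟨t, ht⟩, (expandCoeff s (fullWeight q d κ (insert c t) i) a *
        pos q d c ^ b) • add u h c (ket t) := by
    intro a b
    rw [Module.End.mul_apply, hadd, map_sum]
    refine Finset.sum_congr rfl fun c hc => ?_
    rw [add_ket u h ht, if_pos (hc' c hc).1, map_smul, map_smul, cartanOp_ket, smul_smul, smul_smul,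
      smul_smul]
    congr 1; ring
  have h2 : ∀ a b, (addOp q d u h j b * cartanOp q d κ s i a) (ket t) =
      ∑ c ∈ concaveBoxes j ⟨t, ht⟩, (expandCoeff s (fullWeight q d κ t i) a *
        pos q d c ^ b) • add u h c (ket t) := by
    intro a b
    rw [Module.End.mul_apply, cartanOp_ket, map_smul, hadd, Finset.smul_sum]
    exact Finset.sum_congr rfl fun c _ => smul_smul _ _ _
  rw [exchangeF, LinearMap.add_apply, LinearMap.smul_apply, gMul_apply_sum h2,
    gMulSwap_apply_sum h1, Finset.smul_sum, ← Finset.sum_add_distrib]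
  refine Finset.sum_eq_zero fun c hc => ?_
  obtain ⟨hct, rfl⟩ := hc' c hc
  rw [smul_smul, ← add_smul]
  have := scalar_exchange G s i c (fullWeight q d κ t i) a b
  rw [← fullWeight_insert hct] at this
  have hs := sgn_mul_self i (color c)
  rw [smul_eq_zero]
  left
  linear_combination sgn i (color c) * this -
    gMul q d i (color c) (fun m n => expandCoeff s (fullWeight q d κ t i) m * pos q d c ^ n) a b * hs

/-! ### The commutator of the currents -/

/-- The operators `E_{i,k}` of the MacMahon module. -/
abbrev opE (q d κ : ℂ) (i : ZMod 2) (k : ℤ) : Module.End ℂ Space :=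
  remOp q d (vacE q d κ) (coeffE q d) i k

/-- The operators `F_{i,k}` of the MacMahon module. -/
abbrev opF (q d : ℂ) (i : ZMod 2) (k : ℤ) : Module.End ℂ Space :=
  addOp q d 1 (coeffF q d) i k

theorem IsCorner.mem_nearBoxes {l : PlanePartition} {b : Box} (hb : IsCorner l.cells b) :
    b ∈ nearBoxes l := by
  rcases hb with ⟨h1, h2⟩ | ⟨h1, -⟩
  · exact mem_nearBoxes_of_concave (mem_concaveBoxes.2 ⟨h1, h2, rfl⟩)
  · exact Finset.mem_union_left _ h1

/-- The diagonal value of the commutator is the sum of residues over the corners of color `i`. These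
are all the poles of the weight, so the residue formula identifies it with the difference of the two
expansions. -/
theorem commutator_opE_opF (G : Generic q d) (hκ : GenericLevel q d κ) (i j : ZMod 2) (a b : ℤ) :
    opE q d κ i a * opF q d j b - opF q d j b * opE q d κ i a =
      if i = j then (q - q⁻¹)⁻¹ •
        (cartanOp q d κ Sgn.plus i (a + b) - cartanOp q d κ Sgn.minus i (a + b)) else 0 := by
  classical
  refine end_ext_ket fun s hs => ?_
  have key := commutator_ket (h := coeffF q d) (h' := coeffE q d) (u := 1) (u' := vacE q d κ) G
    (coeffF_mul_coeffE G) ⟨s, hs⟩ i j a b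
  rw [key]
  split_ifs with hij
  swap
  · rfl
  have cb := fun c => commutator_box G hκ ⟨s, hs⟩ c
  simp only at cb
  simp only [cb]
  rw [LinearMap.smul_apply, LinearMap.sub_apply, cartanOp_ket, cartanOp_ket, ← sub_smul, smul_smul]
  set P : Finset Box := {c ∈ nearBoxes ⟨s, hs⟩ | IsCorner s c ∧ color c = i} with hP
  -- Injectivity allows the sum over poles to be read as a sum over corners.
  have hinj : Set.InjOn (pos q d) P := fun x hx y hy hxy =>
    IsCorner.pos_inj G hs (Finset.mem_filter.1 hx).2.1 (Finset.mem_filter.1 hy).2.1 hxy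
  have hf := fullWeight_ne_zero G hκ s i
  rw [expandCoeff_plus_sub_minus (P.image (pos q d)), Finset.sum_image hinj, Finset.mul_sum,
    Finset.sum_smul]
  · have : P = ({c ∈ nearBoxes ⟨s, hs⟩ | color c = i} : Finset Box).filter (IsCorner s) := by
      rw [hP, Finset.filter_filter]
      exact Finset.filter_congr fun c _ => and_comm
    rw [this, Finset.sum_filter (IsCorner s)]
    refine Finset.sum_congr rfl fun c hc => ?_
    split_ifs
    · rw [(Finset.mem_filter.1 hc).2, smul_smul, zpow_sub_one₀ (pos_ne_zero G c)]
      congr 1; ring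
    · rw [smul_zero]
  · rw [Finset.mem_image]
    rintro ⟨c, -, hc⟩
    exact pos_ne_zero G c hc
  · intro p hp
    by_contra! hneg
    obtain ⟨c, rfl, hci, hcor⟩ := exists_box_of_ordAt_neg G hκ hs hneg
    have hcor' : IsCorner (PlanePartition.mk s hs).cells c := hcor
    exact hp (Finset.mem_image_of_mem _ (Finset.mem_filter.2 ⟨hcor'.mem_nearBoxes, hcor, hci⟩))
  · intro p hp
    obtain ⟨c, hc, rfl⟩ := Finset.mem_image.1 hp
    obtain ⟨-, hcor, rfl⟩ := Finset.mem_filter.1 hc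
    exact (ordAt_fullWeight_corner G hκ hs hcor).ge
  · exact fun n hn => (endValue_fullWeight_plus G s i).expandCoeff_plus_neg hn

end

end Toroidal

/-! ### The representation of the quantum toroidal algebra. -/

namespace Toroidal

noncomputable section

/-! ### The MacMahon module -/

variable {q d κ : ℂ}

/-- The operators of the MacMahon module attached to the generators. -/
def genOp (q d κ : ℂ) : Gen → Module.End ℂ Space
  | Gen.E i k => opE q d κ i k
  | Gen.F i k => opF q d i k
  | Gen.K Sgn.plus i n => cartanOp q d κ Sgn.plus i n
  | Gen.K Sgn.minus i n => cartanOp q d κ Sgn.minus i (-n)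
  | Gen.t => 1
  | Gen.tInv => 1

/-- The representation of the free algebra. -/
def freeRep (q d κ : ℂ) : FreeAlgebra ℂ Gen →ₐ[ℂ] Module.End ℂ Space :=
  FreeAlgebra.lift ℂ (genOp q d κ)

theorem freeRep_ι (g : Gen) : freeRep q d κ (FreeAlgebra.ι ℂ g) = genOp q d κ g :=
  FreeAlgebra.lift_ι_apply _ _

theorem freeRep_freeE (i : ZMod 2) (k : ℤ) : freeRep q d κ (freeE i k) = opE q d κ i k :=
  freeRep_ι _

theorem freeRep_freeF (i : ZMod 2) (k : ℤ) : freeRep q d κ (freeF i k) = opF q d i k :=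
  freeRep_ι _

/-- Outside the half-line of its exponents `freeK` is zero by definition. The matching expansion
coefficients vanish because the weights are regular at zero and at infinity. -/
theorem freeRep_freeK (G : Generic q d) (s : Sgn) (i : ZMod 2) (n : ℤ) :
    freeRep q d κ (freeK s i n) = cartanOp q d κ s i n := by
  cases s
  · rw [freeK]
    split_ifs with hn
    · rw [freeRep_ι, genOp, Int.toNat_of_nonneg hn]
    · rw [map_zero, cartanOp_plus_of_neg G i (not_le.1 hn)]
  · rw [freeK]
    split_ifs with hn
    · rw [freeRep_ι, genOp, Int.toNat_of_nonneg (by omega), neg_neg]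
    · rw [map_zero, cartanOp_minus_of_pos G i (not_le.1 hn)]

section Map

variable (φ : FreeAlgebra ℂ Gen →ₐ[ℂ] Module.End ℂ Space)

theorem map_gMul (i j : ZMod 2) (T : ℤ → ℤ → FreeAlgebra ℂ Gen) (a b : ℤ) :
    φ (gMul q d i j T a b) = gMul q d i j (fun a b => φ (T a b)) a b := by
  rw [gMul, gMul]
  split_ifs <;> simp only [map_add, map_sub, map_smul]

theorem map_exchangeE (i j : ZMod 2) (X Y : ℤ → FreeAlgebra ℂ Gen) (a b : ℤ) :
    φ (exchangeE q d i j X Y a b) = exchangeE q d i j (fun k => φ (X k)) (fun k => φ (Y k)) a b := by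
  simp only [exchangeE, gMulSwap, map_add, map_smul, map_gMul, map_mul]

theorem map_exchangeF (i j : ZMod 2) (X Y : ℤ → FreeAlgebra ℂ Gen) (a b : ℤ) :
    φ (exchangeF q d i j X Y a b) = exchangeF q d i j (fun k => φ (X k)) (fun k => φ (Y k)) a b := by
  simp only [exchangeF, gMulSwap, map_add, map_smul, map_gMul, map_mul]

theorem map_serre (X Y : ℤ → FreeAlgebra ℂ Gen) (a : Fin 3 → ℤ) (b : ℤ) :
    φ (serre q X Y a b) = serre q (fun k => φ (X k)) (fun k => φ (Y k)) a b := by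
  simp only [serre, qBracket, map_sub, map_smul, map_sum, map_mul]

end Map

theorem freeRep_rel (G : Generic q d) (hκ : GenericLevel q d κ) {x y : FreeAlgebra ℂ Gen}
    (h : Rel q d x y) : freeRep q d κ x = freeRep q d κ y := by
  cases h with
  | K_mul_inv i =>
    rw [map_mul, freeRep_freeK G, freeRep_freeK G, cartanOp_plus_mul_minus G hκ.ne_zero, map_one]
  | K_inv_mul i =>
    rw [map_mul, freeRep_freeK G, freeRep_freeK G, cartanOp_comm,
      cartanOp_plus_mul_minus G hκ.ne_zero, map_one]
  | K_K s s' i j a b =>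
    rw [map_mul, map_mul, freeRep_freeK G, freeRep_freeK G, cartanOp_comm]
  | K_E s i j a b =>
    rw [map_exchangeE, map_zero]
    simp only [freeRep_freeK G, freeRep_freeE]
    exact cartanOp_remOp_exchangeE G s i j a b
  | K_F s i j a b =>
    rw [map_exchangeF, map_zero]
    simp only [freeRep_freeK G, freeRep_freeF]
    exact cartanOp_addOp_exchangeF G s i j a b
  | E_F i j a b =>
    rw [map_sub, map_mul, map_mul, freeRep_freeE, freeRep_freeF, commutator_opE_opF G hκ]
    split_ifs
    · rw [map_smul, map_sub, freeRep_freeK G, freeRep_freeK G]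
    · rw [map_zero]
  | E_E i j a b =>
    rw [map_exchangeE, map_zero]
    simp only [freeRep_freeE]
    exact remOp_exchangeE G exchangeSystem_coeffE i j a b
  | F_F i j a b =>
    rw [map_exchangeF, map_zero]
    simp only [freeRep_freeF]
    exact addOp_exchangeF G exchangeSystem_coeffF i j a b
  | serre_E i a b =>
    rw [map_serre, map_zero]
    simp only [freeRep_freeE]
    exact remOp_serre G exchangeSystem_coeffE i a b
  | serre_F i a b =>
    rw [map_serre, map_zero]
    simp only [freeRep_freeF]
    exact addOp_serre G exchangeSystem_coeffF i a b
  | t_mul_inv => rw [map_mul, freeRep_ι, freeRep_ι, map_one]; exact one_mul 1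
  | t_inv_mul => rw [map_mul, freeRep_ι, freeRep_ι, map_one]; exact one_mul 1
  | t_central g =>
    rw [map_mul, map_mul, freeRep_ι, freeRep_ι]
    exact (one_mul _).trans (mul_one _).symm

/-- The representation of the quantum toroidal algebra on the space of plane partitions. -/
def macMahonRep (G : Generic q d) (hκ : GenericLevel q d κ) : Alg q d →ₐ[ℂ] Module.End ℂ Space :=
  RingQuot.liftAlgHom ℂ ⟨freeRep q d κ, fun _ _ h => freeRep_rel G hκ h⟩

theorem macMahonRep_mk (G : Generic q d) (hκ : GenericLevel q d κ) (x : FreeAlgebra ℂ Gen) :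
    macMahonRep G hκ (RingQuot.mkAlgHom ℂ (Rel q d) x) = freeRep q d κ x :=
  RingQuot.liftAlgHom_mkAlgHom_apply ..

/-- The MacMahon module. -/
abbrev macMahonModule (G : Generic q d) (hκ : GenericLevel q d κ) : Module (Alg q d) Space :=
  Module.compHom Space (macMahonRep G hκ).toRingHom

theorem remOp_ket_convex {u : Box → ℂ} {h : Box → Box → ℂ} (l : PlanePartition) (i : ZMod 2)
    (k : ℤ) : remOp q d u h i k (ket l.cells) = ∑ b ∈ convexBoxes i l,
      (u b * (∏ c ∈ l.cells.erase b, h c b) * pos q d b ^ k) • ket (l.cells.erase b) := by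
  rw [remOp_ket (B := l.cells) l subset_rfl, remOpIn, LinearMap.sum_apply]
  have hsub : convexBoxes i l ⊆ {b ∈ l.cells | color b = i} := fun b hb =>
    Finset.mem_filter.2 ⟨(mem_convexBoxes.1 hb).1, (mem_convexBoxes.1 hb).2.2⟩
  rw [← Finset.sum_subset hsub]
  · refine Finset.sum_congr rfl fun b hb => ?_
    rw [LinearMap.smul_apply, rem_ket u h l.isLowerSet, if_pos (mem_convexBoxes.1 hb).1, smul_smul,
      mul_comm]
  · intro b hb hb'
    obtain ⟨h1, h2⟩ := Finset.mem_filter.1 hb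
    rw [LinearMap.smul_apply, rem_ket u h l.isLowerSet, if_pos h1, ket_eq_zero, smul_zero,
      smul_zero]
    exact fun h3 => hb' (mem_convexBoxes.2 ⟨h1, h3, h2⟩)

theorem addOp_ket_concave {u : Box → ℂ} {h : Box → Box → ℂ} (l : PlanePartition) (i : ZMod 2)
    (k : ℤ) : addOp q d u h i k (ket l.cells) = ∑ b ∈ concaveBoxes i l,
      (u b * (∏ c ∈ l.cells, h c b) * pos q d b ^ k) • ket (insert b l.cells) := by
  rw [ket_cells, addOp, Finsupp.linearCombination_single, one_smul]
  refine Finset.sum_congr rfl fun b hb => ?_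
  rw [add_ket u h l.isLowerSet, if_pos (mem_concaveBoxes.1 hb).1, smul_smul, mul_comm]

theorem isCombinatorialAction_macMahon (G : Generic q d) (hκ : GenericLevel q d κ) :
    @IsCombinatorialAction q d (psiMacMahon κ) (macMahonModule G hκ) := by
  let _ := macMahonModule G hκ
  refine ⟨fun l s i n => ?_, fun i k l => ?_, fun i k l => ?_, fun v => ?_⟩
  · change macMahonRep G hκ (RingQuot.mkAlgHom ℂ (Rel q d) (freeK s i n)) _ = _
    rw [macMahonRep_mk, freeRep_freeK G, cartanOp_ket]
    rfl
  · change macMahonRep G hκ (RingQuot.mkAlgHom ℂ (Rel q d) (freeF i k)) _ = _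
    rw [macMahonRep_mk, freeRep_freeF, addOp_ket_concave]
    refine Finset.sum_congr rfl fun b hb => ?_
    rw [coeffA_eq G hκ hb, Pi.one_apply, one_mul]
  · change macMahonRep G hκ (RingQuot.mkAlgHom ℂ (Rel q d) (freeE i k)) _ = _
    rw [macMahonRep_mk, freeRep_freeE, remOp_ket_convex]
    refine Finset.sum_congr rfl fun b hb => ?_
    rw [coeffB_eq G hκ hb]
  · change macMahonRep G hκ (RingQuot.mkAlgHom ℂ (Rel q d) (FreeAlgebra.ι ℂ Gen.t)) _ = _
    rw [macMahonRep_mk, freeRep_ι]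
    rfl

end

end Toroidal

/-! ### Tameness, irreducibility, highest weight and level. -/

namespace Toroidal

noncomputable section

variable {q d κ : ℂ}

/-! ### Distinctness of the weights -/

/-- The number of boxes on a diagonal line. -/
def lineCount (s : Finset Box) (x y z : ℤ) : ℤ := ∑ c ∈ s, ind (OnLine c x y z)

theorem sum_boxOrd_eq_lineCount (s : Finset Box) (x y z : ℤ) :
    ∑ c ∈ s, boxOrd c x y z = lineCount s (x + 1) y z + lineCount s x (y + 1) z +
      lineCount s x y (z + 1) - lineCount s (x - 1) y z - lineCount s x (y - 1) z -
      lineCount s x y (z - 1) := by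
  simp only [boxOrd, lineCount, Finset.sum_sub_distrib, Finset.sum_add_distrib]

/-- The form `x - 2y + z` is constant on diagonal lines, and line counts vanish where it is large.
Descending induction on this level recovers the counts from the orders. -/
theorem lineCount_eq_of_sum_boxOrd_eq {s t : Finset Box}
    (h : ∀ x y z : ℤ, ∑ c ∈ s, boxOrd c x y z = ∑ c ∈ t, boxOrd c x y z) (x y z : ℤ) :
    lineCount s x y z = lineCount t x y z := by
  obtain ⟨M, hM⟩ := ((s ∪ t).image fun c : Box => (c.1 : ℤ) - 2 * c.2.1 + c.2.2).exists_le
  have hzero : ∀ r ⊆ s ∪ t, ∀ x y z : ℤ, M < x - 2 * y + z → lineCount r x y z = 0 := by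
    intro r hr x y z hlt
    refine Finset.sum_eq_zero fun c hc => ind_neg ?_
    rintro ⟨h1, h2⟩
    have := hM _ (Finset.mem_image_of_mem _ (hr hc))
    omega
  have key : ∀ k : ℕ, ∀ x y z : ℤ, M - k < x - 2 * y + z →
      lineCount s x y z = lineCount t x y z := by
    intro k
    induction k with
    | zero =>
      intro x y z hlt
      rw [hzero s Finset.subset_union_left x y z (by simpa using hlt),
        hzero t Finset.subset_union_right x y z (by simpa using hlt)]
    | succ k ih =>
      intro x y z hlt
      push_cast at hlt
      -- Among the six lines in the equation at `(x, y - 1, z)`, the one through `(x, y, z)` has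
      -- strictly the lowest level, so its count is determined by the others.
      have h1 := h x (y - 1) z
      rw [sum_boxOrd_eq_lineCount, sum_boxOrd_eq_lineCount, sub_add_cancel,
        ih (x + 1) (y - 1) z (by omega), ih x (y - 1) (z + 1) (by omega),
        ih (x - 1) (y - 1) z (by omega), ih x (y - 1 - 1) z (by omega),
        ih x (y - 1) (z - 1) (by omega)] at h1
      omega
  exact key (M - (x - 2 * y + z) + 1).toNat x y z (by omega)

/-- A plane partition meets a diagonal line in an initial segment. If `b` lies in `s` but not in
`t`, then the segment of `t` stops before `b` and is strictly shorter. -/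
theorem subset_of_lineCount_eq {s t : Finset Box} (hs : IsLowerSet (s : Set Box))
    (ht : IsLowerSet (t : Set Box))
    (h : ∀ x y z : ℤ, lineCount s x y z = lineCount t x y z) : s ⊆ t := by
  classical
  intro b hb
  by_contra hbt
  have h1 := h b.1 b.2.1 b.2.2
  have hcount : ∀ r : Finset Box, lineCount r b.1 b.2.1 b.2.2 =
      ({c ∈ r | OnLine c b.1 b.2.1 b.2.2} : Finset Box).card := by
    intro r
    simp only [lineCount, ind]
    rw [Finset.sum_boole]
  rw [hcount, hcount, Nat.cast_inj] at h1
  refine h1.not_gt (Finset.card_lt_card ⟨fun c hc => ?_, fun hsub => ?_⟩)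
  · obtain ⟨hct, hon⟩ := Finset.mem_filter.1 hc
    refine Finset.mem_filter.2 ⟨?_, hon⟩
    obtain ⟨x, y, z⟩ := b
    obtain ⟨x', y', z'⟩ := c
    simp only [OnLine] at hon
    rcases le_total x x' with hx | hx
    · refine absurd (ht (b := (x, y, z)) ?_ hct) hbt
      simp only [Prod.mk_le_mk]; omega
    · refine hs (b := (x', y', z')) ?_ hb
      simp only [Prod.mk_le_mk]; omega
  · refine hbt (Finset.mem_filter.1 (hsub (Finset.mem_filter.2 ⟨hb, ?_⟩))).1
    simp only [OnLine]; omega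

theorem lWeight_injective (G : Generic q d) (hκ : GenericLevel q d κ) :
    Function.Injective (lWeight q d (psiMacMahon κ)) := by
  intro l m hlm
  have h : ∀ x y z : ℤ, ∑ c ∈ l.cells, boxOrd c x y z = ∑ c ∈ m.cells, boxOrd c x y z := by
    intro x y z
    have h1 : fullWeight q d κ l.cells (colorZ x z) = fullWeight q d κ m.cells (colorZ x z) :=
      congrFun hlm (colorZ x z)
    have h2 := ordAt_fullWeight G hκ l.cells x y z
    rw [h1, ordAt_fullWeight G hκ] at h2
    omega
  have hN := lineCount_eq_of_sum_boxOrd_eq h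
  exact PlanePartition.ext ((subset_of_lineCount_eq l.isLowerSet m.isLowerSet hN).antisymm
    (subset_of_lineCount_eq m.isLowerSet l.isLowerSet fun x y z => (hN x y z).symm))

/-! ### Properties of the MacMahon module -/

theorem exists_convex (l : PlanePartition) (hl : l.cells.Nonempty) :
    ∃ b, b ∈ convexBoxes (color b) l := by
  obtain ⟨b, hb⟩ := l.cells.exists_maximal hl
  exact ⟨b, mem_convexBoxes.2 ⟨hb.prop, isLowerSet_erase l.isLowerSet
    fun c hc hbc => le_antisymm (hb.2 hc hbc) hbc, rfl⟩⟩

section Action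

variable [Module (Alg q d) Space]

theorem IsCombinatorialAction.isTame (hact : IsCombinatorialAction q d (psiMacMahon κ))
    (G : Generic q d) (hκ : GenericLevel q d κ) : IsTame q d Space := by
  refine ⟨PlanePartition, Finsupp.basisSingleOne, lWeight q d (psiMacMahon κ),
    lWeight_injective G hκ, fun l => ?_⟩
  have := hact.K_ket l
  rwa [ket_cells] at this

variable [IsScalarTower ℂ (Alg q d) Space]

theorem IsCombinatorialAction.K_smul_apply (hact : IsCombinatorialAction q d (psiMacMahon κ))
    (s : Sgn) (i : ZMod 2) (n : ℤ) (v : Space) (l : PlanePartition) :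
    (K q d s i n • v) l = expandCoeff s (lWeight q d (psiMacMahon κ) l i) n * v l := by
  induction v using Finsupp.induction_linear with
  | zero => rw [smul_zero, Finsupp.zero_apply, mul_zero]
  | add v w hv hw => rw [smul_add, Finsupp.add_apply, hv, hw, Finsupp.add_apply, mul_add]
  | single m c =>
    have h1 : (Finsupp.single m c : Space) = c • ket m.cells := by
      rw [ket_cells, Finsupp.smul_single_one]
    rw [h1, smul_algebra_smul_comm, hact.K_ket m s i n, ket_cells]
    by_cases hm : m = l
    · subst hm
      simp [mul_comm]
    · simp [Finsupp.single_eq_of_ne (Ne.symm hm)]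

/-- Separation of distinct joint eigenvalues: subtracting from a suitable Cartan coefficient its
eigenvalue at another partition `m` kills the component at `m`, keeps the one at `l`, and enlarges
no support. -/
theorem IsCombinatorialAction.ket_mem_of_mem (hact : IsCombinatorialAction q d (psiMacMahon κ))
    (G : Generic q d) (hκ : GenericLevel q d κ) (N : Submodule (Alg q d) Space) {v : Space}
    (hv : v ∈ N) {l : PlanePartition} (hl : v l ≠ 0) : ket l.cells ∈ N := by
  induction hn : v.support.card using Nat.strong_induction_on generalizing v with
  | _ n ih =>
    by_cases hm : ∃ m, m ≠ l ∧ v m ≠ 0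
    · obtain ⟨m, hml, hvm⟩ := hm
      obtain ⟨i, hi⟩ := Function.ne_iff.1 ((lWeight_injective G hκ).ne hml)
      obtain ⟨k, hk⟩ : ∃ k, expandCoeff Sgn.minus (lWeight q d (psiMacMahon κ) m i) k ≠
          expandCoeff Sgn.minus (lWeight q d (psiMacMahon κ) l i) k := by
        by_contra! hall
        exact hi (expandCoeff_injective hall)
      set e := expandCoeff Sgn.minus (lWeight q d (psiMacMahon κ) m i) k
      have happ : ∀ p, (K q d Sgn.minus i k • v - e • v) p =
          (expandCoeff Sgn.minus (lWeight q d (psiMacMahon κ) p i) k - e) * v p := by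
        intro p
        rw [Finsupp.sub_apply, hact.K_smul_apply, Finsupp.smul_apply, smul_eq_mul, sub_mul]
      refine ih _ ?_ (N.sub_mem (N.smul_mem (K q d Sgn.minus i k) hv)
        (N.smul_of_tower_mem e hv)) ?_ rfl
      · rw [← hn]
        refine Finset.card_lt_card ⟨fun p hp => ?_, fun hsub => ?_⟩
        · rw [Finsupp.mem_support_iff, happ] at hp
          exact Finsupp.mem_support_iff.2 (right_ne_zero_of_mul hp)
        · have := hsub (Finsupp.mem_support_iff.2 hvm)
          rw [Finsupp.mem_support_iff, happ, sub_self, zero_mul] at this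
          exact this rfl
      · rw [happ]
        exact mul_ne_zero (sub_ne_zero.2 hk.symm) hl
    · push Not at hm
      have : v = v l • ket l.cells := by
        ext p
        rw [Finsupp.smul_apply, ket_cells]
        by_cases hp : p = l
        · simp [hp]
        · rw [hm p hp, Finsupp.single_eq_of_ne hp, smul_zero]
      have h2 := N.smul_of_tower_mem (v l)⁻¹ hv
      rwa [this, smul_smul, Finsupp.smul_apply, ket_cells, Finsupp.single_eq_same, smul_eq_mul,
        mul_one, inv_mul_cancel₀ hl, one_smul, ← ket_cells] at h2

theorem sum_smul_ket_apply {S : Finset Box} {f : Box → Finset Box} {c : Box → ℂ}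
    (hf : Set.InjOn f S) {b : Box} (hb : b ∈ S) (hl : IsLowerSet (f b : Set Box)) :
    (∑ x ∈ S, c x • ket (f x)) ⟨f b, hl⟩ = c b := by
  rw [Finsupp.finsetSum_apply, Finset.sum_eq_single_of_mem b hb, ket_eq_single hl,
    Finsupp.smul_apply, Finsupp.single_eq_same, smul_eq_mul, mul_one]
  intro x hx hxb
  by_cases hx' : IsLowerSet (f x : Set Box)
  · rw [ket_eq_single hx', Finsupp.smul_apply, Finsupp.single_eq_of_ne, smul_zero]
    intro h
    exact hxb (hf hx hb (congrArg PlanePartition.cells h).symm)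
  · rw [ket_eq_zero hx', smul_zero, Finsupp.zero_apply]

/-- The component of `E_{i,0} |λ⟩` at this smaller partition is non-zero, and weight separation
isolates it. -/
theorem IsCombinatorialAction.ket_erase_mem (hact : IsCombinatorialAction q d (psiMacMahon κ))
    (G : Generic q d) (hκ : GenericLevel q d κ) (N : Submodule (Alg q d) Space)
    {l : PlanePartition} (hl : ket l.cells ∈ N) {i : ZMod 2} {b : Box} (hb : b ∈ convexBoxes i l) :
    ket (l.cells.erase b) ∈ N := by
  obtain ⟨h1, h2, -⟩ := mem_convexBoxes.1 hb
  refine hact.ket_mem_of_mem G hκ N (N.smul_mem (E q d i 0) hl)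
    (l := ⟨l.cells.erase b, h2⟩) ?_
  rw [hact.E_ket, sum_smul_ket_apply (f := fun x => l.cells.erase x) _ hb h2, coeffB_eq G hκ hb,
    zpow_zero, mul_one]
  · exact vacE_mul_prod_coeffE_ne_zero G hκ _ _
  · intro x hx y _ hxy
    by_contra hne
    have : x ∈ l.cells.erase y := Finset.mem_erase.2 ⟨hne, (mem_convexBoxes.1 hx).1⟩
    rw [← show l.cells.erase x = l.cells.erase y from hxy] at this
    exact Finset.notMem_erase _ _ this

theorem IsCombinatorialAction.ket_insert_mem (hact : IsCombinatorialAction q d (psiMacMahon κ))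
    (G : Generic q d) (hκ : GenericLevel q d κ) (N : Submodule (Alg q d) Space)
    {l : PlanePartition} (hl : ket l.cells ∈ N) {i : ZMod 2} {b : Box} (hb : b ∈ concaveBoxes i l) :
    ket (insert b l.cells) ∈ N := by
  obtain ⟨h1, h2, -⟩ := mem_concaveBoxes.1 hb
  refine hact.ket_mem_of_mem G hκ N (N.smul_mem (F q d i 0) hl)
    (l := ⟨insert b l.cells, h2⟩) ?_
  rw [hact.F_ket, sum_smul_ket_apply (f := fun x => insert x l.cells) _ hb h2, coeffA_eq G hκ hb,
    zpow_zero, mul_one]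
  · exact prod_coeffF_ne_zero G _ _
  · intro x hx y _ hxy
    have : x ∈ insert y l.cells := by
      rw [← show insert x l.cells = insert y l.cells from hxy]; exact Finset.mem_insert_self _ _
    exact (Finset.mem_insert.1 this).resolve_right (mem_concaveBoxes.1 hx).1

theorem IsCombinatorialAction.ket_empty_mem (hact : IsCombinatorialAction q d (psiMacMahon κ))
    (G : Generic q d) (hκ : GenericLevel q d κ) (N : Submodule (Alg q d) Space)
    (l : PlanePartition) (hl : ket l.cells ∈ N) : ket ∅ ∈ N := by
  induction hn : l.cells.card generalizing l with
  | zero => rwa [Finset.card_eq_zero.1 hn] at hl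
  | succ n ih =>
    obtain ⟨b, hb⟩ := exists_convex l (Finset.card_pos.1 (by omega))
    obtain ⟨h1, h2, -⟩ := mem_convexBoxes.1 hb
    refine ih ⟨l.cells.erase b, h2⟩ (hact.ket_erase_mem G hκ N hl hb) ?_
    simp only
    rw [Finset.card_erase_of_mem h1, hn, Nat.add_sub_cancel]

theorem IsCombinatorialAction.ket_mem_of_empty (hact : IsCombinatorialAction q d (psiMacMahon κ))
    (G : Generic q d) (hκ : GenericLevel q d κ) (N : Submodule (Alg q d) Space)
    (h : ket ∅ ∈ N) (l : PlanePartition) : ket l.cells ∈ N := by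
  induction hn : l.cells.card generalizing l with
  | zero => rwa [Finset.card_eq_zero.1 hn]
  | succ n ih =>
    obtain ⟨b, hb⟩ := exists_convex l (Finset.card_pos.1 (by omega))
    obtain ⟨h1, h2, -⟩ := mem_convexBoxes.1 hb
    have h3 := ih ⟨l.cells.erase b, h2⟩ (by
      simp only
      rw [Finset.card_erase_of_mem h1, hn, Nat.add_sub_cancel])
    have h4 := hact.ket_insert_mem G hκ N h3 (i := color b) (b := b) (mem_concaveBoxes.2
      ⟨Finset.notMem_erase _ _, by
        simp only
        rw [Finset.insert_erase h1]; exact l.isLowerSet, rfl⟩)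
    simp only at h4
    rwa [Finset.insert_erase h1] at h4

theorem IsCombinatorialAction.isSimpleModule (hact : IsCombinatorialAction q d (psiMacMahon κ))
    (G : Generic q d) (hκ : GenericLevel q d κ) : IsSimpleModule (Alg q d) Space := by
  have hnt : Nontrivial Space := ⟨⟨ket ∅, 0, by
    have := ket_cells PlanePartition.empty
    rw [show (∅ : Finset Box) = PlanePartition.empty.cells from rfl, this]
    simp⟩⟩
  rw [isSimpleModule_iff]
  refine { exists_pair_ne := ⟨⊥, ⊤, bot_ne_top⟩, eq_bot_or_eq_top := fun N => ?_ }
  refine or_iff_not_imp_left.2 fun hN => ?_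
  obtain ⟨v, hv, hv0⟩ := Submodule.exists_mem_ne_zero_of_ne_bot hN
  obtain ⟨l, hl⟩ := Finsupp.ne_iff.1 hv0
  have hall := hact.ket_mem_of_empty G hκ N
    (hact.ket_empty_mem G hκ N l (hact.ket_mem_of_mem G hκ N hv hl))
  refine eq_top_iff.2 fun w _ => ?_
  induction w using Finsupp.induction_linear with
  | zero => exact N.zero_mem
  | add v w hv hw => exact N.add_mem (hv trivial) (hw trivial)
  | single m c =>
    rw [← Finsupp.smul_single_one, ← ket_cells]
    exact N.smul_of_tower_mem c (hall m)

theorem IsCombinatorialAction.isHighestLWeight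
    (hact : IsCombinatorialAction q d (psiMacMahon κ)) (G : Generic q d)
    (hκ : GenericLevel q d κ) : IsHighestLWeight q d Space (psiMacMahon κ) := by
  have hs := hact.isSimpleModule G hκ
  have hne : ket PlanePartition.empty.cells ≠ 0 := by
    rw [ket_cells]; simp
  refine ⟨ket PlanePartition.empty.cells, hne, ?_, fun i k => ?_, ?_⟩
  · have := hact.K_ket PlanePartition.empty
    have e : lWeight q d (psiMacMahon κ) PlanePartition.empty = psiMacMahon κ := by
      rw [lWeight, boxesWeight]
      exact (congrArg _ Finset.prod_empty).trans (mul_one _)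
    rwa [e] at this
  · rw [hact.E_ket, Finset.sum_eq_zero]
    intro b hb
    exact absurd (mem_convexBoxes.1 hb).1 (Finset.notMem_empty b)
  -- By irreducibility any non-zero vector generates.
  · exact (eq_bot_or_eq_top _).resolve_left fun h => hne (Submodule.span_singleton_eq_bot.1 h)

theorem IsCombinatorialAction.hasLevel (hact : IsCombinatorialAction q d (psiMacMahon κ))
    (G : Generic q d) : HasLevel q d Space κ := by
  intro v
  ext l
  have h1 := (endValue_fullWeight_plus (κ := κ) G l.cells 0).expandCoeff_zero
  have h2 := (endValue_fullWeight_plus (κ := κ) G l.cells 1).expandCoeff_zero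
  rw [mul_smul, hact.K_smul_apply, hact.K_smul_apply, ← mul_assoc, Finsupp.smul_apply, smul_eq_mul]
  congr 1
  exact (congrArg₂ _ h1 h2).trans (weightEnd_zero_mul_one G _)

end Action

end

end Toroidal

open Toroidal in
theorem mainTheorem6 (q d : ℂ) (hq : q ≠ 0) (hd : d ≠ 0)
    (hqd : ∀ m n : ℤ, q ^ m * d ^ n = 1 → m = 0 ∧ n = 0)
    (κ : ℂ) (hκ₀ : κ ≠ 0)
    (hκ : ∀ i j k : ℕ, Even (i + k) → κ ^ 2 ≠ q₁ q d ^ i * q₂ q ^ j * q₃ q d ^ k) :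
    (∀ (i : ZMod 2) (l : PlanePartition), ∀ b ∈ concaveBoxes i l,
      RegularAt (lWeightAbove q d l b i) (pos q d b)) ∧
    ∃ (_ : Module (Alg q d) Space) (_ : IsScalarTower ℂ (Alg q d) Space),
      IsCombinatorialAction q d (psiMacMahon κ) ∧
      IsSimpleModule (Alg q d) Space ∧
      IsTame q d Space ∧
      IsHighestLWeight q d Space (psiMacMahon κ) ∧
      HasLevel q d Space κ := by
  have G : Generic q d := ⟨hq, hd, hqd⟩
  have hlevel : GenericLevel q d κ := .of_ne G hκ₀ hκ
  refine ⟨fun i l b hb => regularAt_lWeightAbove G hlevel hb, macMahonModule G hlevel, ?_⟩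
  let _ := macMahonModule G hlevel
  -- The complex structure induced by the algebra action agrees with the one already on `Space`,
  -- because the representation is `ℂ`-linear.
  have htower : IsScalarTower ℂ (Alg q d) Space := ⟨fun c a v => by
    change macMahonRep G hlevel (c • a) v = c • macMahonRep G hlevel a v
    rw [map_smul, LinearMap.smul_apply]⟩
  have hact := isCombinatorialAction_macMahon G hlevel
  exact ⟨htower, hact, hact.isSimpleModule G hlevel, hact.isTame G hlevel,
    hact.isHighestLWeight G hlevel, hact.hasLevel G⟩
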